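/- Let $V=\mathbb C^4$ and let $Q_1,Q_2,Q_3$ be a basis of a regular net of quadrics on $V$, i.e. linearly independent symmetric complex $4\times4$ matrices such that, with $Q_t=t_1Q_1+t_2Q_2+t_3Q_3$, the plane curve $C=\{t\in\mathbb P^2\mid \det Q_t=0\}$ of singular members is a smooth quartic. Let $b_1,\dots,b_8\in\mathbb P(V)$ be the eight distinct base points of the net, let $H_i\subset\mathbb P(V^*)$ be the plane dual to $b_i$, and let $$\pi: X=\Big\{\eta^2=\prod_{i=1}^8(b_{i1}\xi_1+b_{i2}\xi_2+b_{i3}\xi_3+b_{i4}\xi_4)\Big\}\subset\mathbb P(1,1,1,1,4)\longrightarrow\mathbb P(V^*),\qquad(\xi:\eta)\mapsto(\xi),$$ be the double covering branched along $H_1\cup\dots\cup H_8$. For $t\in C$ the quadric $Z(Q_t)$ is a cone over a smooth conic; let $\gamma_t\subset\mathbb P(V^*)$ be the smooth conic of all planes tangent to $Z(Q_t)$ (at smooth points of $Z(Q_t)$). Let $C^\#\to C$ be the étale double covering formed by the two irreducible components of $\pi^{-1}(\gamma_t)$ as $t$ runs over $C$; that is, $C^\#$ is the Stein factorization over $C$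 of the normalization of the variety $\{(t,x)\in C\times X\mid \pi(x)\in\gamma_t\}$. Then this covering is trivial: there is an isomorphism $C^\#\cong C\sqcup C$ over $C$. -/

import Mathlib

open AlgebraicGeometry CategoryTheory Limits MvPolynomial

noncomputable section

namespace CayleyOctad

/-! ### Normalization and Stein factorization of schemes -/

section General

/-- The morphism to `X` from the disjoint union of the spectra of the residue fields at
the generic points of the irreducible components of `X`. -/
abbrev fromGenericPoints (X : Scheme.{0}) :
    (∐ fun η : genericPoints X => Spec (X.residueField η.1)) ⟶ X :=
  Sigma.desc fun η : genericPoints X => X.fromSpecResidueField η.1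

theorem finite_genericPoints (X : Scheme.{0}) [IsNoetherian X] : Finite (genericPoints X) :=
  (genericPoints.finite (finite_irreducibleComponents_of_isNoetherian (X := X))).to_subtype

instance (X : Scheme.{0}) [IsNoetherian X] : QuasiSeparated (fromGenericPoints X) := by
  have := finite_genericPoints X
  infer_instance

instance (X : Scheme.{0}) [IsNoetherian X] : QuasiCompact (fromGenericPoints X) := by
  have := finite_genericPoints X
  infer_instance

/-- The normalization of a (noetherian) scheme `X`: the normalization of `X` in the
disjoint union of the spectra of the residue fields at its generic points. -/
abbrev absNormalization (X : Scheme.{0}) [IsNoetherian X] : Scheme.{0} :=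
  (fromGenericPoints X).normalization

/-- The (integral) normalization morphism. -/
abbrev absNormalizationMap (X : Scheme.{0}) [IsNoetherian X] : absNormalization X ⟶ X :=
  (fromGenericPoints X).fromNormalization

/-- The middle term `Z'` of the Stein factorization `Z ⟶ Z' ⟶ S` of a proper morphism `f`:
the normalization of `S` in `Z`, i.e. the relative spectrum of the integral closure of the
structure sheaf of `S` in the direct image of that of `Z`.  (For proper `f` over a locally
noetherian base the direct image is itself integral, so this is the relative spectrum of the
direct image.) -/
abbrev steinFactor {Z S : Scheme.{0}} (f : Z ⟶ S) [QuasiCompact f] [QuasiSeparated f] :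
    Scheme.{0} :=
  f.normalization

/-- The integral morphism `Z' ⟶ S` of the Stein factorization. -/
abbrev steinFactorMap {Z S : Scheme.{0}} (f : Z ⟶ S) [QuasiCompact f] [QuasiSeparated f] :
    steinFactor f ⟶ S :=
  f.fromNormalization

/-- The reduced closed subscheme supported on a closed subset. -/
abbrev reducedSubscheme {X : Scheme.{0}} (Z : TopologicalSpace.Closeds X) : Scheme.{0} :=
  (Scheme.IdealSheafData.vanishingIdeal Z).subscheme

/-- The inclusion of the reduced closed subscheme supported on a closed subset. -/
abbrev reducedSubschemeι {X : Scheme.{0}} (Z : TopologicalSpace.Closeds X) :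
    reducedSubscheme Z ⟶ X :=
  (Scheme.IdealSheafData.vanishingIdeal Z).subschemeι

end General

/-! ### Weighted projective spaces over the complex numbers -/

section Projective

variable {σ : Type} (w : σ → ℕ)

instance : GradedAlgebra (weightedHomogeneousSubmodule ℂ w) := weightedGradedAlgebra ℂ w

/-- The weighted projective space over `ℂ` with weights `w`. -/
abbrev WProj : Scheme.{0} := Proj (weightedHomogeneousSubmodule ℂ w)

/-- The structure morphism of the weighted projective space. -/
def WProj.toSpec : WProj w ⟶ Spec (.of ℂ) :=
  Proj.toSpecZero (weightedHomogeneousSubmodule ℂ w) ≫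
    Spec.map (CommRingCat.ofHom (algebraMap ℂ (weightedHomogeneousSubmodule ℂ w 0)))

/-- The closed subset of the weighted projective space defined by the vanishing of `p`. -/
def WProj.zeros (p : MvPolynomial σ ℂ) : TopologicalSpace.Closeds (WProj w) :=
  ⟨ProjectiveSpectrum.zeroLocus (weightedHomogeneousSubmodule ℂ w) {p},
    ProjectiveSpectrum.isClosed_zeroLocus _ _⟩

/-- The reduced closed subscheme of the weighted projective space with equation `p = 0`. -/
abbrev WProj.hypersurface (p : MvPolynomial σ ℂ) : Scheme.{0} := reducedSubscheme (WProj.zeros w p)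

/-- The inclusion of the hypersurface `p = 0`. -/
abbrev WProj.hypersurfaceι (p : MvPolynomial σ ℂ) : WProj.hypersurface w p ⟶ WProj w :=
  reducedSubschemeι (WProj.zeros w p)

/-- `x` is the complex point of the weighted projective space with homogeneous
coordinates `v`. -/
def WProj.HasCoords (x : WProj w) (v : σ → ℂ) : Prop :=
  v ≠ 0 ∧ ∀ (n : ℕ) (p : MvPolynomial σ ℂ), p ∈ weightedHomogeneousSubmodule ℂ w n →
    (p ∈ ProjectiveSpectrum.asHomogeneousIdeal
      (𝒜 := weightedHomogeneousSubmodule ℂ w) x ↔ eval v p = 0)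

theorem algebraMap_gradeZero_surjective (hw : ∀ i, w i ≠ 0) :
    Function.Surjective (algebraMap ℂ (weightedHomogeneousSubmodule ℂ w 0)) := by
  classical
  rintro ⟨p, hp⟩
  refine ⟨coeff 0 p, Subtype.ext ?_⟩
  change C (coeff 0 p) = p
  rw [mem_weightedHomogeneousSubmodule] at hp
  ext d
  rw [coeff_C]
  split_ifs with h
  · rw [← h]
  · by_contra hne
    have h1 := hp (Ne.symm hne)
    have : Finsupp.NonTorsionWeight ℕ w :=
      Finsupp.nonTorsionWeight_of _ _ hw
    exact h (((Finsupp.weight_eq_zero_iff_eq_zero w).1 h1).symm)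

/-- The structure morphism of a weighted projective space with positive weights is proper. -/
theorem WProj.isProper_toSpec [Finite σ] (hw : ∀ i, w i ≠ 0) : IsProper (WProj.toSpec w) := by
  have : IsScalarTower ℂ (weightedHomogeneousSubmodule ℂ w 0) (MvPolynomial σ ℂ) :=
    ⟨fun c x y => smul_mul_assoc c (x : MvPolynomial σ ℂ) y⟩
  have : Algebra.FiniteType (weightedHomogeneousSubmodule ℂ w 0) (MvPolynomial σ ℂ) :=
    Algebra.FiniteType.of_restrictScalars_finiteType ℂ _ _
  have : IsClosedImmersion (Spec.map (CommRingCat.ofHom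
      (algebraMap ℂ (weightedHomogeneousSubmodule ℂ w 0)))) :=
    IsClosedImmersion.spec_of_surjective _ (algebraMap_gradeZero_surjective w hw)
  unfold WProj.toSpec
  infer_instance

end Projective

/-! ### The net of quadrics, the octad, and the two varieties `C` and `X` -/

/-- The symmetric matrix `t₁ Q₁ + t₂ Q₂ + t₃ Q₃` of the member of the net with parameter `t`. -/
def member (Q : Fin 3 → Matrix (Fin 4) (Fin 4) ℂ) (t : Fin 3 → ℂ) : Matrix (Fin 4) (Fin 4) ℂ :=
  ∑ k, t k • Q k

/-- The discriminant `det (t₁ Q₁ + t₂ Q₂ + t₃ Q₃)` as a polynomial in `t`. -/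
def discriminant (Q : Fin 3 → Matrix (Fin 4) (Fin 4) ℂ) : MvPolynomial (Fin 3) ℂ :=
  (∑ k, (X k : MvPolynomial (Fin 3) ℂ) • (Q k).map C).det

/-- `Q₁, Q₂, Q₃` is a basis of a net of quadrics in projective three-space whose locus of
singular members is a smooth plane curve (Jacobian criterion). -/
structure IsRegularNet (Q : Fin 3 → Matrix (Fin 4) (Fin 4) ℂ) : Prop where
  symm : ∀ k, (Q k).IsSymm
  linearIndependent : LinearIndependent ℂ Q
  smooth : ∀ t : Fin 3 → ℂ, t ≠ 0 → eval t (discriminant Q) = 0 →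
    ∃ k, eval t (pderiv k (discriminant Q)) ≠ 0

/-- `b₁, …, b₈` are homogeneous coordinates of the eight distinct points of the base locus
of the net. -/
structure IsBaseLocus (Q : Fin 3 → Matrix (Fin 4) (Fin 4) ℂ) (b : Fin 8 → Fin 4 → ℂ) :
    Prop where
  ne_zero : ∀ i, b i ≠ 0
  distinct : ∀ i j, i ≠ j → ∀ c : ℂ, b j ≠ c • b i
  mem_iff : ∀ v : Fin 4 → ℂ, v ≠ 0 →
    ((∀ k, v ⬝ᵥ (Q k).mulVec v = 0) ↔ ∃ i, ∃ c : ℂ, v = c • b i)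

/-- The weights of the coordinates `t₁, t₂, t₃` of the plane `ℙ(L)`: all equal to one. -/
abbrev planeWeight : Fin 3 → ℕ := fun _ => 1

/-- The weights of the coordinates `ξ₁, …, ξ₄` (`some j`, weight one) and `η`
(`none`, weight four). -/
abbrev coverWeight : Option (Fin 4) → ℕ := fun o => o.elim 4 fun _ => 1

/-- The plane curve `C` of singular members of the net. -/
abbrev curve (Q : Fin 3 → Matrix (Fin 4) (Fin 4) ℂ) : Scheme.{0} :=
  WProj.hypersurface planeWeight (discriminant Q)

/-- The equation `η² - ∏ i, (b_{i1} ξ₁ + ⋯ + b_{i4} ξ₄)`. -/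
def coverEquation (b : Fin 8 → Fin 4 → ℂ) : MvPolynomial (Option (Fin 4)) ℂ :=
  X none ^ 2 - ∏ i, ∑ j, C (b i j) * X (some j)

/-- The double covering `X` of the dual projective space branched along the eight planes
`H_i : b_{i1} ξ₁ + ⋯ + b_{i4} ξ₄ = 0`. -/
abbrev threefold (b : Fin 8 → Fin 4 → ℂ) : Scheme.{0} :=
  WProj.hypersurface coverWeight (coverEquation b)

/-- The structure morphism of `C`. -/
abbrev curveToSpec (Q : Fin 3 → Matrix (Fin 4) (Fin 4) ℂ) : curve Q ⟶ Spec (.of ℂ) :=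
  WProj.hypersurfaceι planeWeight (discriminant Q) ≫ WProj.toSpec planeWeight

/-- The structure morphism of `X`. -/
abbrev threefoldToSpec (b : Fin 8 → Fin 4 → ℂ) : threefold b ⟶ Spec (.of ℂ) :=
  WProj.hypersurfaceι coverWeight (coverEquation b) ≫ WProj.toSpec coverWeight

/-- The affine cone (without the origin) over the conic `γ_t`: the coordinate vectors `ξ` of
planes which are tangent to the quadric `y ↦ ᵗy Q_t y` at one of its smooth points. -/
def gamma (Q : Fin 3 → Matrix (Fin 4) (Fin 4) ℂ) (t : Fin 3 → ℂ) : Set (Fin 4 → ℂ) :=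
  {ξ | ∃ y : Fin 4 → ℂ, y ⬝ᵥ (member Q t).mulVec y = 0 ∧ (member Q t).mulVec y ≠ 0 ∧
    ∃ c : ℂ, c ≠ 0 ∧ ξ = c • (member Q t).mulVec y}

/-! ### The double covering `C^#` of `C` -/

/-- The product `C × X`. -/
abbrev ambient (Q : Fin 3 → Matrix (Fin 4) (Fin 4) ℂ) (b : Fin 8 → Fin 4 → ℂ) : Scheme.{0} :=
  pullback (curveToSpec Q) (threefoldToSpec b)

/-- The closed subset `{(t, x) ∈ C × X ∣ π(x) ∈ γ_t}` of `C × X`, given as the closure of the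
set of its complex points; here `π (ξ : η) = (ξ)`. -/
def incidenceSet (Q : Fin 3 → Matrix (Fin 4) (Fin 4) ℂ) (b : Fin 8 → Fin 4 → ℂ) :
    TopologicalSpace.Closeds (ambient Q b) :=
  .closure {z | ∃ (t : Fin 3 → ℂ) (ξ : Fin 4 → ℂ) (η : ℂ),
    WProj.HasCoords planeWeight (WProj.hypersurfaceι planeWeight (discriminant Q)
      (pullback.fst (curveToSpec Q) (threefoldToSpec b) z)) t ∧
    WProj.HasCoords coverWeight (WProj.hypersurfaceι coverWeight (coverEquation b)
      (pullback.snd (curveToSpec Q) (threefoldToSpec b) z)) (fun o => o.elim η ξ) ∧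
    ξ ∈ gamma Q t}

/-- The variety `{(t, x) ∈ C × X ∣ π(x) ∈ γ_t}`. -/
abbrev incidence (Q : Fin 3 → Matrix (Fin 4) (Fin 4) ℂ) (b : Fin 8 → Fin 4 → ℂ) : Scheme.{0} :=
  reducedSubscheme (incidenceSet Q b)

/-- The projection `(t, x) ↦ t` to `C`. -/
abbrev incidenceToCurve (Q : Fin 3 → Matrix (Fin 4) (Fin 4) ℂ) (b : Fin 8 → Fin 4 → ℂ) :
    incidence Q b ⟶ curve Q :=
  reducedSubschemeι (incidenceSet Q b) ≫ pullback.fst (curveToSpec Q) (threefoldToSpec b)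

instance (Q : Fin 3 → Matrix (Fin 4) (Fin 4) ℂ) : IsProper (curveToSpec Q) := by
  have := WProj.isProper_toSpec planeWeight (by simp)
  infer_instance

instance (b : Fin 8 → Fin 4 → ℂ) : IsProper (threefoldToSpec b) := by
  have := WProj.isProper_toSpec coverWeight (by rintro (_ | _) <;> simp)
  infer_instance

instance (Q : Fin 3 → Matrix (Fin 4) (Fin 4) ℂ) (b : Fin 8 → Fin 4 → ℂ) :
    IsProper (incidenceToCurve Q b) := inferInstance

instance (Q : Fin 3 → Matrix (Fin 4) (Fin 4) ℂ) (b : Fin 8 → Fin 4 → ℂ) :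
    IsNoetherian (incidence Q b) := by
  have : IsProper (incidenceToCurve Q b ≫ curveToSpec Q) := inferInstance
  have : IsLocallyNoetherian (Spec (.of ℂ)) := inferInstance
  have h : IsLocallyNoetherian (incidence Q b) :=
    LocallyOfFiniteType.isLocallyNoetherian (incidenceToCurve Q b ≫ curveToSpec Q)
  have : CompactSpace (incidence Q b) :=
    QuasiCompact.compactSpace_of_compactSpace (incidenceToCurve Q b ≫ curveToSpec Q)
  exact { h with }

/-- The normalization of `{(t, x) ∈ C × X ∣ π(x) ∈ γ_t}`, followed by the projection to `C`. -/
abbrev normalizedIncidenceToCurve (Q : Fin 3 → Matrix (Fin 4) (Fin 4) ℂ)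
    (b : Fin 8 → Fin 4 → ℂ) : absNormalization (incidence Q b) ⟶ curve Q :=
  absNormalizationMap (incidence Q b) ≫ incidenceToCurve Q b

/-- The double covering `C^#` of `C`: the Stein factorization of the normalization of
`{(t, x) ∈ C × X ∣ π(x) ∈ γ_t}` over `C`. -/
abbrev doubleCover (Q : Fin 3 → Matrix (Fin 4) (Fin 4) ℂ) (b : Fin 8 → Fin 4 → ℂ) :
    Scheme.{0} :=
  steinFactor (normalizedIncidenceToCurve Q b)

/-- The covering morphism `C^# ⟶ C`. -/
abbrev doubleCoverMap (Q : Fin 3 → Matrix (Fin 4) (Fin 4) ℂ) (b : Fin 8 → Fin 4 → ℂ) :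
    doubleCover Q b ⟶ curve Q :=
  steinFactorMap (normalizedIncidenceToCurve Q b)

end CayleyOctad

end

/-! Let `K` be the function field of `C`, `A` the member of the net at the generic point of `C`, and
`k` a vector spanning the kernel of `A`. The base point `b 0` is a rational point of the cone of
`A`, so projection from it parametrizes the conic of tangent planes: a vector `v` is sent to `ξ(v) =
A σ(v)`, where `σ(v)` is the second intersection of the cone with the line through `b 0` and `v`
(`secondPoint`, `tangentPlane`). Along this parametrization `b 0 · ξ = -2 (b 0 · A v)²`, and by a
Gram determinant (`gram_det`) `k a * (b 0 · A b i) * (b i · ξ) = -det(v, b 0, b i, k)²` for the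
other seven points. The product of the eight linear forms is therefore a square as soon as the
constant `k a * ∏ i, b 0 · A b i`, with `i` running over the other seven points, is a square in `K`.

That is `exists_prod_polar_mul_eq_sq`, the heart of the matter. In coordinates adapted to `b 0`, the
other seven base points are the seven fixed points `x i` of a quadratic self-map of the plane, and
`b 0 · A b i` is the linear form `t · x i`. The product of these seven forms vanishes when the line
`t` contains a fixed point, so up to a constant and a power of one coordinate it is the resultant of
a binary quadratic and a binary cubic form attached to the line (`exists_lineResultant_eq`). On `C`
the quadratic form has a double root, so the resultant is a square times an extreme coefficient of
that form; this coefficient is minus a diagonal cofactor of a singular symmetric matrix, hence `-k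
a` up to squares.

So `η = ±r` with `r` a polynomial in `v` over `K`, which gives two morphisms from the spectrum of
`K(v)` to `C × X`. Their images are the generic points of the incidence variety: each complex point
is a specialization of one of them (`specializes_of_mem_incidencePoints`), and neither specializes
to the other, because a relation `∏ (z i · ξ) = c (b 0 · ξ)³ r` expresses `r` through `ξ` and so
detects the sign (`not_specializes_of_neg`).

Normalizing in two steps, `C^#` is the normalization of `C` in the two residue fields. Both embed in
`K(v)`, where `K` is algebraically closed, and `C` is normal because it is smooth; each of the two
normalizations is thus `C` itself. -/

noncomputable section

namespace CayleyOctad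

/-! ### Normalization in stages and in a disjoint union of two points. -/

section Normalization

variable {Z I C : Scheme.{0}} (g : Z ⟶ I) (h : I ⟶ C) [QuasiCompact g] [QuasiSeparated g]
  [QuasiCompact h] [QuasiSeparated h]

/-- Normalizing in two steps: the normalization of `C` in the normalization of `I` in `Z`
is the normalization of `C` in `Z`. -/
theorem exists_normalization_comp_iso :
    ∃ e : (g.fromNormalization ≫ h).normalization ≅ (g ≫ h).normalization,
      e.hom ≫ (g ≫ h).fromNormalization = (g.fromNormalization ≫ h).fromNormalization := by
  have hg : g ≫ h = (g.toNormalization ≫ (g.fromNormalization ≫ h).toNormalization) ≫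
      (g.fromNormalization ≫ h).fromNormalization := by simp
  let a := (g ≫ h).normalizationDesc _ _ hg
  -- The normalization of `C` in `Z`, pulled back along `h`, is integral over `I` and receives `Z`,
  -- so by the universal property it also receives the normalization of `I` in `Z`.
  let l : Z ⟶ pullback (g ≫ h).fromNormalization h :=
    pullback.lift (g ≫ h).toNormalization g (Scheme.Hom.toNormalization_fromNormalization _)
  have hl₁ : l ≫ pullback.fst _ _ = (g ≫ h).toNormalization := pullback.lift_fst _ _ _
  have hl₂ : l ≫ pullback.snd _ _ = g := pullback.lift_snd _ _ _
  let c : g.normalization ⟶ pullback (g ≫ h).fromNormalization h :=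
    g.normalizationDesc l (pullback.snd _ _) hl₂.symm
  have hgc : g.toNormalization ≫ c = l := g.toNormalization_normalizationDesc _ _ _
  have hc₂ : c ≫ pullback.snd _ _ = g.fromNormalization := g.normalizationDesc_comp _ _ _
  have hc : g.fromNormalization ≫ h = (c ≫ pullback.fst _ _) ≫ (g ≫ h).fromNormalization := by
    rw [Category.assoc, pullback.condition, ← Category.assoc, hc₂]
  let d := (g.fromNormalization ≫ h).normalizationDesc _ _ hc
  have ha : (g ≫ h).toNormalization ≫ a =
      g.toNormalization ≫ (g.fromNormalization ≫ h).toNormalization :=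
    (g ≫ h).toNormalization_normalizationDesc _ _ _
  have hd : (g.fromNormalization ≫ h).toNormalization ≫ d = c ≫ pullback.fst _ _ :=
    (g.fromNormalization ≫ h).toNormalization_normalizationDesc _ _ _
  have ha' : a ≫ (g.fromNormalization ≫ h).fromNormalization = (g ≫ h).fromNormalization :=
    (g ≫ h).normalizationDesc_comp _ _ _
  have hd' : d ≫ (g ≫ h).fromNormalization = (g.fromNormalization ≫ h).fromNormalization :=
    (g.fromNormalization ≫ h).normalizationDesc_comp _ _ _
  have had : a ≫ d = 𝟙 _ := by
    refine Scheme.Hom.normalization.hom_ext _ _ _ (g ≫ h).fromNormalization ?_ ?_ (by simp)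
    · rw [reassoc_of% ha, hd, reassoc_of% hgc, hl₁, Category.comp_id]
    · rw [Category.assoc, hd', ha']
  have hda : d ≫ a = 𝟙 _ := by
    refine Scheme.Hom.normalization.hom_ext _ _ _ (g.fromNormalization ≫ h).fromNormalization
      ?_ ?_ (by simp)
    · rw [reassoc_of% hd, Category.comp_id]
      have hp : (c ≫ pullback.fst _ _ ≫ a) ≫ (g.fromNormalization ≫ h).fromNormalization =
          g.fromNormalization ≫ h := by rw [Category.assoc, Category.assoc, ha', hc, Category.assoc]
      have hq : (g.fromNormalization ≫ h).toNormalization ≫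
          (g.fromNormalization ≫ h).fromNormalization = g.fromNormalization ≫ h :=
        Scheme.Hom.toNormalization_fromNormalization _
      -- Uniqueness of maps out of the normalization of `I` requires an integral target over `I`;
      -- the two maps are therefore compared in the pullback along `h`.
      have hpq : pullback.lift _ _ hp = pullback.lift _ _ hq := by
        refine Scheme.Hom.normalization.hom_ext _ _ _ (pullback.snd _ _) ?_
          (pullback.lift_snd _ _ _) (pullback.lift_snd _ _ _)
        apply pullback.hom_ext
        · rw [Category.assoc, Category.assoc, pullback.lift_fst, pullback.lift_fst,
            reassoc_of% hgc, reassoc_of% hl₁, ha]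
        · rw [Category.assoc, Category.assoc, pullback.lift_snd, pullback.lift_snd]
      rw [← pullback.lift_fst _ _ hp, hpq, pullback.lift_fst]
    · rw [Category.assoc, ha', hd']
  exact ⟨⟨d, a, hda, had⟩, hd'⟩

/-- On an affine open the normalization is the spectrum of the integral closure in the sections
upstairs, so the question is one of rings on an affine cover. -/
theorem isIso_fromNormalization {X Y : Scheme.{0}} (f : X ⟶ Y) [QuasiCompact f] [QuasiSeparated f]
    {ι : Type} (U : ι → Y.Opens) (hU : ∀ i, IsAffineOpen (U i)) (hcov : ⨆ i, U i = ⊤)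
    (hinj : ∀ i, Function.Injective (f.app (U i)).hom)
    (hint : ∀ i x, (f.app (U i)).hom.IsIntegralElem x → x ∈ (f.app (U i)).hom.range) :
    IsIso f.fromNormalization := by
  refine (IsZariskiLocalAtTarget.iff_of_iSup_eq_top (P := .isomorphisms _) U hcov).mpr fun i ↦ ?_
  refine (isIso_morphismRestrict_iff_isIso_app _ (hU i)).mpr ?_
  rw [Scheme.Hom.fromNormalization_app _ (hU i)]
  let := (f.app (U i)).hom.toAlgebra
  have : IsIso (CommRingCat.ofHom
      (algebraMap Γ(Y, U i) (integralClosure Γ(Y, U i) Γ(X, f ⁻¹ᵁ U i)))) := by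
    refine (ConcreteCategory.isIso_iff_bijective _).mpr ⟨fun a b h ↦ ?_, fun x ↦ ?_⟩
    · exact hinj i congr(($h).1)
    · obtain ⟨a, ha⟩ := hint i x.1 x.2
      exact ⟨a, Subtype.ext ha⟩
  infer_instance

theorem app_specMap_fromSpec {Y : Scheme.{0}} {U : Y.Opens} (hU : IsAffineOpen U) {R : CommRingCat.{0}}
    (φ : Γ(Y, U) ⟶ R) :
    ∃ e : R ≅ Γ(Spec R, (Spec.map φ ≫ hU.fromSpec) ⁻¹ᵁ U),
      (Spec.map φ ≫ hU.fromSpec).app U = φ ≫ e.hom := by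
  have h : (⊤ : (Spec R).Opens) = (Spec.map φ ≫ hU.fromSpec) ⁻¹ᵁ U := by
    simp
  refine ⟨(Scheme.ΓSpecIso R).symm ≪≫ (Spec R).presheaf.mapIso (eqToIso h.symm).op, ?_⟩
  rw [Scheme.Hom.comp_app, IsAffineOpen.fromSpec_app_self]
  simp [Scheme.Hom.app_eq_appLE]
  exact (Scheme.Hom.appLE_map ..).symm

/-- A morphism from the spectrum of a ring with image in an affine open is given by a ring
homomorphism. -/
theorem exists_eq_specMap_fromSpec {Y : Scheme.{0}} {U : Y.Opens} (hU : IsAffineOpen U)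
    {R : CommRingCat.{0}} (f : Spec R ⟶ Y) (hf : ∀ x, f x ∈ U) :
    ∃ φ : Γ(Y, U) ⟶ R, f = Spec.map φ ≫ hU.fromSpec := by
  have : Set.range f ⊆ Set.range hU.fromSpec := by
    rw [hU.range_fromSpec]
    rintro _ ⟨x, rfl⟩
    exact hf x
  refine ⟨Spec.preimage (IsOpenImmersion.lift hU.fromSpec f this), ?_⟩
  rw [Spec.map_preimage, IsOpenImmersion.lift_fac]

/-- An element of `κ` integral over the base stays integral in `L`. It thus suffices to test
integral closedness in any larger field, and the residue field at a generic point of the incidence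
variety never has to be computed: it is enough that it embeds in `K(v)`. -/
theorem isIso_fromNormalization_of_specMap {Y : Scheme.{0}} {κ L : CommRingCat.{0}}
    [Subsingleton (Spec κ)] [Nonempty (Spec L)]
    (f : Spec κ ⟶ Y) [QuasiCompact f] [QuasiSeparated f] (ψ : κ ⟶ L)
    (hψ : Function.Injective ψ.hom)
    {ι : Type} (U : ι → Y.Opens) (hU : ∀ i, IsAffineOpen (U i)) (hcov : ⨆ i, U i = ⊤)
    (φ : ∀ i, Γ(Y, U i) ⟶ L) (hφ : ∀ i, Spec.map ψ ≫ f = Spec.map (φ i) ≫ (hU i).fromSpec)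
    (hinj : ∀ i, Function.Injective (φ i).hom)
    (hint : ∀ i x, (φ i).hom.IsIntegralElem x → x ∈ (φ i).hom.range) :
    IsIso f.fromNormalization := by
  have key (i) : ∃ φ' : Γ(Y, U i) ⟶ κ, f = Spec.map φ' ≫ (hU i).fromSpec ∧ φ' ≫ ψ = φ i := by
    obtain ⟨φ', h'⟩ := exists_eq_specMap_fromSpec (hU i) f (fun x ↦ by
      obtain ⟨z⟩ := ‹Nonempty (Spec L)›
      rw [Subsingleton.elim x (Spec.map ψ z)]
      have : f (Spec.map ψ z) = (hU i).fromSpec (Spec.map (φ i) z) := congr($(hφ i) z)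
      rw [this, ← SetLike.mem_coe, ← (hU i).range_fromSpec]
      exact ⟨_, rfl⟩)
    refine ⟨φ', h', Spec.map_injective ?_⟩
    rw [← cancel_mono (hU i).fromSpec, ← hφ i, Spec.map_comp, Category.assoc, ← h']
  refine isIso_fromNormalization f U hU hcov (fun i ↦ ?_) (fun i x hx ↦ ?_)
  · obtain ⟨φ', rfl, h⟩ := key i
    obtain ⟨e, he⟩ := app_specMap_fromSpec (hU i) φ'
    rw [he]
    have h1 : Function.Injective φ'.hom := by
      have := hinj i
      rw [← h] at this
      exact Function.Injective.of_comp (f := ψ.hom) this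
    exact e.commRingCatIsoToRingEquiv.injective.comp h1
  · obtain ⟨φ', h', h⟩ := key i
    obtain ⟨e, he⟩ := app_specMap_fromSpec (hU i) φ'
    subst h'
    rw [he] at hx ⊢
    have hx' : φ'.hom.IsIntegralElem (e.inv.hom x) := by
      have := hx.map e.inv.hom
      rwa [← CommRingCat.hom_comp, Category.assoc, e.hom_inv_id, Category.comp_id] at this
    have hx'' := hx'.map ψ.hom
    rw [← CommRingCat.hom_comp, h] at hx''
    obtain ⟨a, ha⟩ := hint i _ hx''
    refine ⟨a, ?_⟩
    have : φ'.hom a = e.inv.hom x := hψ (by rw [← ha, ← h]; rfl)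
    change e.hom.hom (φ'.hom a) = x
    rw [this]
    exact e.commRingCatIsoToRingEquiv.apply_symm_apply x

/-- A coproduct indexed by a type with two elements is a binary coproduct. -/
theorem nonempty_isColimit_of_two {J : Type} (Z : J → Scheme.{0}) (j : Fin 2 → J)
    (hj : Function.Bijective j) :
    Nonempty (IsColimit (BinaryCofan.mk (Sigma.ι Z (j 0)) (Sigma.ι Z (j 1)))) := by
  classical
  let e := Equiv.ofBijective j hj
  have he (i : Fin 2) : e.symm (j i) = i := e.symm_apply_apply i
  have key (W : Scheme.{0}) (f : ∀ i : Fin 2, Z (j i) ⟶ W) :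
      ∃ d : ∐ Z ⟶ W, ∀ i, Sigma.ι Z (j i) ≫ d = f i := by
    refine ⟨Sigma.desc fun x ↦ eqToHom (congrArg Z (e.apply_symm_apply x).symm) ≫ f (e.symm x),
      fun i ↦ ?_⟩
    rw [Sigma.ι_desc]
    have : ∀ (k : Fin 2) (hk : k = i) (h' : Z (j i) = Z (j k)), eqToHom h' ≫ f k = f i := by
      rintro k rfl h'
      simp
    exact this _ (he i) _
  have key' (W : Scheme.{0}) (f : Z (j 0) ⟶ W) (g : Z (j 1) ⟶ W) :
      ∃ d : ∐ Z ⟶ W, Sigma.ι Z (j 0) ≫ d = f ∧ Sigma.ι Z (j 1) ≫ d = g := by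
    obtain ⟨d, hd⟩ := key W (Fin.cons f (Fin.cons g finZeroElim))
    exact ⟨d, hd 0, hd 1⟩
  choose d hd₀ hd₁ using key'
  refine ⟨BinaryCofan.isColimitMk (fun s ↦ d _ s.inl s.inr) (fun s ↦ hd₀ _ _ _)
    (fun s ↦ hd₁ _ _ _) fun s m h₀ h₁ ↦ ?_⟩
  refine Sigma.hom_ext _ _ fun x ↦ ?_
  obtain ⟨i, rfl⟩ := hj.surjective x
  fin_cases i
  · exact h₀.trans (hd₀ _ _ _).symm
  · exact h₁.trans (hd₁ _ _ _).symm

/-- If `I` has exactly two generic points and `C` is integrally closed in the residue fields of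
both, then the normalization of `C` in the normalization of `I` is the trivial double covering. -/
theorem exists_steinFactor_absNormalization_iso {I C : Scheme.{0}} [IsNoetherian I] (h : I ⟶ C)
    [QuasiCompact h] [QuasiSeparated h] (p : Fin 2 → I) (hp : Function.Injective p)
    (hgen : genericPoints I = Set.range p)
    [∀ i, QuasiCompact (I.fromSpecResidueField (p i) ≫ h)]
    [∀ i, QuasiSeparated (I.fromSpecResidueField (p i) ≫ h)]
    (hiso : ∀ i, IsIso (I.fromSpecResidueField (p i) ≫ h).fromNormalization) :
    ∃ e : steinFactor (absNormalizationMap I ≫ h) ≅ C ⨿ C,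
      e.hom ≫ coprod.desc (𝟙 C) (𝟙 C) = steinFactorMap (absNormalizationMap I ≫ h) := by
  -- This turns the Stein factorization into a normalization of `C` in the disjoint union of the
  -- spectra of two residue fields, and normalization commutes with finite coproducts of the source.
  obtain ⟨e₁, he₁⟩ := exists_normalization_comp_iso (fromGenericPoints I) h
  let η (i : Fin 2) : genericPoints I := ⟨p i, hgen ▸ ⟨i, rfl⟩⟩
  have hη : Function.Bijective η := by
    refine ⟨fun i j hij ↦ hp congr(($hij).1), fun x ↦ ?_⟩
    obtain ⟨i, hi⟩ : x.1 ∈ Set.range p := hgen ▸ x.2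
    exact ⟨i, Subtype.ext hi⟩
  let Z (η : genericPoints I) := Spec (I.residueField η.1)
  obtain ⟨hc⟩ := nonempty_isColimit_of_two Z η hη
  have hι (i : Fin 2) : Sigma.ι Z (η i) ≫ fromGenericPoints I ≫ h =
      I.fromSpecResidueField (p i) ≫ h := by
    rw [← Category.assoc]
    congr 1
    exact Sigma.ι_desc _ _
  have := finite_genericPoints I
  let e₂ := (fromGenericPoints I ≫ h).normalizationCoprodIso hc
  have hiso' (i : Fin 2) :
      IsIso (Sigma.ι Z (η i) ≫ fromGenericPoints I ≫ h).fromNormalization := by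
    have key {X Y : Scheme.{0}} (f g : X ⟶ Y) [QuasiCompact f] [QuasiSeparated f]
        [QuasiCompact g] [QuasiSeparated g] (hfg : f = g) (hf : IsIso f.fromNormalization) :
        IsIso g.fromNormalization := by
      subst hfg
      exact hf
    exact key _ _ (hι i).symm (hiso i)
  have := hiso' 0
  have := hiso' 1
  let e₃ : C ⨿ C ≅ _ := coprod.mapIso
    (asIso (Sigma.ι Z (η 0) ≫ fromGenericPoints I ≫ h).fromNormalization).symm
    (asIso (Sigma.ι Z (η 1) ≫ fromGenericPoints I ≫ h).fromNormalization).symm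
  refine ⟨e₁ ≪≫ (e₃ ≪≫ e₂).symm, ?_⟩
  rw [Iso.trans_hom, Iso.symm_hom, Category.assoc]
  refine Eq.trans ?_ he₁
  congr 1
  rw [Iso.inv_comp_eq, Iso.trans_hom, Category.assoc]
  apply coprod.hom_ext
  · simpa [e₂, e₃] using coprod.inl_desc _ _
  · simpa [e₂, e₃] using coprod.inr_desc _ _

end Normalization

/-! ### Points of weighted projective space with values in a ring, given by homogeneous coordinates.
-/

section Coordinates

variable {σ : Type} (w : σ → ℕ) {R : Type} [CommRing R] [Algebra ℂ R]

theorem aeval_smul_of_mem {n : ℕ} {p : MvPolynomial σ ℂ}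
    (hp : p ∈ weightedHomogeneousSubmodule ℂ w n) (u : R) (v : σ → R) :
    aeval (fun j ↦ u ^ w j * v j) p = u ^ n * aeval v p := by
  rw [aeval_def, aeval_def, eval₂_eq, eval₂_eq, Finset.mul_sum]
  refine Finset.sum_congr rfl fun d hd ↦ ?_
  have hd' : Finsupp.weight w d = n := hp (mem_support_iff.mp hd)
  have : ∏ i ∈ d.support, (u ^ w i * v i) ^ d i = u ^ n * ∏ i ∈ d.support, v i ^ d i := by
    simp_rw [mul_pow]
    rw [Finset.prod_mul_distrib, ← hd', Finsupp.weight_apply, Finsupp.sum,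
      ← Finset.prod_pow_eq_pow_sum]
    congr 1
    exact Finset.prod_congr rfl fun i _ ↦ by rw [← pow_mul, mul_comm, smul_eq_mul]
  rw [this]
  ring

/-- Evaluation at `v` of the homogeneous fractions of degree zero with denominators the powers
of `f`. -/
def awayEval (f : MvPolynomial σ ℂ) (v : σ → R) (hf : IsUnit (aeval v f)) :
    HomogeneousLocalization.Away (weightedHomogeneousSubmodule ℂ w) f →+* R :=
  (IsLocalization.Away.lift (S := Localization.Away f) f (g := (aeval v : _ →ₐ[ℂ] R).toRingHom) hf).comp
    (algebraMap _ (Localization.Away f))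

variable {w}

theorem awayEval_mk {f : MvPolynomial σ ℂ} {v : σ → R} (hf : IsUnit (aeval v f)) {d : ℕ}
    (hd : f ∈ weightedHomogeneousSubmodule ℂ w d) (n : ℕ) (p : MvPolynomial σ ℂ)
    (hp : p ∈ weightedHomogeneousSubmodule ℂ w (n • d)) :
    awayEval w f v hf (.mk _ hd n p hp) * aeval v f ^ n = aeval v p := by
  rw [awayEval, RingHom.comp_apply, HomogeneousLocalization.algebraMap_apply,
    HomogeneousLocalization.Away.val_mk, Localization.mk_eq_mk', IsLocalization.Away.lift]
  have h := (IsLocalization.lift_mk'_spec (M := Submonoid.powers f) (S := Localization.Away f)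
    (g := (aeval v : _ →ₐ[ℂ] R).toRingHom) (hg := by
      rintro ⟨_, n, rfl⟩; simpa using hf.pow n) p _ ⟨f ^ n, n, rfl⟩).mp rfl
  rw [mul_comm]
  simpa using h.symm

theorem eq_awayEval {f : MvPolynomial σ ℂ} {v : σ → R} (hf : IsUnit (aeval v f)) {d : ℕ}
    (hd : f ∈ weightedHomogeneousSubmodule ℂ w d)
    (φ : HomogeneousLocalization.Away (weightedHomogeneousSubmodule ℂ w) f →+* R)
    (h : ∀ (n : ℕ) (p : MvPolynomial σ ℂ) (hp : p ∈ weightedHomogeneousSubmodule ℂ w (n • d)),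
      φ (.mk _ hd n p hp) * aeval v f ^ n = aeval v p) :
    φ = awayEval w f v hf := by
  ext x
  obtain ⟨n, p, hp, rfl⟩ := HomogeneousLocalization.Away.mk_surjective _ hd x
  refine (hf.pow n).mul_right_cancel ?_
  rw [h, awayEval_mk]

/-- The morphism to the weighted projective space with homogeneous coordinates `v`, where the
value at `v` of the homogeneous polynomial `f` is a unit. -/
def coordMor (f : MvPolynomial σ ℂ) {d : ℕ} (hd : f ∈ weightedHomogeneousSubmodule ℂ w d)
    (h0 : 0 < d) (v : σ → R) (hf : IsUnit (aeval v f)) : Spec (.of R) ⟶ WProj w :=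
  Spec.map (CommRingCat.ofHom (awayEval w f v hf)) ≫ Proj.awayι _ f hd h0

/-- Shrinking the chart of `f` to that of `f * g` does not change the morphism; applied in both
orders this makes `coordMor` independent of the chosen form. -/
theorem coordMor_mul {f g : MvPolynomial σ ℂ} {d e : ℕ}
    (hd : f ∈ weightedHomogeneousSubmodule ℂ w d) (h0 : 0 < d)
    (he : g ∈ weightedHomogeneousSubmodule ℂ w e)
    (v : σ → R) (hf : IsUnit (aeval v f)) (hg : IsUnit (aeval v g)) :
    coordMor f hd h0 v hf = coordMor (f * g) (SetLike.mul_mem_graded hd he)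
      (h0.trans_le (Nat.le_add_right _ _)) v (by rw [map_mul]; exact hf.mul hg) := by
  rw [coordMor, coordMor, ← Proj.SpecMap_awayMap_awayι _ hd h0 he rfl, ← Category.assoc,
    ← Spec.map_comp, ← CommRingCat.ofHom_comp]
  congr 3
  refine (eq_awayEval hf hd _ fun n p hp ↦ ?_).symm
  rw [RingHom.comp_apply, HomogeneousLocalization.awayMap_mk]
  refine (hg.pow n).mul_right_cancel ?_
  have := awayEval_mk (w := w) (v := v) (f := f * g) (by rw [map_mul]; exact hf.mul hg)
    (SetLike.mul_mem_graded hd he) n (p * g ^ n) 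
  simp only [map_mul, map_pow, mul_pow] at this
  rw [mul_assoc, this]

theorem coordMor_eq {f g : MvPolynomial σ ℂ} {d e : ℕ}
    (hd : f ∈ weightedHomogeneousSubmodule ℂ w d) (h0 : 0 < d)
    (he : g ∈ weightedHomogeneousSubmodule ℂ w e) (h0' : 0 < e)
    (v : σ → R) (hf : IsUnit (aeval v f)) (hg : IsUnit (aeval v g)) :
    coordMor f hd h0 v hf = coordMor g he h0' v hg := by
  rw [coordMor_mul hd h0 he v hf hg, coordMor_mul he h0' hd v hg hf]
  simp only [mul_comm f g, add_comm d e]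

theorem specMap_coordMor {S : Type} [CommRing S] [Algebra ℂ S] (φ : R →ₐ[ℂ] S)
    {f : MvPolynomial σ ℂ} {d : ℕ} (hd : f ∈ weightedHomogeneousSubmodule ℂ w d) (h0 : 0 < d)
    (v : σ → R) (hf : IsUnit (aeval v f)) (hf' : IsUnit (aeval (φ ∘ v) f)) :
    Spec.map (CommRingCat.ofHom φ.toRingHom) ≫ coordMor f hd h0 v hf =
      coordMor f hd h0 (φ ∘ v) hf' := by
  have h (p : MvPolynomial σ ℂ) : aeval (φ ∘ v) p = φ (aeval v p) := by
    rw [← AlgHom.comp_apply, MvPolynomial.comp_aeval]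
    rfl
  rw [coordMor, coordMor, ← Category.assoc, ← Spec.map_comp, ← CommRingCat.ofHom_comp]
  congr 3
  refine eq_awayEval _ hd _ fun n p hp ↦ ?_
  rw [h, h, ← awayEval_mk hf hd n p hp, map_mul, map_pow]
  rfl

theorem coordMor_smul {f : MvPolynomial σ ℂ} {d : ℕ}
    (hd : f ∈ weightedHomogeneousSubmodule ℂ w d) (h0 : 0 < d)
    (v v' : σ → R) (hf : IsUnit (aeval v f)) (hf' : IsUnit (aeval v' f))
    (u : R) (hv : ∀ j, v' j = u ^ w j * v j) :
    coordMor f hd h0 v hf = coordMor f hd h0 v' hf' := by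
  obtain rfl : v' = fun j ↦ u ^ w j * v j := funext hv
  rw [coordMor, coordMor]
  congr 3
  refine eq_awayEval _ hd _ fun n p hp ↦ ?_
  rw [aeval_smul_of_mem w hp, aeval_smul_of_mem w hd, mul_pow, ← awayEval_mk hf hd n p hp]
  rw [smul_eq_mul, mul_comm n d, pow_mul]
  ring

theorem mem_coordMor_iff {f : MvPolynomial σ ℂ} {d : ℕ}
    (hd : f ∈ weightedHomogeneousSubmodule ℂ w d) (h0 : 0 < d)
    (v : σ → R) (hf : IsUnit (aeval v f)) (x : PrimeSpectrum R) {n : ℕ} {p : MvPolynomial σ ℂ}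
    (hp : p ∈ weightedHomogeneousSubmodule ℂ w n) :
    p ∈ ProjectiveSpectrum.asHomogeneousIdeal (𝒜 := weightedHomogeneousSubmodule ℂ w)
      (coordMor f hd h0 v hf x) ↔ aeval v p ∈ x.asIdeal := by
  have pos {n : ℕ} {p : MvPolynomial σ ℂ} (hn : 0 < n)
      (hp : p ∈ weightedHomogeneousSubmodule ℂ w n) :
      p ∈ ProjectiveSpectrum.asHomogeneousIdeal (𝒜 := weightedHomogeneousSubmodule ℂ w)
        (coordMor f hd h0 v hf x) ↔ aeval v p ∈ x.asIdeal := by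
    rw [← not_iff_not, ← Proj.mem_basicOpen]
    have h1 : coordMor f hd h0 v hf x ∈ Proj.basicOpen (weightedHomogeneousSubmodule ℂ w) p ↔
        Spec.map (CommRingCat.ofHom (awayEval w f v hf)) x ∈
          Proj.awayι _ f hd h0 ⁻¹ᵁ Proj.basicOpen (weightedHomogeneousSubmodule ℂ w) p := Iff.rfl
    rw [h1, Proj.awayι_preimage_basicOpen _ hd h0 hp hn]
    refine not_congr ?_
    change awayEval w f v hf (HomogeneousLocalization.Away.isLocalizationElem hd hp) ∈ x.asIdeal ↔ _
    have h2 := awayEval_mk hf hd n (p ^ d) (by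
      convert! SetLike.pow_mem_graded d hp using 2; exact mul_comm _ _)
    rw [map_pow] at h2
    rw [← Ideal.mul_unit_mem_iff_mem _ (hf.pow n)]
    refine Iff.trans ?_ (x.2.pow_mem_iff_mem d h0)
    rw [← h2]
  rcases Nat.eq_zero_or_pos n with rfl | hn
  -- The description of basic opens inside a chart needs positive degree; a form of degree zero is
  -- multiplied by `f`, which is a unit at `v`.
  · have hpf := pos (n := 0 + d) (p := p * f) (by omega) (SetLike.mul_mem_graded hp hd)
    rw [map_mul, Ideal.mul_unit_mem_iff_mem _ hf] at hpf
    rw [← hpf]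
    refine ⟨fun h ↦ Ideal.mul_mem_right _ _ h, fun h ↦ ?_⟩
    refine (((coordMor f hd h0 v hf x).isPrime.mem_or_mem h).resolve_right fun h' ↦ ?_)
    exact x.2.ne_top (Ideal.eq_top_of_isUnit_mem _ ((pos h0 hd).mp h') hf)
  · exact pos hn hp

theorem coordMor_toSpec {f : MvPolynomial σ ℂ} {d : ℕ}
    (hd : f ∈ weightedHomogeneousSubmodule ℂ w d) (h0 : 0 < d)
    (v : σ → R) (hf : IsUnit (aeval v f)) :
    coordMor f hd h0 v hf ≫ WProj.toSpec w = Spec.map (CommRingCat.ofHom (algebraMap ℂ R)) := by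
  rw [coordMor, WProj.toSpec, Category.assoc, Proj.awayι_toSpecZero_assoc, ← Spec.map_comp,
    ← Spec.map_comp, ← CommRingCat.ofHom_comp, ← CommRingCat.ofHom_comp]
  congr 2
  ext c
  have h0' : (C c : MvPolynomial σ ℂ) ∈ weightedHomogeneousSubmodule ℂ w (0 • d) := by
    rw [zero_smul]
    exact isWeightedHomogeneous_C _ _
  have h := awayEval_mk hf hd 0 (C c) h0'
  rw [pow_zero, mul_one, aeval_C] at h
  rw [← h]
  change awayEval w f v hf _ = _
  congr 1
  ext
  rw [HomogeneousLocalization.Away.val_mk]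
  rfl

/-- The value of the coordinate `X j` normalized by `X i = 1`. -/
def awayCoord (i : σ) (hi : w i = 1) (j : σ) :
    HomogeneousLocalization.Away (weightedHomogeneousSubmodule ℂ w) (X i) :=
  .mk _ (show X i ∈ weightedHomogeneousSubmodule ℂ w 1 from hi ▸ isWeightedHomogeneous_X _ _ _)
    (w j) (X j) (by rw [smul_eq_mul, mul_one]; exact isWeightedHomogeneous_X _ _ _)

theorem X_mem {i : σ} (hi : w i = 1) : X i ∈ weightedHomogeneousSubmodule ℂ w 1 :=
  hi ▸ isWeightedHomogeneous_X _ _ _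

theorem awayEval_awayCoord (v : σ → R) (i : σ) (hi : w i = 1)
    (hv : IsUnit (aeval v (X i : MvPolynomial σ ℂ))) (hvi : v i = 1) (j : σ) :
    awayEval w (X i) v hv (awayCoord i hi j) = v j := by
  have := awayEval_mk hv (X_mem hi) (w j) (X j)
    (by rw [smul_eq_mul, mul_one]; exact isWeightedHomogeneous_X _ _ _)
  rwa [aeval_X, hvi, one_pow, mul_one, aeval_X] at this

instance (f : MvPolynomial σ ℂ) :
    Algebra ℂ (HomogeneousLocalization.Away (weightedHomogeneousSubmodule ℂ w) f) :=
  ((HomogeneousLocalization.fromZeroRingHom (weightedHomogeneousSubmodule ℂ w) _).comp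
    (algebraMap ℂ (weightedHomogeneousSubmodule ℂ w 0))).toAlgebra

/-- Dehomogenization: since `X i` has weight one, the fraction of `p` by `X i ^ n` is `p` evaluated
at the normalized coordinates. The identity is checked in the full localization, into which the
degree zero part injects. -/
theorem aeval_awayCoord (i : σ) (hi : w i = 1) (n : ℕ) (p : MvPolynomial σ ℂ)
    (hp : p ∈ weightedHomogeneousSubmodule ℂ w (n • 1)) :
    aeval (awayCoord i hi) p = HomogeneousLocalization.Away.mk _ (X_mem hi) n p hp := by
  let val : HomogeneousLocalization.Away (weightedHomogeneousSubmodule ℂ w) (X i) →ₐ[ℂ]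
      Localization.Away (X i : MvPolynomial σ ℂ) :=
    { algebraMap (HomogeneousLocalization.Away (weightedHomogeneousSubmodule ℂ w) (X i))
        (Localization.Away (X i : MvPolynomial σ ℂ)) with
      commutes' := fun c ↦ rfl }
  have hval : Function.Injective val := HomogeneousLocalization.val_injective _
  apply hval
  let u : Localization.Away (X i : MvPolynomial σ ℂ) :=
    IsLocalization.Away.invSelf (X i : MvPolynomial σ ℂ)
  have hmk (n : ℕ) (p : MvPolynomial σ ℂ) (hp) :
      val (HomogeneousLocalization.Away.mk _ (X_mem hi) n p hp) =
        u ^ n * algebraMap (MvPolynomial σ ℂ) (Localization.Away (X i : MvPolynomial σ ℂ)) p := by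
    change HomogeneousLocalization.val (HomogeneousLocalization.Away.mk
      (weightedHomogeneousSubmodule ℂ w) (X_mem hi) n p hp) = _
    rw [HomogeneousLocalization.Away.val_mk, Localization.mk_eq_mk', IsLocalization.mk'_eq_iff_eq_mul]
    have hu : algebraMap _ (Localization.Away (X i)) (X i : MvPolynomial σ ℂ) * u = 1 :=
      IsLocalization.Away.mul_invSelf _
    have hu' : algebraMap _ (Localization.Away (X i)) (X i : MvPolynomial σ ℂ) ^ n * u ^ n = 1 := by
      rw [← mul_pow, hu, one_pow]
    rw [map_pow]
    linear_combination (-algebraMap _ (Localization.Away (X i)) p) * hu'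
  have hX (j : σ) : val (awayCoord i hi j) =
      u ^ w j * algebraMap _ (Localization.Away (X i)) (X j : MvPolynomial σ ℂ) := hmk _ _ _
  rw [hmk, ← AlgHom.comp_apply, comp_aeval]
  have h1 : (fun j ↦ val (awayCoord i hi j)) =
    fun j ↦ u ^ w j * algebraMap _ (Localization.Away (X i)) (X j : MvPolynomial σ ℂ) := funext hX
  rw [h1, aeval_smul_of_mem w hp, smul_eq_mul, mul_one]
  congr 1
  have h2 := comp_aeval (R := ℂ) (fun j ↦ (X j : MvPolynomial σ ℂ))
    (IsScalarTower.toAlgHom ℂ (MvPolynomial σ ℂ) (Localization.Away (X i : MvPolynomial σ ℂ)))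
  rw [aeval_X_left, AlgHom.comp_id] at h2
  exact (congr($h2 p)).symm

/-- A morphism to the weighted projective space with image in the chart `X i ≠ 0` is given by
its coordinates, normalized by `X i = 1`. -/
theorem exists_eq_coordMor (i : σ) (hi : w i = 1) (g : Spec (.of R) ⟶ WProj w)
    (hg : g ≫ WProj.toSpec w = Spec.map (CommRingCat.ofHom (algebraMap ℂ R)))
    (hr : ∀ x, g x ∈ Proj.basicOpen (weightedHomogeneousSubmodule ℂ w) (X i)) :
    ∃ (v : σ → R) (hv : v i = 1),
      g = coordMor (X i) (X_mem hi) one_pos v (by rw [aeval_X, hv]; exact isUnit_one) := by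
  have : Set.range g ⊆ Set.range (Proj.awayι _ (X i) (X_mem hi) one_pos) := by
    rw [← Scheme.Hom.coe_opensRange (Proj.awayι _ (X i) (X_mem hi) one_pos),
      Proj.opensRange_awayι]
    rintro _ ⟨x, rfl⟩
    exact hr x
  obtain ⟨φ, hφ⟩ : ∃ φ : CommRingCat.of (HomogeneousLocalization.Away
      (weightedHomogeneousSubmodule ℂ w) (X i)) ⟶ .of R,
      g = Spec.map φ ≫ Proj.awayι _ (X i) (X_mem hi) one_pos :=
    ⟨Spec.preimage (IsOpenImmersion.lift (Proj.awayι _ (X i) (X_mem hi) one_pos) g this), by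
      rw [Spec.map_preimage]
      exact (IsOpenImmersion.lift_fac (Proj.awayι _ (X i) (X_mem hi) one_pos) g this).symm⟩
  have hφC (c : ℂ) : φ.hom (algebraMap ℂ _ c) = algebraMap ℂ R c := by
    rw [hφ, WProj.toSpec, Category.assoc, Proj.awayι_toSpecZero_assoc, ← Spec.map_comp,
      ← Spec.map_comp, Spec.map_inj] at hg
    exact congr(($hg).hom c)
  let ψ : HomogeneousLocalization.Away (weightedHomogeneousSubmodule ℂ w) (X i) →ₐ[ℂ] R :=
    { φ.hom with commutes' := hφC }
  have hone : awayCoord i hi i = 1 := by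
    have := aeval_awayCoord i hi 1 (X i) (by simpa using X_mem hi)
    rw [aeval_X] at this
    rw [this]
    ext
    rw [HomogeneousLocalization.Away.val_mk, HomogeneousLocalization.val_one]
    convert! Localization.mk_self _ using 2
    simp
  refine ⟨fun j ↦ ψ (awayCoord i hi j), by simp only [hone, map_one], ?_⟩
  rw [hφ, coordMor]
  congr 2
  ext1
  refine eq_awayEval _ (X_mem hi) _ fun n p hp ↦ ?_
  simp only [aeval_X, hone, map_one, one_pow, mul_one]
  rw [← aeval_awayCoord i hi n p hp]
  change ψ _ = _
  rw [← AlgHom.comp_apply, comp_aeval]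

theorem coordMor_injective (i : σ) (hi : w i = 1) {v v' : σ → R} (hv : v i = 1) (hv' : v' i = 1)
    (h : coordMor (X i) (X_mem hi) one_pos v (by rw [aeval_X, hv]; exact isUnit_one) =
      coordMor (X i) (X_mem hi) one_pos v' (by rw [aeval_X, hv']; exact isUnit_one)) : v = v' := by
  rw [coordMor, coordMor, cancel_mono, Spec.map_inj] at h
  funext j
  rw [← awayEval_awayCoord v i hi (by rw [aeval_X, hv]; exact isUnit_one) hv j,
    ← awayEval_awayCoord v' i hi (by rw [aeval_X, hv']; exact isUnit_one) hv' j]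
  exact congr(($h).hom _)

/-- A morphism from a reduced scheme factors through the reduced closed subscheme supported on
a closed set which contains its image. -/
theorem exists_lift_reducedSubscheme {X Y : Scheme.{0}} [IsReduced X] (f : X ⟶ Y)
    [QuasiCompact f]
    (Z : TopologicalSpace.Closeds Y) (hf : ∀ x, f x ∈ Z) :
    ∃ g : X ⟶ reducedSubscheme Z, g ≫ reducedSubschemeι Z = f := by
  refine ⟨IsClosedImmersion.lift (reducedSubschemeι Z) f ?_, IsClosedImmersion.lift_fac _ _ _⟩
  -- On a reduced scheme the zero ideal sheaf is the vanishing ideal of the whole space, so the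
  -- kernel of `f` is the vanishing ideal of the closure of its image.
  rw [Scheme.IdealSheafData.ker_subschemeι, ← Scheme.IdealSheafData.map_bot,
    ← Scheme.nilradical_eq_bot, ← Scheme.IdealSheafData.vanishingIdeal_top,
    Scheme.IdealSheafData.map_vanishingIdeal]
  refine Scheme.IdealSheafData.vanishingIdeal_antimono ?_
  rw [TopologicalSpace.Closeds.closure_le]
  rintro _ ⟨x, -, rfl⟩
  exact hf x

instance {X : Scheme.{0}} (Z : TopologicalSpace.Closeds X) : IsReduced (reducedSubscheme Z) := by
  have (U : (Scheme.IdealSheafData.vanishingIdeal Z).subschemeCover.openCover.I₀) : IsReduced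
      ((Scheme.IdealSheafData.vanishingIdeal Z).subschemeCover.openCover.X U) := by
    change X.affineOpens at U
    have : _root_.IsReduced (Γ(X, U) ⧸ (Scheme.IdealSheafData.vanishingIdeal Z).ideal U) := by
      rw [← Ideal.isRadical_iff_quotient_reduced, Scheme.IdealSheafData.vanishingIdeal_ideal]
      exact PrimeSpectrum.isRadical_vanishingIdeal _
    change IsReduced (Spec (.of (Γ(X, U) ⧸ (Scheme.IdealSheafData.vanishingIdeal Z).ideal U)))
    infer_instance
  exact .of_openCover _ (Scheme.IdealSheafData.vanishingIdeal Z).subschemeCover.openCover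

theorem range_reducedSubschemeι {X : Scheme.{0}} (Z : TopologicalSpace.Closeds X) :
    Set.range (reducedSubschemeι Z) = Z := by
  simp

end Coordinates

/-! ### Smooth plane curves: irreducibility of the equation and normality of the charts. -/

section PlaneCurves

theorem aeval_eq_eval_apply {σ : Type} (a : σ → ℂ) (p : MvPolynomial σ ℂ) :
    aeval a p = eval a p := rfl

/-- The ideal generated by the first `j` variables, as the kernel of a substitution. -/
def initialVarsIdeal (j : ℕ) : Ideal (MvPolynomial (Fin 3) ℂ) :=
  RingHom.ker (aeval fun i : Fin 3 ↦ if i.1 < j then 0 else (X i : MvPolynomial (Fin 3) ℂ))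

instance (j : ℕ) : (initialVarsIdeal j).IsPrime := RingHom.ker_isPrime _

theorem initialVarsIdeal_lt {j : ℕ} (hj : j < 3) :
    initialVarsIdeal j < initialVarsIdeal (j + 1) := by
  refine SetLike.lt_iff_le_and_exists.mpr ⟨fun p hp ↦ ?_, X ⟨j, hj⟩, ?_, ?_⟩
  · rw [initialVarsIdeal, RingHom.mem_ker] at hp ⊢
    have := congrArg (aeval fun i : Fin 3 ↦ if i.1 < j + 1 then 0 else
      (X i : MvPolynomial (Fin 3) ℂ)) hp
    rw [map_zero, ← AlgHom.comp_apply, comp_aeval] at this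
    rw [← this]
    congr 2
    funext i
    split_ifs <;> simp_all
    · omega
  · simp [initialVarsIdeal, RingHom.mem_ker]
  · simp [initialVarsIdeal, RingHom.mem_ker]

theorem le_height_initialVarsIdeal {j : ℕ} (hj : j ≤ 3) : j ≤ (initialVarsIdeal j).height := by
  induction j with
  | zero => simp
  | succ j ih =>
    push_cast
    exact (add_le_add_left (ih (by omega)) 1).trans
      (Ideal.height_add_one_le_of_lt_of_isPrime (initialVarsIdeal_lt (by omega)))

theorem initialVarsIdeal_three {p : MvPolynomial (Fin 3) ℂ} :
    p ∈ initialVarsIdeal 3 ↔ eval 0 p = 0 := by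
  have : (fun i : Fin 3 ↦ if i.1 < 3 then 0 else (X i : MvPolynomial (Fin 3) ℂ)) =
      fun i ↦ algebraMap ℂ _ ((0 : Fin 3 → ℂ) i) := by
    funext i
    simp [i.2]
  have h : aeval (fun i ↦ algebraMap ℂ (MvPolynomial (Fin 3) ℂ) ((0 : Fin 3 → ℂ) i)) p = _ :=
    aeval_algebraMap_apply (MvPolynomial (Fin 3) ℂ) (0 : Fin 3 → ℂ) p
  rw [initialVarsIdeal, RingHom.mem_ker, this, h, aeval_eq_eval_apply]
  simp [algebraMap_eq]

/-- Two surfaces in affine three-space through the origin meet in another point. -/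
theorem exists_ne_zero_common_zero {f g : MvPolynomial (Fin 3) ℂ} (hf : eval 0 f = 0)
    (hg : eval 0 g = 0) : ∃ a : Fin 3 → ℂ, a ≠ 0 ∧ eval a f = 0 ∧ eval a g = 0 := by
  by_contra! h
  have hI : Ideal.span {f, g} ≤ initialVarsIdeal 3 := by
    rw [Ideal.span_le]
    rintro p (rfl | rfl)
    exacts [initialVarsIdeal_three.mpr hf, initialVarsIdeal_three.mpr hg]
  -- If the origin were the only common zero, then by the Nullstellensatz this minimal prime over
  -- two elements would be the ideal of the origin. Its height is at least 3, against Krull's bound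
  -- 2.
  obtain ⟨P, hP, hPm⟩ := Ideal.exists_minimalPrimes_le hI
  have hP' := hP.isPrime
  have hmP : initialVarsIdeal 3 ≤ P := by
    rw [← MvPolynomial.IsPrime.vanishingIdeal_zeroLocus (K := ℂ) P]
    intro p hp
    rw [mem_vanishingIdeal_iff]
    intro x hx
    have hfP := hx f (hP.1.2 (Ideal.subset_span (by simp)))
    have hgP := hx g (hP.1.2 (Ideal.subset_span (by simp)))
    rw [aeval_eq_eval_apply] at hfP hgP ⊢
    have hx0 : x = 0 := by
      by_contra hx0
      exact h x hx0 hfP hgP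
    rw [hx0]
    exact initialVarsIdeal_three.mp hp
  obtain rfl := le_antisymm hPm hmP
  have h1 := Ideal.height_le_card_of_mem_minimalPrimes_span (s := {f, g}) (by simp) hP
  have h2 := (le_height_initialVarsIdeal le_rfl).trans h1
  have h3 : ({f, g} : Set (MvPolynomial (Fin 3) ℂ)).ncard ≤ 2 := (Set.ncard_insert_le f {g}).trans (by simp)
  have h4 := Nat.cast_le.mp h2
  omega

/-- Nonconstant factors of a homogeneous polynomial vanish at the origin. -/
theorem eval_zero_eq_zero_of_mul_isHomogeneous {f g : MvPolynomial (Fin 3) ℂ} {n : ℕ}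
    (h : (f * g).IsHomogeneous n) (h0 : f * g ≠ 0) (hf : ¬ IsUnit f) : eval 0 f = 0 := by
  -- The substitution `X i ↦ T * X i` records the grading in an auxiliary variable `T`. The image of
  -- `f * g` is a monomial in `T`, so degree and trailing degree in `T` agree for each factor; if
  -- `f` has a nonzero constant term, both are zero and `f` is that constant.
  let φ : MvPolynomial (Fin 3) ℂ →ₐ[ℂ] Polynomial (MvPolynomial (Fin 3) ℂ) :=
    aeval fun i ↦ Polynomial.X ^ 1 * Polynomial.C (X i)
  have hφ1 (p) : Polynomial.eval 1 (φ p) = p := by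
    have : ((Polynomial.aeval (1 : MvPolynomial (Fin 3) ℂ)).restrictScalars ℂ).comp φ =
        AlgHom.id ℂ _ := by
      ext i
      simp [φ]
    exact DFunLike.congr_fun this p
  have hφ0 (p) : Polynomial.eval 0 (φ p) = C (eval 0 p) := by
    have : ((Polynomial.aeval (0 : MvPolynomial (Fin 3) ℂ)).restrictScalars ℂ).comp φ =
        (Algebra.ofId ℂ _).comp (aeval (0 : Fin 3 → ℂ)) := by
      ext i
      simp [φ]
    have := DFunLike.congr_fun this p
    rw [AlgHom.comp_apply, AlgHom.comp_apply, aeval_eq_eval_apply] at this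
    simpa [Algebra.ofId_apply, algebraMap_eq, Polynomial.coe_aeval_eq_eval] using this
  have hfg : φ (f * g) = Polynomial.X ^ n * Polynomial.C (f * g) := by
    have := aeval_smul_of_mem (fun _ : Fin 3 ↦ 1) (n := n) (p := f * g) h
      (Polynomial.X : Polynomial (MvPolynomial (Fin 3) ℂ)) (fun i ↦ Polynomial.C (X i))
    refine this.trans ?_
    congr 1
    have : (aeval fun i ↦ Polynomial.C (X i)) =
        (Algebra.ofId (MvPolynomial (Fin 3) ℂ)
          (Polynomial (MvPolynomial (Fin 3) ℂ))).restrictScalars ℂ := by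
      ext i
      simp [Algebra.ofId_apply]
    rw [this]
    rfl
  have hf0 : φ f ≠ 0 := fun h ↦ h0 (by rw [← hφ1 f, h]; simp)
  have hg0 : φ g ≠ 0 := fun h ↦ h0 (by rw [← hφ1 g, h]; simp)
  have h1 : (φ f).natDegree + (φ g).natDegree = n := by
    rw [← Polynomial.natDegree_mul hf0 hg0, ← map_mul, hfg, mul_comm,
      Polynomial.natDegree_C_mul_X_pow _ _ h0]
  have h2 : (φ f).natTrailingDegree + (φ g).natTrailingDegree = n := by
    rw [← Polynomial.natTrailingDegree_mul hf0 hg0, ← map_mul, hfg, mul_comm,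
      Polynomial.natTrailingDegree_mul_X_pow (by simpa using h0)]
    simp only [Polynomial.natTrailingDegree_C, zero_add]
  have h3 := Polynomial.natTrailingDegree_le_natDegree (φ f)
  have h4 := Polynomial.natTrailingDegree_le_natDegree (φ g)
  by_contra hne
  have h5 : (φ f).natTrailingDegree = 0 := by
    rw [Polynomial.natTrailingDegree_eq_zero]
    right
    rw [Polynomial.coeff_zero_eq_eval_zero, hφ0]
    simpa using hne
  have h6 := Polynomial.eq_C_of_natDegree_eq_zero (p := φ f) (by omega)
  have h7 := hφ1 f
  have h8 := hφ0 f
  rw [h6, Polynomial.eval_C] at h7 h8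
  exact hf (by rw [← h7, h8]; exact (isUnit_iff_ne_zero.mpr hne).map C)

/-- The equation of a smooth projective plane curve is prime. -/
theorem prime_of_smooth {f : MvPolynomial (Fin 3) ℂ} {n : ℕ} (hn : n ≠ 0) (h : f.IsHomogeneous n)
    (hf : ∀ t : Fin 3 → ℂ, t ≠ 0 → eval t f = 0 → ∃ k, eval t (pderiv k f) ≠ 0) : Prime f := by
  have h0 : f ≠ 0 := by
    rintro rfl
    obtain ⟨k, hk⟩ := hf 1 one_ne_zero (map_zero _)
    simp at hk
  refine UniqueFactorizationMonoid.irreducible_iff_prime.mp ⟨fun hu ↦ ?_, fun p q hpq ↦ ?_⟩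
  · have := (isUnit_iff_totalDegree_of_isReduced.mp hu).2
    rw [h.totalDegree h0] at this
    exact hn this
  · by_contra! hu
    subst hpq
    -- A common zero of both factors would be a singular point of the curve, by the Leibniz rule.
    obtain ⟨a, ha, hp, hq⟩ := exists_ne_zero_common_zero
      (eval_zero_eq_zero_of_mul_isHomogeneous h h0 hu.1)
      (eval_zero_eq_zero_of_mul_isHomogeneous (by rwa [mul_comm]) (by rwa [mul_comm]) hu.2)
    obtain ⟨k, hk⟩ := hf a ha (by simp [hp])
    simp [Derivation.leibniz, hp, hq] at hk

/-- Maximal ideals of finitely generated algebras over `ℂ` are kernels of complex points. -/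
theorem exists_algHom_ker_eq {A : Type} [CommRing A] [Algebra ℂ A] [Algebra.FiniteType ℂ A]
    (m : Ideal A) [m.IsMaximal] : ∃ φ : A →ₐ[ℂ] ℂ, RingHom.ker φ = m := by
  let : Field (A ⧸ m) := Ideal.Quotient.field m
  have : Module.Finite ℂ (A ⧸ m) := finite_of_finite_type_of_isJacobsonRing ℂ (A ⧸ m)
  let ψ : (A ⧸ m) →ₐ[ℂ] ℂ := IsAlgClosed.lift
  refine ⟨ψ.comp (Ideal.Quotient.mkₐ ℂ m), ?_⟩
  ext x
  rw [RingHom.mem_ker, AlgHom.comp_apply, map_eq_zero_iff ψ ψ.toRingHom.injective]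
  exact Ideal.Quotient.eq_zero_iff_mem

/-- A function on an affine variety is nonzero at some complex point. -/
theorem exists_algHom_ne_zero {A : Type} [CommRing A] [IsDomain A] [Algebra ℂ A]
    [Algebra.FiniteType ℂ A] {x : A} (hx : x ≠ 0) : ∃ φ : A →ₐ[ℂ] ℂ, φ x ≠ 0 := by
  have : IsJacobsonRing A := isJacobsonRing_of_finiteType (A := ℂ)
  have h : x ∉ Ideal.jacobson (⊥ : Ideal A) := by
    rw [IsJacobsonRing.out ‹_› (Ideal.IsPrime.isRadical Ideal.isPrime_bot)]
    simpa using hx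
  rw [Ideal.jacobson, Ideal.mem_sInf] at h
  push Not at h
  obtain ⟨m, ⟨-, hm⟩, hxm⟩ := h
  obtain ⟨φ, hφ⟩ := exists_algHom_ker_eq m
  exact ⟨φ, fun h ↦ hxm (hφ ▸ h)⟩

/-- First-order Taylor expansion modulo the square of the ideal of a point. Applied to the equation
of a curve, it gives the linear relation between the local coordinates. -/
theorem taylor_mem_sq {σ A : Type} [Fintype σ] [CommRing A] [Algebra ℂ A] (τ : σ → A)
    (a : σ → ℂ) (p : MvPolynomial σ ℂ) :
    aeval τ p - algebraMap ℂ A (eval a p) -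
      ∑ j, algebraMap ℂ A (eval a (pderiv j p)) * (τ j - algebraMap ℂ A (a j)) ∈
      (Ideal.span (Set.range fun j ↦ τ j - algebraMap ℂ A (a j))) ^ 2 := by
  classical
  set J := Ideal.span (Set.range fun j ↦ τ j - algebraMap ℂ A (a j))
  have hJ (j) : τ j - algebraMap ℂ A (a j) ∈ J := Ideal.subset_span ⟨j, rfl⟩
  induction p using MvPolynomial.induction_on with
  | C c => simp
  | add p q hp hq =>
    convert add_mem hp hq using 1
    simp only [map_add, add_mul, Finset.sum_add_distrib]
    ring
  | mul_X p i hp =>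
    set D := ∑ j, algebraMap ℂ A (eval a (pderiv j p)) * (τ j - algebraMap ℂ A (a j)) with hD
    have hDJ : D ∈ J := sum_mem fun j _ ↦ Ideal.mul_mem_left _ _ (hJ j)
    convert add_mem (Ideal.mul_mem_left _ (τ i) hp)
      ((pow_two J) ▸ Ideal.mul_mem_mul (hJ i) hDJ) using 1
    have : ∑ j, algebraMap ℂ A (eval a (pderiv j (p * X i))) * (τ j - algebraMap ℂ A (a j)) =
        algebraMap ℂ A (a i) * D + algebraMap ℂ A (eval a p) * (τ i - algebraMap ℂ A (a i)) := by
      simp_rw [Derivation.leibniz, smul_eq_mul, map_add, map_mul, add_mul,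
        Finset.sum_add_distrib, pderiv_X, hD, Finset.mul_sum]
      rw [add_comm]
      congr 1
      · simp [mul_assoc]
      · rw [Finset.sum_eq_single i] <;> simp +contextual
    rw [this]
    simp only [map_mul, aeval_X, eval_X]
    ring

/-- The coordinate ring of an affine chart of a smooth projective plane curve is integrally
closed. -/
theorem isIntegrallyClosed_of_smooth {A : Type} [CommRing A] [IsDomain A] [Algebra ℂ A]
    {τ : Fin 3 → A} (hτ : Algebra.adjoin ℂ (Set.range τ) = ⊤) {i : Fin 3} (hi : τ i = 1)
    {f : MvPolynomial (Fin 3) ℂ} {n : ℕ} (h : f.IsHomogeneous n)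
    (hf : ∀ t : Fin 3 → ℂ, t ≠ 0 → eval t f = 0 → ∃ k, eval t (pderiv k f) ≠ 0)
    (h0 : aeval τ f = 0) : IsIntegrallyClosed A := by
  have : Algebra.FiniteType ℂ A := ⟨⟨(Set.finite_range τ).toFinset, by simpa using hτ⟩⟩
  have : IsNoetherianRing A := Algebra.FiniteType.isNoetherianRing ℂ A
  refine IsIntegrallyClosed.of_localization_maximal fun m _ _ ↦ ?_
  obtain ⟨φ, hφ⟩ := exists_algHom_ker_eq m
  set a : Fin 3 → ℂ := fun j ↦ φ (τ j) with ha
  have hai : a i = 1 := by simp [ha, hi]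
  have hfa : eval a f = 0 := by
    rw [← aeval_eq_eval_apply, ha, ← comp_aeval_apply, h0, map_zero]
  set J := Ideal.span (Set.range fun j ↦ τ j - algebraMap ℂ A (a j)) with hJ
  have hJmem (j) : τ j - algebraMap ℂ A (a j) ∈ J := Ideal.subset_span ⟨j, rfl⟩
  have hmJ : m = J := by
    apply le_antisymm
    · intro x hx
      rw [← hφ, RingHom.mem_ker] at hx
      obtain ⟨p, rfl⟩ : ∃ p, aeval τ p = x := by
        have : x ∈ Algebra.adjoin ℂ (Set.range τ) := hτ ▸ Algebra.mem_top
        rwa [Algebra.adjoin_range_eq_range_aeval] at this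
      have hpa : eval a p = 0 := by
        rw [← aeval_eq_eval_apply, ha, ← comp_aeval_apply, hx]
      have := Ideal.pow_le_self two_ne_zero (taylor_mem_sq τ a p)
      rw [hpa, map_zero, sub_zero] at this
      exact (Submodule.sub_mem_iff_left _ (sum_mem fun j _ ↦ Ideal.mul_mem_left _ _
        (hJmem j))).mp this
    · rw [hJ, Ideal.span_le, ← hφ]
      rintro _ ⟨j, rfl⟩
      simp [RingHom.mem_ker, ha]
  -- Euler's relation: at a zero `a` of `f` with `a i = 1`, the derivative along `i` is a
  -- combination of the others, so it cannot be the only nonzero one.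
  obtain ⟨k, hki, hk⟩ : ∃ k, k ≠ i ∧ eval a (pderiv k f) ≠ 0 := by
    by_contra! hne
    obtain ⟨k, hk⟩ := hf a (fun h ↦ by simp [h] at hai) hfa
    obtain rfl : k = i := by
      by_contra hki
      exact hk (hne k hki)
    have he := congrArg (eval a) h.sum_X_mul_pderiv
    rw [map_sum, Finset.sum_eq_single k (fun j _ hj ↦ by simp [hne j hj]) (by simp)] at he
    simp [hai, hfa, hk] at he
  obtain ⟨l, hl⟩ : ∃ l, ∀ j, j = i ∨ j = k ∨ j = l :=
    (by decide : ∀ i k : Fin 3, k ≠ i → ∃ l, ∀ j, j = i ∨ j = k ∨ j = l) i k hki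
  -- Of the three generators of `J` the one with index `i` is zero, and the expansion of `f`
  -- eliminates the one with index `k` modulo `J²`, its coefficient being a unit. Only the index `l`
  -- remains.
  have hJle : J ≤ Ideal.span {τ l - algebraMap ℂ A (a l)} ⊔ J * J := by
    have hl' : τ l - algebraMap ℂ A (a l) ∈
        Ideal.span {τ l - algebraMap ℂ A (a l)} ⊔ J * J :=
      Ideal.mem_sup_left (Ideal.mem_span_singleton_self _)
    have hi' : τ i - algebraMap ℂ A (a i) = 0 := by simp [hi, hai]
    rw [hJ, Ideal.span_le]
    rintro _ ⟨j, rfl⟩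
    rcases hl j with rfl | rfl | rfl
    · simp [hi']
    · have hT := taylor_mem_sq τ a f
      rw [h0, hfa, map_zero, sub_zero, zero_sub, neg_mem_iff, pow_two] at hT
      have hT' := Ideal.mem_sup_right (S := Ideal.span {τ l - algebraMap ℂ A (a l)}) hT
      rw [← Finset.add_sum_erase _ _ (Finset.mem_univ j)] at hT'
      have hrest : ∑ x ∈ Finset.univ.erase j, algebraMap ℂ A (eval a (pderiv x f)) *
          (τ x - algebraMap ℂ A (a x)) ∈ Ideal.span {τ l - algebraMap ℂ A (a l)} ⊔ J * J := by
        refine sum_mem fun x hx ↦ Ideal.mul_mem_left _ _ ?_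
        rcases hl x with rfl | rfl | rfl
        · simp [hi']
        · simp at hx
        · exact hl'
      have h1 := (Submodule.add_mem_iff_left _ hrest).mp hT'
      have hu : IsUnit (algebraMap ℂ A (eval a (pderiv j f))) :=
        (isUnit_iff_ne_zero.mpr hk).map _
      exact (Ideal.unit_mul_mem_iff_mem _ hu).mp h1
    · exact hl'
  let L := Localization.AtPrime m
  have hmax : IsLocalRing.maximalIdeal L = J.map (algebraMap A L) := by
    rw [← hmJ, Localization.AtPrime.map_eq_maximalIdeal]
  have hprinc : IsLocalRing.maximalIdeal L =
      Ideal.span {algebraMap A L (τ l - algebraMap ℂ A (a l))} := by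
    apply le_antisymm
    -- Nakayama's lemma makes the maximal ideal principal; a noetherian local domain with principal
    -- maximal ideal is a field or a discrete valuation ring, hence integrally closed.
    · refine Submodule.le_of_le_smul_of_le_jacobson_bot (I := IsLocalRing.maximalIdeal L)
        (IsNoetherian.noetherian _) (IsLocalRing.jacobson_eq_maximalIdeal ⊥ bot_ne_top).ge ?_
      have := Ideal.map_mono (f := algebraMap A L) hJle
      rw [Ideal.map_sup, Ideal.map_mul, Ideal.map_span _ {_}, Set.image_singleton] at this
      rw [hmax]
      simpa using this
    · rw [Ideal.span_singleton_le_iff_mem, hmax]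
      exact Ideal.mem_map_of_mem _ (hJmem l)
  have htfae := tfae_of_isNoetherianRing_of_isLocalRing_of_isDomain L
  have hP : (IsLocalRing.maximalIdeal L).IsPrincipal := ⟨_, hprinc⟩
  exact ((htfae.out 4 3 rfl rfl).mp hP).1

end PlaneCurves

/-! ### The generic point of a plane curve, its function field and its affine charts. -/

section Curve

variable {f : MvPolynomial (Fin 3) ℂ} {n : ℕ}

theorem mem_planeWeight {σ : Type} {p : MvPolynomial σ ℂ} {m : ℕ} :
    p ∈ weightedHomogeneousSubmodule ℂ (fun _ : σ ↦ 1) m ↔ p.IsHomogeneous m := Iff.rfl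

theorem not_dvd_of_isHomogeneous (h : f.IsHomogeneous n) {m : ℕ} (hmn : m < n)
    {p : MvPolynomial (Fin 3) ℂ} (hp : p.IsHomogeneous m) (hp0 : p ≠ 0) : ¬ f ∣ p := by
  rintro ⟨q, rfl⟩
  have hf : f ≠ 0 := left_ne_zero_of_mul hp0
  have hq : q ≠ 0 := right_ne_zero_of_mul hp0
  have := hp.totalDegree hp0
  rw [totalDegree_mul_of_isDomain hf hq, h.totalDegree hf] at this
  omega

/-- The generic point of an irreducible plane curve. -/
def curveGenericPoint (h : f.IsHomogeneous n) (hn : 1 < n) (hf : Prime f) : WProj planeWeight where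
  asHomogeneousIdeal := ⟨Ideal.span {f}, Ideal.homogeneous_span _ _ (by
    rintro _ rfl
    exact ⟨n, h⟩)⟩
  isPrime := (Ideal.span_singleton_prime hf.ne_zero).mpr hf
  not_irrelevant_le hle := by
    have h1 : (X 0 : MvPolynomial (Fin 3) ℂ) ∈ HomogeneousIdeal.irrelevant
        (weightedHomogeneousSubmodule ℂ planeWeight) := by
      rw [HomogeneousIdeal.mem_irrelevant_iff, GradedRing.proj_apply,
        DirectSum.decompose_of_mem_ne _ (X_mem (w := planeWeight) (i := 0) rfl) one_ne_zero]
    have h2 : X 0 ∈ Ideal.span {f} := hle h1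
    exact not_dvd_of_isHomogeneous h hn (isHomogeneous_X _ _) (X_ne_zero _)
      (Ideal.mem_span_singleton.mp h2)

theorem mem_curveGenericPoint (h : f.IsHomogeneous n) (hn : 1 < n) (hf : Prime f)
    {p : MvPolynomial (Fin 3) ℂ} :
    p ∈ (curveGenericPoint h hn hf).asHomogeneousIdeal ↔ f ∣ p :=
  Ideal.mem_span_singleton

theorem closure_curveGenericPoint (h : f.IsHomogeneous n) (hn : 1 < n) (hf : Prime f) :
    closure {curveGenericPoint h hn hf} = (WProj.zeros planeWeight f : Set (WProj planeWeight)) := by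
  ext y
  have h1 := ProjectiveSpectrum.le_iff_mem_closure (weightedHomogeneousSubmodule ℂ planeWeight)
    (curveGenericPoint h hn hf) y
  refine h1.symm.trans ?_
  change Ideal.span {f} ≤ y.asHomogeneousIdeal.toIdeal ↔ ({f} : Set _) ⊆ _
  rw [Ideal.span_le]
  rfl

theorem exists_generic (h : f.IsHomogeneous n) (hn : 1 < n) (hf : Prime f) :
    ∃ c : WProj.hypersurface planeWeight f, closure {c} = Set.univ ∧
      WProj.hypersurfaceι planeWeight f c = curveGenericPoint h hn hf := by
  have h1 : curveGenericPoint h hn hf ∈ Set.range (WProj.hypersurfaceι planeWeight f) := by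
    rw [range_reducedSubschemeι]
    rw [← closure_curveGenericPoint h hn hf]
    exact subset_closure rfl
  obtain ⟨c, hc⟩ := h1
  refine ⟨c, ?_, hc⟩
  have hemb := (WProj.hypersurfaceι planeWeight f).isClosedEmbedding
  rw [Set.eq_univ_iff_forall]
  intro y
  rw [hemb.isEmbedding.closure_eq_preimage_closure_image, Set.image_singleton, hc,
    closure_curveGenericPoint h hn hf, ← range_reducedSubschemeι]
  exact ⟨y, rfl⟩

theorem isIntegral_hypersurface (h : f.IsHomogeneous n) (hn : 1 < n) (hf : Prime f) :
    IsIntegral (WProj.hypersurface planeWeight f) := by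
  obtain ⟨c, hc, -⟩ := exists_generic h hn hf
  have : Nonempty (WProj.hypersurface planeWeight f) := ⟨c⟩
  have : IrreducibleSpace (WProj.hypersurface planeWeight f) := by
    have := (isIrreducible_singleton (x := c)).closure
    rw [hc] at this
    exact (irreducibleSpace_def _).mpr this
  exact isIntegral_of_irreducibleSpace_of_isReduced _

/-- The chart `t i ≠ 0` of a plane curve. -/
def curveChart (f : MvPolynomial (Fin 3) ℂ) (i : Fin 3) :
    (WProj.hypersurface planeWeight f).Opens :=
  WProj.hypersurfaceι planeWeight f ⁻¹ᵁ
    Proj.basicOpen (weightedHomogeneousSubmodule ℂ planeWeight) (X i)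

theorem isAffineOpen_basicOpen_X (i : Fin 3) :
    IsAffineOpen (Proj.basicOpen (weightedHomogeneousSubmodule ℂ planeWeight) (X i)) :=
  Proj.isAffineOpen_basicOpen _ _ (X_mem (w := planeWeight) (i := i) rfl) one_pos

theorem isAffineOpen_curveChart (f : MvPolynomial (Fin 3) ℂ) (i : Fin 3) :
    IsAffineOpen (curveChart f i) :=
  (isAffineOpen_basicOpen_X i).preimage _

theorem iSup_curveChart (f : MvPolynomial (Fin 3) ℂ) : ⨆ i, curveChart f i = ⊤ := by
  have h := Proj.iSup_basicOpen_eq_top' (weightedHomogeneousSubmodule ℂ planeWeight)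
    (fun i : Fin 3 ↦ (X i : MvPolynomial (Fin 3) ℂ))
    (fun i ↦ ⟨1, isHomogeneous_X _ _⟩) (by
      rw [eq_top_iff]
      intro p _
      have : p ∈ Algebra.adjoin ℂ (Set.range (X : Fin 3 → MvPolynomial (Fin 3) ℂ)) := by
        rw [adjoin_range_X]
        trivial
      induction this using Algebra.adjoin_induction with
      | mem x hx => exact Algebra.subset_adjoin hx
      | algebraMap c => 
        exact Subalgebra.algebraMap_mem (Algebra.adjoin (weightedHomogeneousSubmodule ℂ
          planeWeight 0) (Set.range (X : Fin 3 → MvPolynomial (Fin 3) ℂ)))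
          (algebraMap ℂ (weightedHomogeneousSubmodule ℂ planeWeight 0) c)
      | add x y _ _ hx hy => exact add_mem (hx trivial) (hy trivial)
      | mul x y _ _ hx hy => exact mul_mem (hx trivial) (hy trivial))
  refine TopologicalSpace.Opens.ext (Set.eq_univ_of_forall fun x ↦ ?_)
  have hx : WProj.hypersurfaceι planeWeight f x ∈ ⨆ i : Fin 3,
      Proj.basicOpen (weightedHomogeneousSubmodule ℂ planeWeight) (X i) := by
    rw [h]
    trivial
  obtain ⟨i, hi⟩ := TopologicalSpace.Opens.mem_iSup.mp hx
  exact TopologicalSpace.Opens.mem_iSup.mpr ⟨i, hi⟩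

theorem isUnit_aeval_X {σ R : Type} [CommRing R] [Algebra ℂ R] {v : σ → R} {i : σ} (hv : IsUnit (v i)) :
    IsUnit (aeval v (X i : MvPolynomial σ ℂ)) := by rwa [aeval_X]

theorem awayEval_aeval_awayCoord {σ R : Type} {w : σ → ℕ} [CommRing R] [Algebra ℂ R] {v : σ → R}
    {i : σ} (hi : w i = 1) (hv : IsUnit (aeval v (X i : MvPolynomial σ ℂ))) (hvi : v i = 1)
    (p : MvPolynomial σ ℂ) :
    awayEval w (X i) v hv (aeval (awayCoord i hi) p) = aeval v p := by
  induction p using MvPolynomial.induction_on with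
  | C c =>
    have h0 : (C c : MvPolynomial σ ℂ) ∈ weightedHomogeneousSubmodule ℂ w (0 • 1) := by
      rw [zero_smul]
      exact isWeightedHomogeneous_C _ _
    have h := awayEval_mk hv (X_mem hi) 0 (C c) h0
    rw [aeval_awayCoord i hi 0 (C c) h0]
    simpa using h
  | add p q hp hq => rw [map_add, map_add, hp, hq, map_add]
  | mul_X p j hp =>
    rw [map_mul, map_mul, hp, map_mul, aeval_X, aeval_X, awayEval_awayCoord v i hi hv hvi]

/-- The ring of functions on the chart `t i ≠ 0` of a plane curve is a quotient of that of the
chart of the plane. -/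
theorem exists_surjective_curveChart (f : MvPolynomial (Fin 3) ℂ) (i : Fin 3) :
    ∃ α : CommRingCat.of (HomogeneousLocalization.Away
        (weightedHomogeneousSubmodule ℂ planeWeight) (X i)) ⟶
        Γ(WProj.hypersurface planeWeight f, curveChart f i), Function.Surjective α.hom ∧
      ∀ (R : Type) [CommRing R] [Algebra ℂ R] (v : Fin 3 → R) (hv : v i = 1)
        (ψ : Γ(WProj.hypersurface planeWeight f, curveChart f i) ⟶ .of R),
        (Spec.map ψ ≫ (isAffineOpen_curveChart f i).fromSpec) ≫ WProj.hypersurfaceι planeWeight f =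
        coordMor (X i) (X_mem (w := planeWeight) rfl) one_pos v
          (isUnit_aeval_X (hv ▸ isUnit_one)) →
        α ≫ ψ = CommRingCat.ofHom (awayEval planeWeight (X i) v
          (isUnit_aeval_X (hv ▸ isUnit_one))) := by
  have hD := isAffineOpen_basicOpen_X i
  let e := IsOpenImmersion.isoOfRangeEq
    (Proj.awayι _ _ (X_mem (w := planeWeight) (i := i) rfl) one_pos) hD.fromSpec (by
      rw [hD.range_fromSpec, ← Proj.opensRange_awayι _ _ (X_mem (w := planeWeight) (i := i) rfl)
        one_pos]
      rfl)
  have he : Spec.map (Spec.preimage e.inv) = e.inv := Spec.map_preimage _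
  have hiso : IsIso (Spec.map (Spec.preimage e.inv)) := by rw [he]; infer_instance
  have hiso' : IsIso (Spec.preimage e.inv) := by
    exact (ConcreteCategory.isIso_iff_bijective _).mpr (isIso_SpecMap_iff.mp hiso)
  let a : Γ(WProj planeWeight, Proj.basicOpen (weightedHomogeneousSubmodule ℂ planeWeight) (X i)) ⟶
      Γ(WProj.hypersurface planeWeight f, curveChart f i) :=
    (WProj.hypersurfaceι planeWeight f).app _
  have ha : Function.Surjective a.hom :=
    (Scheme.IdealSheafData.vanishingIdeal (WProj.zeros planeWeight f)).subschemeι_app_surjective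
      ⟨_, hD⟩
  refine ⟨Spec.preimage e.inv ≫ a, ?_, fun R _ _ v hv ψ hψ ↦ ?_⟩
  · rw [CommRingCat.hom_comp, RingHom.coe_comp]
    exact ha.comp (ConcreteCategory.bijective_of_isIso (Spec.preimage e.inv)).2
  · apply Spec.map_injective
    rw [← cancel_mono (Proj.awayι _ _ (X_mem (w := planeWeight) (i := i) rfl) one_pos),
      Spec.map_comp, Spec.map_comp, he]
    refine Eq.trans ?_ hψ
    rw [Category.assoc, Category.assoc, Category.assoc]
    congr 1
    rw [IsOpenImmersion.isoOfRangeEq_inv_fac]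
    have := hD.SpecMap_appLE_fromSpec (WProj.hypersurfaceι planeWeight f)
      (isAffineOpen_curveChart f i) le_rfl
    exact (congrArg (fun t ↦ Spec.map t ≫ hD.fromSpec)
      (Scheme.Hom.app_eq_appLE (f := WProj.hypersurfaceι planeWeight f))).trans this

/-- A function field of an irreducible plane curve, with the homogeneous coordinates of the
generic point. -/
structure CurveFunctionField (f : MvPolynomial (Fin 3) ℂ) (K : Type) [Field K] [Algebra ℂ K] where
  coord : Fin 3 → K
  coord_zero : coord 0 = 1
  mor : Spec (.of K) ⟶ WProj.hypersurface planeWeight f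
  mor_comp : mor ≫ WProj.hypersurfaceι planeWeight f =
    coordMor (X 0) (X_mem (w := planeWeight) rfl) one_pos coord
      (isUnit_aeval_X (coord_zero ▸ isUnit_one))
  aeval_eq_zero_iff : ∀ {m : ℕ} {p : MvPolynomial (Fin 3) ℂ}, p.IsHomogeneous m →
    (aeval coord p = 0 ↔ f ∣ p)
  chartMap : ∀ i, Γ(WProj.hypersurface planeWeight f, curveChart f i) ⟶ .of K
  chartMap_injective : ∀ i, Function.Injective (chartMap i).hom
  mor_eq : ∀ i, mor = Spec.map (chartMap i) ≫ (isAffineOpen_curveChart f i).fromSpec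
  exists_mul_chartMap : ∀ i x, ∃ a c, (chartMap i).hom c ≠ 0 ∧
    x * (chartMap i).hom c = (chartMap i).hom a

/-- The field is the stalk at the generic point, with the complex structure pulled back along the
structure morphism. The generic point corresponds to the ideal generated by `f`, which contains no
coordinate; hence it lies in every chart and can be normalized by `coord 0 = 1`. -/
theorem exists_curveFunctionField (h : f.IsHomogeneous n) (hn : 1 < n) (hf : Prime f) :
    ∃ (K : Type) (_ : Field K) (_ : Algebra ℂ K), Nonempty (CurveFunctionField f K) := by
  have hint := isIntegral_hypersurface h hn hf
  obtain ⟨c, hc, hιc⟩ := exists_generic h hn hf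
  have hgc : genericPoint (WProj.hypersurface planeWeight f) = c :=
    (genericPoint_spec _).eq hc
  let K : Type := (WProj.hypersurface planeWeight f).functionField
  let g : Spec (.of K) ⟶ WProj.hypersurface planeWeight f :=
    (WProj.hypersurface planeWeight f).fromSpecStalk (genericPoint _)
  have : Subsingleton (Spec (.of K)) := inferInstanceAs (Subsingleton (PrimeSpectrum K))
  have hg (x : Spec (.of K)) : g x = c := by
    rw [← hgc]
    obtain rfl : x = IsLocalRing.closedPoint _ := Subsingleton.elim _ _
    exact Scheme.fromSpecStalk_closedPoint
  let a : .of ℂ ⟶ CommRingCat.of K := Spec.preimage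
    (g ≫ WProj.hypersurfaceι planeWeight f ≫ WProj.toSpec planeWeight)
  let : Algebra ℂ K := a.hom.toAlgebra
  have hbasic (i : Fin 3) : curveGenericPoint h hn hf ∈
      Proj.basicOpen (weightedHomogeneousSubmodule ℂ planeWeight) (X i) := by
    rw [Proj.mem_basicOpen, mem_curveGenericPoint h hn hf]
    exact not_dvd_of_isHomogeneous h hn (isHomogeneous_X _ _) (X_ne_zero _)
  have hmem (i : Fin 3) : genericPoint (WProj.hypersurface planeWeight f) ∈ curveChart f i := by
    rw [hgc]
    change WProj.hypersurfaceι planeWeight f c ∈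
      Proj.basicOpen (weightedHomogeneousSubmodule ℂ planeWeight) (X i)
    rw [hιc]
    exact hbasic i
  obtain ⟨τ, hτ, hgτ⟩ := exists_eq_coordMor (w := planeWeight) (R := K) 0 rfl
    (g ≫ WProj.hypersurfaceι planeWeight f) (by
      rw [Category.assoc]
      exact (Spec.map_preimage _).symm) (fun x ↦ by
      rw [Scheme.Hom.comp_apply, hg, hιc]
      exact hbasic 0)
  refine ⟨K, inferInstance, inferInstance, ⟨{
    coord := τ
    coord_zero := hτ
    mor := g
    mor_comp := hgτ
    aeval_eq_zero_iff := fun {m p} hp ↦ ?_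
    chartMap := fun i ↦ (WProj.hypersurface planeWeight f).presheaf.germ (curveChart f i) _ (hmem i)
    chartMap_injective := fun i ↦ germ_injective_of_isIntegral _ _ _
    mor_eq := fun i ↦ ?_
    exists_mul_chartMap := fun i x ↦ ?_ }⟩⟩
  · let x : Spec (.of K) := (⊥ : PrimeSpectrum K)
    have h1 := mem_coordMor_iff (X_mem (w := planeWeight) (i := 0) rfl) one_pos τ
      (isUnit_aeval_X (hτ ▸ isUnit_one)) x hp
    rw [← hgτ] at h1
    have h2 : (g ≫ WProj.hypersurfaceι planeWeight f) x = curveGenericPoint h hn hf := by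
      rw [Scheme.Hom.comp_apply, hg, hιc]
    rw [← mem_curveGenericPoint h hn hf, ← h2]
    exact h1.symm
  · exact ((isAffineOpen_curveChart f i).fromSpecStalk_eq_fromSpecStalk (hmem i)).symm
  · have : Nonempty (curveChart f i) := ⟨⟨_, hmem i⟩⟩
    have := functionField_isFractionRing_of_isAffineOpen _ _ (isAffineOpen_curveChart f i)
    obtain ⟨⟨a, c⟩, hac⟩ := IsLocalization.surj
      (nonZeroDivisors Γ(WProj.hypersurface planeWeight f, curveChart f i)) (x : K)
    refine ⟨a, c, fun h0 ↦ nonZeroDivisors.coe_ne_zero c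
      (germ_injective_of_isIntegral _ _ (hmem i) (h0.trans (map_zero _).symm)), hac⟩

namespace CurveFunctionField

variable {K : Type} [Field K] [Algebra ℂ K] (F : CurveFunctionField f K)

theorem aeval_self (h : f.IsHomogeneous n) : aeval F.coord f = 0 :=
  (F.aeval_eq_zero_iff h).mpr dvd_rfl

/-- This degree count supplies the nonvanishing statements at the generic point of the curve: for
coordinates and polar forms (degree 1) and for cofactors (degree 3) against the quartic. -/
theorem aeval_ne_zero (h : f.IsHomogeneous n) {m : ℕ} (hm : m < n) {p : MvPolynomial (Fin 3) ℂ}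
    (hp : p.IsHomogeneous m) (hp0 : p ≠ 0) : aeval F.coord p ≠ 0 := fun h0 ↦
  not_dvd_of_isHomogeneous h hm hp hp0 ((F.aeval_eq_zero_iff hp).mp h0)

theorem coord_ne_zero (h : f.IsHomogeneous n) (hn : 1 < n) (i : Fin 3) : F.coord i ≠ 0 := by
  have := F.aeval_ne_zero h hn (isHomogeneous_X ℂ i) (X_ne_zero i)
  rwa [aeval_X] at this

/-- The affine coordinates of the generic point on the chart `t i ≠ 0`. -/
def affineCoord (i j : Fin 3) : K := F.coord j / F.coord i

theorem affineCoord_self (h : f.IsHomogeneous n) (hn : 1 < n) (i : Fin 3) :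
    F.affineCoord i i = 1 := div_self (F.coord_ne_zero h hn i)

theorem mor_comp_eq (h : f.IsHomogeneous n) (hn : 1 < n) (i : Fin 3) :
    F.mor ≫ WProj.hypersurfaceι planeWeight f =
      coordMor (X i) (X_mem (w := planeWeight) rfl) one_pos (F.affineCoord i)
        (isUnit_aeval_X (F.affineCoord_self h hn i ▸ isUnit_one)) := by
  have hi := isUnit_iff_ne_zero.mpr (F.coord_ne_zero h hn i)
  rw [F.mor_comp, coordMor_eq _ _ (X_mem (w := planeWeight) (i := i) rfl) one_pos F.coord _
    (isUnit_aeval_X hi)]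
  refine coordMor_smul (w := planeWeight) _ _ _ _ _ _ (F.coord i)⁻¹ fun j ↦ ?_
  rw [affineCoord, pow_one, div_eq_inv_mul]

theorem comp_chartMap (h : f.IsHomogeneous n) (hn : 1 < n) (i : Fin 3) :
    (Spec.map (F.chartMap i) ≫ (isAffineOpen_curveChart f i).fromSpec) ≫
      WProj.hypersurfaceι planeWeight f =
      coordMor (X i) (X_mem (w := planeWeight) rfl) one_pos (F.affineCoord i)
        (isUnit_aeval_X (F.affineCoord_self h hn i ▸ isUnit_one)) := by
  rw [← F.mor_eq, F.mor_comp_eq h hn]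

/-- The coordinate ring of the chart `t i ≠ 0`, as a subring of the function field. -/
def chartRing (i : Fin 3) : Subalgebra ℂ K := Algebra.adjoin ℂ (Set.range (F.affineCoord i))

theorem range_chartMap (h : f.IsHomogeneous n) (hn : 1 < n) (i : Fin 3) (x : K) :
    x ∈ (F.chartMap i).hom.range ↔ x ∈ F.chartRing i := by
  obtain ⟨α, hα, H⟩ := exists_surjective_curveChart f i
  have hi := F.affineCoord_self h hn i
  have h1 := H K (F.affineCoord i) hi (F.chartMap i) (F.comp_chartMap h hn i)
  have h2 (y) : (F.chartMap i).hom (α.hom y) = awayEval planeWeight (X i) (F.affineCoord i)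
      (isUnit_aeval_X (hi ▸ isUnit_one)) y := congr(($h1).hom y)
  rw [chartRing, Algebra.adjoin_range_eq_range_aeval]
  constructor
  · rintro ⟨y, rfl⟩
    obtain ⟨y, rfl⟩ := hα y
    obtain ⟨m, p, hp, rfl⟩ := HomogeneousLocalization.Away.mk_surjective _
      (X_mem (w := planeWeight) (i := i) rfl) y
    rw [h2]
    refine ⟨p, ?_⟩
    have := awayEval_mk (isUnit_aeval_X (hi ▸ isUnit_one)) (X_mem (w := planeWeight) (i := i) rfl)
      m p hp
    have h3 : (aeval (F.affineCoord i) (X i : MvPolynomial (Fin 3) ℂ)) ^ m = 1 := by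
      rw [aeval_X, hi, one_pow]
    exact ((congrArg _ h3).symm.trans this).symm.trans (mul_one _)
  · rintro ⟨p, rfl⟩
    refine ⟨α.hom (aeval (awayCoord (w := planeWeight) i rfl) p), ?_⟩
    rw [h2]
    exact awayEval_aeval_awayCoord (w := planeWeight) (i := i) rfl _ hi p

/-- The affine coordinates, as elements of the coordinate ring of the chart `t i ≠ 0`. -/
def chartCoord (i j : Fin 3) : F.chartRing i :=
  ⟨F.affineCoord i j, Algebra.subset_adjoin ⟨j, rfl⟩⟩

theorem adjoin_chartCoord (i : Fin 3) : Algebra.adjoin ℂ (Set.range (F.chartCoord i)) = ⊤ := by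
  have := Algebra.adjoin_adjoin_coe_preimage (R := ℂ) (s := Set.range (F.affineCoord i))
  refine Eq.trans ?_ this
  congr 1
  ext ⟨x, hx⟩
  simp only [Set.mem_range, Subtype.ext_iff, chartCoord]
  exact Iff.rfl

theorem aeval_chartCoord (i : Fin 3) (p : MvPolynomial (Fin 3) ℂ) :
    (aeval (F.chartCoord i) p : K) = aeval (F.affineCoord i) p :=
  comp_aeval_apply (R := ℂ) (F.chartCoord i) (F.chartRing i).val p

theorem aeval_affineCoord (h : f.IsHomogeneous n) (i : Fin 3) : aeval (F.affineCoord i) f = 0 := by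
  have h2 := aeval_smul_of_mem (fun _ : Fin 3 ↦ 1) (p := f) h (F.coord i)⁻¹ F.coord
  rw [F.aeval_self h, mul_zero] at h2
  rw [← h2]
  congr 2
  funext j
  simp [affineCoord, div_eq_inv_mul]

theorem isIntegrallyClosed_chartRing (h : f.IsHomogeneous n) (hn : 1 < n)
    (hf : ∀ t : Fin 3 → ℂ, t ≠ 0 → eval t f = 0 → ∃ k, eval t (pderiv k f) ≠ 0) (i : Fin 3) :
    IsIntegrallyClosed (F.chartRing i) := by
  exact isIntegrallyClosed_of_smooth (F.adjoin_chartCoord i)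
    (Subtype.ext (F.affineCoord_self h hn i)) h hf
    (Subtype.val_injective ((F.aeval_chartCoord i f).trans (F.aeval_affineCoord h i)))

/-- The complex points of a chart of the curve are points of its coordinate ring. -/
theorem exists_algHom_chartRing (h : f.IsHomogeneous n) (hn : 1 < n) {i : Fin 3} {t : Fin 3 → ℂ}
    (ht : t i = 1) (hft : eval t f = 0) :
    ∃ χ : F.chartRing i →ₐ[ℂ] ℂ,
      ∀ j, χ (F.chartCoord i j) = t j := by
  obtain ⟨α, hα, H⟩ := exists_surjective_curveChart f i
  have hi := F.affineCoord_self h hn i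
  have h1 := H K (F.affineCoord i) hi (F.chartMap i) (F.comp_chartMap h hn i)
  have h2 (y) : (F.chartMap i).hom (α.hom y) = awayEval planeWeight (X i) (F.affineCoord i)
      (isUnit_aeval_X (hi ▸ isUnit_one)) y := congr(($h1).hom y)
  have hu : IsUnit (aeval t (X i : MvPolynomial (Fin 3) ℂ)) := isUnit_aeval_X (ht ▸ isUnit_one)
  let q : Spec (.of ℂ) ⟶ WProj planeWeight :=
    coordMor (X i) (X_mem (w := planeWeight) rfl) one_pos t hu
  obtain ⟨g, hg⟩ := exists_lift_reducedSubscheme q (WProj.zeros planeWeight f) (fun x ↦ by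
    have := (mem_coordMor_iff (X_mem (w := planeWeight) (i := i) rfl) one_pos t hu x
      (n := n) (p := f) h).mpr (by rw [aeval_eq_eval_apply, hft]; exact zero_mem _)
    exact Set.singleton_subset_iff.mpr this)
  obtain ⟨χ, hχ⟩ := exists_eq_specMap_fromSpec (isAffineOpen_curveChart f i) g (fun x ↦ by
    change WProj.hypersurfaceι planeWeight f (g x) ∈
      Proj.basicOpen (weightedHomogeneousSubmodule ℂ planeWeight) (X i)
    rw [← Scheme.Hom.comp_apply, hg, Proj.mem_basicOpen,
      mem_coordMor_iff (X_mem (w := planeWeight) (i := i) rfl) one_pos t hu x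
      (n := 1) (isHomogeneous_X _ _), aeval_X, ht]
    exact fun h ↦ x.2.ne_top ((Ideal.eq_top_iff_one _).mpr h))
  have h3 := H ℂ t ht χ (by rw [← hχ, hg])
  have h4 (y) : χ.hom (α.hom y) = awayEval planeWeight (X i) t hu y := congr(($h3).hom y)
  -- Every relation between the affine coordinates of the generic point holds at `t`, because the
  -- functions on the chart inject into `K`. The homomorphism is then well defined by choosing
  -- polynomial representatives.
  have key (p : MvPolynomial (Fin 3) ℂ) (hp : aeval (F.affineCoord i) p = 0) :
      aeval t p = 0 := by
    rw [← awayEval_aeval_awayCoord (w := planeWeight) rfl (isUnit_aeval_X (hi ▸ isUnit_one)) hi,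
      ← h2, map_eq_zero_iff _ (F.chartMap_injective i)] at hp
    rw [← awayEval_aeval_awayCoord (w := planeWeight) rfl hu ht, ← h4, hp, map_zero]
  have hsurj (x : F.chartRing i) : ∃ p : MvPolynomial (Fin 3) ℂ, aeval (F.affineCoord i) p = x.1 := by
    have h5 : x.1 ∈ Algebra.adjoin ℂ (Set.range (F.affineCoord i)) := x.2
    rwa [Algebra.adjoin_range_eq_range_aeval] at h5
  choose P hP using hsurj
  have hχ' (x) (p : MvPolynomial (Fin 3) ℂ) (hp : aeval (F.affineCoord i) p = x.1) :
      aeval t (P x) = aeval t p := by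
    rw [← sub_eq_zero, ← map_sub]
    exact key _ (by rw [map_sub, hP, hp, sub_self])
  refine ⟨AlgHom.ofLinearMap
    { toFun := fun x ↦ aeval t (P x)
      map_add' := fun x y ↦ by
        rw [hχ' (x + y) (P x + P y) (by rw [map_add, hP, hP]; rfl), map_add]
      map_smul' := fun c x ↦ by
        rw [hχ' (c • x) (c • P x) (by rw [map_smul, hP]; rfl), map_smul]
        rfl } ?_ ?_, fun j ↦ ?_⟩
  · change aeval t (P 1) = 1
    rw [hχ' 1 1 (by rw [map_one]; rfl), map_one]
  · intro x y
    change aeval t (P (x * y)) = aeval t (P x) * aeval t (P y)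
    rw [hχ' (x * y) (P x * P y) (by rw [map_mul, hP, hP]; rfl), map_mul]
  · change aeval t (P _) = t j
    rw [hχ' _ (X j) (aeval_X _ _), aeval_X]

end CurveFunctionField

end Curve

/-! ### The resultant of a quadratic map on a line and its factorization through the fixed points.
-/

section Resultant

variable {R : Type} [CommRing R]

/-- The resultant of the binary forms `q 0 x² + q 1 xy + q 2 y²` and
`k 0 x³ + k 1 x²y + k 2 xy² + k 3 y³`. -/
def binaryResultant (q0 q1 q2 k0 k1 k2 k3 : R) : R :=
  k0 ^ 2 * q2 ^ 3 - k0 * k1 * (q2 ^ 2 * q1) + k0 * k2 * (q2 * (q1 ^ 2 - 2 * (q0 * q2))) +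
    k0 * k3 * (3 * (q0 * q1 * q2) - q1 ^ 3) + k1 ^ 2 * (q0 * q2 ^ 2) - k1 * k2 * (q0 * q1 * q2) +
    k1 * k3 * (q0 * (q1 ^ 2 - 2 * (q0 * q2))) + k2 ^ 2 * (q0 ^ 2 * q2) - k2 * k3 * (q0 ^ 2 * q1) +
    k3 ^ 2 * q0 ^ 3

/-- The product of the values of the cubic form at the two roots `(b₁, -a₁)` and `(b₂, -a₂)` of the
quadratic form. -/
theorem binaryResultant_of_mul (a₁ b₁ a₂ b₂ k0 k1 k2 k3 : R) :
    binaryResultant (a₁ * a₂) (a₁ * b₂ + a₂ * b₁) (b₁ * b₂) k0 k1 k2 k3 =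
      (k0 * b₁ ^ 3 - k1 * b₁ ^ 2 * a₁ + k2 * b₁ * a₁ ^ 2 - k3 * a₁ ^ 3) *
      (k0 * b₂ ^ 3 - k1 * b₂ ^ 2 * a₂ + k2 * b₂ * a₂ ^ 2 - k3 * a₂ ^ 3) := by
  unfold binaryResultant
  ring

/-- Adding `l * y` times the quadratic form to the cubic does not change the values of the cubic at
the roots. -/
theorem binaryResultant_add_mul (q0 q1 q2 k0 k1 k2 k3 l : R) :
    binaryResultant q0 q1 q2 k0 (k1 + l * q0) (k2 + l * q1) (k3 + l * q2) =
      binaryResultant q0 q1 q2 k0 k1 k2 k3 := by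
  unfold binaryResultant
  ring

theorem binaryResultant_smul (a b q0 q1 q2 k0 k1 k2 k3 : R) :
    binaryResultant (a * q0) (a * q1) (a * q2) (b * k0) (b * k1) (b * k2) (b * k3) =
      a ^ 3 * b ^ 2 * binaryResultant q0 q1 q2 k0 k1 k2 k3 := by
  unfold binaryResultant
  ring

/-- The behaviour of the resultant under the substitution `(x, y) ↦ (-a y, c x - b y)`. -/
theorem binaryResultant_comp (a b c q0 q1 q2 k0 k1 k2 k3 : R) :
    binaryResultant (c ^ 2 * q2) (-(a * c * q1) - 2 * b * c * q2)
      (a ^ 2 * q0 + a * b * q1 + b ^ 2 * q2)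
      (c ^ 3 * k3) (-(a * c ^ 2 * k2) - 3 * b * c ^ 2 * k3)
      (a ^ 2 * c * k1 + 2 * a * b * c * k2 + 3 * b ^ 2 * c * k3)
      (-(a ^ 3 * k0) - a ^ 2 * b * k1 - a * b ^ 2 * k2 - b ^ 3 * k3) =
      (a * c) ^ 6 * binaryResultant q0 q1 q2 k0 k1 k2 k3 := by
  unfold binaryResultant
  ring

/-- A quadratic form of discriminant zero has the double root `(-q1, 2 * q0)`, and both factors of
the resultant become the value of the cubic there. This is where the squares on the discriminant
curve come from. -/
theorem binaryResultant_of_sq {F : Type} [Field F] [CharZero F] {q0 q1 q2 : F} (k0 k1 k2 k3 : F)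
    (h0 : q0 ≠ 0) (h : q1 ^ 2 = 4 * q0 * q2) :
    64 * q0 ^ 3 * binaryResultant q0 q1 q2 k0 k1 k2 k3 =
      (8 * k3 * q0 ^ 3 - 4 * k2 * q0 ^ 2 * q1 + 2 * k1 * q0 * q1 ^ 2 - k0 * q1 ^ 3) ^ 2 := by
  obtain rfl : q2 = q1 ^ 2 / (4 * q0) := by
    rw [eq_div_iff (by simpa using h0), h]
    ring
  unfold binaryResultant
  field_simp
  ring

theorem binaryResultant_swap (q0 q1 q2 k0 k1 k2 k3 : R) :
    binaryResultant q2 q1 q0 k3 k2 k1 k0 = binaryResultant q0 q1 q2 k0 k1 k2 k3 := by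
  unfold binaryResultant
  ring

theorem binaryResultant_eq_zero {F : Type} [Field F] {q0 q1 q2 k0 k1 k2 k3 x y : F}
    (hxy : x ≠ 0 ∨ y ≠ 0) (hq : q0 * x ^ 2 + q1 * x * y + q2 * y ^ 2 = 0)
    (hk : k0 * x ^ 3 + k1 * x ^ 2 * y + k2 * x * y ^ 2 + k3 * y ^ 3 = 0) :
    binaryResultant q0 q1 q2 k0 k1 k2 k3 = 0 := by
  have key {q0 q1 q2 k0 k1 k2 k3 x y : F} (hy : y ≠ 0)
      (hq : q0 * x ^ 2 + q1 * x * y + q2 * y ^ 2 = 0)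
      (hk : k0 * x ^ 3 + k1 * x ^ 2 * y + k2 * x * y ^ 2 + k3 * y ^ 3 = 0) :
      binaryResultant q0 q1 q2 k0 k1 k2 k3 = 0 := by
    obtain ⟨r, rfl⟩ : ∃ r, x = r * y := ⟨x / y, by field_simp⟩
    have h1 : q2 = -(q0 * r ^ 2) - q1 * r := by
      have : (q0 * r ^ 2 + q1 * r + q2) * y ^ 2 = 0 := by linear_combination hq
      have := (mul_eq_zero.mp this).resolve_right (pow_ne_zero _ hy)
      linear_combination this
    have h2 : k3 = -(k0 * r ^ 3) - k1 * r ^ 2 - k2 * r := by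
      have : (k0 * r ^ 3 + k1 * r ^ 2 + k2 * r + k3) * y ^ 3 = 0 := by linear_combination hk
      have := (mul_eq_zero.mp this).resolve_right (pow_ne_zero _ hy)
      linear_combination this
    rw [h1, h2]
    unfold binaryResultant
    ring
  rcases hxy with hx | hy
  · rw [← binaryResultant_swap]
    exact key (x := y) hx (by linear_combination hq) (by linear_combination hk)
  · exact key hy hq hk

theorem exists_root_of_binaryResultant_eq_zero {q0 q1 q2 k0 k1 k2 k3 : ℂ}
    (h : binaryResultant q0 q1 q2 k0 k1 k2 k3 = 0) :
    ∃ x y : ℂ, (x ≠ 0 ∨ y ≠ 0) ∧ q0 * x ^ 2 + q1 * x * y + q2 * y ^ 2 = 0 ∧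
      k0 * x ^ 3 + k1 * x ^ 2 * y + k2 * x * y ^ 2 + k3 * y ^ 3 = 0 := by
  have key {a₁ b₁ a₂ b₂ : ℂ} (h₁ : a₁ ≠ 0 ∨ b₁ ≠ 0) (h₂ : a₂ ≠ 0 ∨ b₂ ≠ 0)
      (h0 : q0 = a₁ * a₂) (h1 : q1 = a₁ * b₂ + a₂ * b₁) (h2 : q2 = b₁ * b₂) :
      ∃ x y : ℂ, (x ≠ 0 ∨ y ≠ 0) ∧ q0 * x ^ 2 + q1 * x * y + q2 * y ^ 2 = 0 ∧
        k0 * x ^ 3 + k1 * x ^ 2 * y + k2 * x * y ^ 2 + k3 * y ^ 3 = 0 := by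
    rw [h0, h1, h2, binaryResultant_of_mul, mul_eq_zero] at h
    subst h0 h1 h2
    rcases h with h | h
    · refine ⟨b₁, -a₁, ?_, by ring, by linear_combination h⟩
      simpa [or_comm] using h₁
    · refine ⟨b₂, -a₂, ?_, by ring, by linear_combination h⟩
      simpa [or_comm] using h₂
  by_cases hq0 : q0 = 0
  · by_cases hq : q1 = 0 ∧ q2 = 0
    · obtain ⟨rfl, rfl⟩ := hq
      by_cases hk0 : k0 = 0
      · exact ⟨1, 0, by simp, by simp [hq0], by simp [hk0]⟩
      · obtain ⟨r, hr⟩ := IsAlgClosed.exists_root (Polynomial.C k0 * Polynomial.X ^ 3 +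
          Polynomial.C k1 * Polynomial.X ^ 2 + Polynomial.C k2 * Polynomial.X + Polynomial.C k3)
          (by rw [Polynomial.degree_cubic hk0]; decide)
        refine ⟨r, 1, by simp, by simp [hq0], ?_⟩
        simpa using hr
    · refine key (a₁ := 0) (b₁ := 1) (a₂ := q1) (b₂ := q2) (by simp) ?_ (by simp [hq0]) (by ring)
        (by ring)
      by_contra! h'
      exact hq h'
  · obtain ⟨d, hd⟩ := IsAlgClosed.exists_pow_nat_eq (q1 ^ 2 - 4 * q0 * q2) two_pos
    refine key (a₁ := 2 * q0) (b₁ := q1 - d) (a₂ := 1 / 2) (b₂ := (q1 + d) / (4 * q0))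
      (by simp [hq0]) (by simp) (by ring) (by field_simp; ring) ?_
    field_simp
    linear_combination hd

/-- The value at `x` and `y` of the bilinear form with matrix `C`. -/
def bilin (C : Fin 3 → Fin 3 → R) (x y : Fin 3 → R) : R := ∑ j, ∑ l, C j l * x j * y l

/-- The resultant of the binary forms `t · c (t × u)` and `u · c (t × u)` in `u = (u₀, u₁, 0)`,
where `c` is a triple of quadratic forms with matrices `C k`. -/
def lineResultant (t : Fin 3 → R) (C : Fin 3 → Fin 3 → Fin 3 → R) : R :=
  binaryResultant
    (∑ k, t k * bilin (C k) ![0, t 2, -t 1] ![0, t 2, -t 1])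
    (2 * ∑ k, t k * bilin (C k) ![0, t 2, -t 1] ![-t 2, 0, t 0])
    (∑ k, t k * bilin (C k) ![-t 2, 0, t 0] ![-t 2, 0, t 0])
    (bilin (C 0) ![0, t 2, -t 1] ![0, t 2, -t 1])
    (2 * bilin (C 0) ![0, t 2, -t 1] ![-t 2, 0, t 0] +
      bilin (C 1) ![0, t 2, -t 1] ![0, t 2, -t 1])
    (bilin (C 0) ![-t 2, 0, t 0] ![-t 2, 0, t 0] +
      2 * bilin (C 1) ![0, t 2, -t 1] ![-t 2, 0, t 0])
    (bilin (C 1) ![-t 2, 0, t 0] ![-t 2, 0, t 0])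

theorem map_bilin {S : Type} [CommRing S] (φ : R →+* S) (C : Fin 3 → Fin 3 → R)
    (x y : Fin 3 → R) :
    φ (bilin C x y) = bilin (fun j l ↦ φ (C j l)) (φ ∘ x) (φ ∘ y) := by
  simp [bilin]

theorem map_lineResultant {S : Type} [CommRing S] (φ : R →+* S) (t : Fin 3 → R)
    (C : Fin 3 → Fin 3 → Fin 3 → R) :
    φ (lineResultant t C) = lineResultant (φ ∘ t) fun k j l ↦ φ (C k j l) := by
  have h1 : φ ∘ ![0, t 2, -t 1] = ![0, (φ ∘ t) 2, -(φ ∘ t) 1] := by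
    funext i
    fin_cases i <;> simp
  have h2 : φ ∘ ![-t 2, 0, t 0] = ![-(φ ∘ t) 2, 0, (φ ∘ t) 0] := by
    funext i
    fin_cases i <;> simp
  simp only [lineResultant, binaryResultant, map_add, map_sub, map_mul, map_pow, map_sum,
    map_ofNat, map_bilin, h1, h2, Function.comp_apply]

/-- Cyclic permutation of coordinates. -/
def rot {α : Type} (x : Fin 3 → α) : Fin 3 → α := ![x 1, x 2, x 0]

/-- The auxiliary vector `u` matters only modulo `t`. Normalizing its coordinate 0 instead of its
coordinate 2 to zero is the substitution of `binaryResultant_comp` and changes the cubic by a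
multiple of the quadratic form. The comparison shows that the extraneous factor of `lineResultant`
is a sixth power of `t 2`. -/
theorem lineResultant_rot [IsDomain R] (t : Fin 3 → R) (C : Fin 3 → Fin 3 → Fin 3 → R)
    (hC : ∀ k j l, C k j l = C k l j) (h2 : t 2 ≠ 0) :
    t 2 ^ 6 * lineResultant (rot t) (rot fun k ↦ rot fun j ↦ rot (C k j)) =
      t 0 ^ 6 * lineResultant t C := by
  have h := binaryResultant_comp (t 0) (t 1) (t 2)
    (∑ k, t k * bilin (C k) ![0, t 2, -t 1] ![0, t 2, -t 1])
    (2 * ∑ k, t k * bilin (C k) ![0, t 2, -t 1] ![-t 2, 0, t 0])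
    (∑ k, t k * bilin (C k) ![-t 2, 0, t 0] ![-t 2, 0, t 0])
    (bilin (C 0) ![0, t 2, -t 1] ![0, t 2, -t 1])
    (2 * bilin (C 0) ![0, t 2, -t 1] ![-t 2, 0, t 0] +
      bilin (C 1) ![0, t 2, -t 1] ![0, t 2, -t 1])
    (bilin (C 0) ![-t 2, 0, t 0] ![-t 2, 0, t 0] +
      2 * bilin (C 1) ![0, t 2, -t 1] ![-t 2, 0, t 0])
    (bilin (C 1) ![-t 2, 0, t 0] ![-t 2, 0, t 0])
  rw [← binaryResultant_add_mul _ _ _ _ _ _ _ 1] at h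
  refine mul_left_cancel₀ (pow_ne_zero 6 h2) ?_
  rw [← lineResultant] at h
  have h' : t 2 ^ 6 * (t 0 ^ 6 * lineResultant t C) =
    (t 0 * t 2) ^ 6 * lineResultant t C := by ring
  rw [h', ← h]
  have h'' (r : R) : t 2 ^ 6 * (t 2 ^ 6 * r) = (t 2 ^ 2) ^ 3 * (t 2 ^ 3) ^ 2 * r := by ring
  rw [h'', lineResultant, ← binaryResultant_smul]
  have e0 (k) := hC k 1 0
  have e1 (k) := hC k 2 0
  have e2 (k) := hC k 2 1
  simp only [bilin, Fin.sum_univ_three, rot, Matrix.cons_val, e0, e1, e2]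
  congr 1 <;> ring

theorem bilin_cross {C : Fin 3 → Fin 3 → R} (hC : ∀ j l, C j l = C l j) (t : Fin 3 → R) (u v : R) :
    bilin C ![-(t 2 * v), t 2 * u, t 0 * v - t 1 * u] ![-(t 2 * v), t 2 * u, t 0 * v - t 1 * u] =
      bilin C ![0, t 2, -t 1] ![0, t 2, -t 1] * u ^ 2 +
      2 * bilin C ![0, t 2, -t 1] ![-t 2, 0, t 0] * u * v +
      bilin C ![-t 2, 0, t 0] ![-t 2, 0, t 0] * v ^ 2 := by
  simp only [bilin, Fin.sum_univ_three, Matrix.cons_val, hC 1 0, hC 2 0, hC 2 1]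
  ring

/-- If the fixed point `x` lies on the line `t`, write `x = t × u`. Then `c(x)`, being proportional
to `x`, is orthogonal to both `t` and `u`, so the two binary forms have the common root `u`. -/
theorem lineResultant_eq_zero {F : Type} [Field F] {t : Fin 3 → F} {C : Fin 3 → Fin 3 → Fin 3 → F}
    (hC : ∀ k j l, C k j l = C k l j) (h2 : t 2 ≠ 0) {x : Fin 3 → F} (hx : x ≠ 0)
    (htx : ∑ k, t k * x k = 0) {β : F} (hβ : ∀ k, bilin (C k) x x = β * x k) :
    lineResultant t C = 0 := by
  set u := x 1 / t 2 with hu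
  set v := -x 0 / t 2 with hv
  have hx0 : x 0 = -(t 2 * v) := by rw [hv]; field_simp
  have hx1 : x 1 = t 2 * u := by rw [hu]; field_simp
  have hx2 : x 2 = t 0 * v - t 1 * u := by
    refine mul_left_cancel₀ h2 ?_
    rw [Fin.sum_univ_three, hx0, hx1] at htx
    linear_combination htx
  have hxe : x = ![-(t 2 * v), t 2 * u, t 0 * v - t 1 * u] := by
    funext i
    fin_cases i
    exacts [hx0, hx1, hx2]
  have hb (k) := bilin_cross (hC k) t u v
  simp only [← hxe, hβ] at hb
  rw [lineResultant]
  refine binaryResultant_eq_zero (x := u) (y := v) ?_ ?_ ?_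
  · by_contra! h
    apply hx
    rw [hxe, h.1, h.2]
    funext i
    fin_cases i <;> simp
  · simp only [Fin.sum_univ_three] at htx ⊢
    linear_combination β * htx - t 0 * hb 0 - t 1 * hb 1 - t 2 * hb 2
  · linear_combination β * u * hx0 + β * v * hx1 - u * hb 0 - v * hb 1

/-- At a common root `u`, the vector `c(t × u)` is orthogonal to the independent vectors `t` and
`u`, hence proportional to `t × u`. -/
theorem exists_of_lineResultant_eq_zero {t : Fin 3 → ℂ} {C : Fin 3 → Fin 3 → Fin 3 → ℂ}
    (hC : ∀ k j l, C k j l = C k l j) (h2 : t 2 ≠ 0) (h : lineResultant t C = 0) :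
    ∃ x : Fin 3 → ℂ, x ≠ 0 ∧ ∑ k, t k * x k = 0 ∧ ∃ β, ∀ k, bilin (C k) x x = β * x k := by
  obtain ⟨u, v, huv, hq, hk⟩ := exists_root_of_binaryResultant_eq_zero h
  set x : Fin 3 → ℂ := ![-(t 2 * v), t 2 * u, t 0 * v - t 1 * u] with hx
  have hb (k) := bilin_cross (hC k) t u v
  rw [← hx] at hb
  have h1 : u * bilin (C 0) x x + v * bilin (C 1) x x = 0 := by
    rw [hb, hb]
    linear_combination hk
  have h3 : ∑ k, t k * bilin (C k) x x = 0 := by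
    simp only [Fin.sum_univ_three, hb] at hq ⊢
    linear_combination hq
  rw [Fin.sum_univ_three] at h3
  have hx0 : x 0 = -(t 2 * v) := rfl
  have hx1 : x 1 = t 2 * u := rfl
  have hx2 : x 2 = t 0 * v - t 1 * u := rfl
  refine ⟨x, fun h ↦ ?_, by rw [Fin.sum_univ_three, hx0, hx1, hx2]; ring, ?_⟩
  · rw [h] at hx0 hx1
    simp [h2] at hx0 hx1
    exact huv.elim (· hx1) (· hx0)
  -- The first two components of `c(x)` are orthogonal to `(u, v)`, hence a multiple of `(-v, u)`.
  · obtain ⟨μ, h4, h5⟩ : ∃ μ, bilin (C 0) x x = -(μ * v) ∧ bilin (C 1) x x = μ * u := by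
      by_cases hv : v = 0
      · have hu : u ≠ 0 := huv.resolve_right (· hv)
        refine ⟨bilin (C 1) x x / u, ?_, by field_simp⟩
        rw [hv] at h1 ⊢
        simpa [hu] using h1
      · refine ⟨-bilin (C 0) x x / v, by field_simp, ?_⟩
        field_simp
        linear_combination h1
    refine ⟨μ / t 2, fun k ↦ ?_⟩
    rw [div_mul_eq_mul_div, eq_div_iff h2]
    fin_cases k
    · change bilin (C 0) x x * t 2 = μ * x 0
      rw [h4, hx0]
      ring
    · change bilin (C 1) x x * t 2 = μ * x 1
      rw [h5, hx1]
      ring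
    · change bilin (C 2) x x * t 2 = μ * x 2
      rw [hx2]
      rw [h4, h5] at h3
      linear_combination h3

/-- The quadratic form has coefficients of degree 3 in `t` and enters cubically; the cubic has
coefficients of degree 2 and enters quadratically. The total `9 + 4 = 13` is exactly `6 + 7`, which
leaves only a constant in the factorization into `X 2 ^ 6` and seven linear forms. -/
theorem isHomogeneous_lineResultant (C : Fin 3 → Fin 3 → Fin 3 → ℂ) :
    (lineResultant X fun k j l ↦ MvPolynomial.C (C k j l)).IsHomogeneous 13 := by
  have hX (i : Fin 3) : (X i : MvPolynomial (Fin 3) ℂ).IsHomogeneous 1 := isHomogeneous_X _ _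
  have hp (i) : ((![0, X 2, -X 1] : Fin 3 → MvPolynomial (Fin 3) ℂ) i).IsHomogeneous 1 := by
    fin_cases i
    exacts [isHomogeneous_zero _ _ _, hX _, (hX _).neg]
  have hs (i) : ((![-X 2, 0, X 0] : Fin 3 → MvPolynomial (Fin 3) ℂ) i).IsHomogeneous 1 := by
    fin_cases i
    exacts [(hX _).neg, isHomogeneous_zero _ _ _, hX _]
  have hb {x y : Fin 3 → MvPolynomial (Fin 3) ℂ} (hx : ∀ i, (x i).IsHomogeneous 1)
      (hy : ∀ i, (y i).IsHomogeneous 1) (k) :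
      (bilin (fun j l ↦ MvPolynomial.C (C k j l)) x y).IsHomogeneous 2 := by
    refine IsHomogeneous.sum _ _ _ fun j _ ↦ IsHomogeneous.sum _ _ _ fun l _ ↦ ?_
    exact ((isHomogeneous_C _ _).mul (hx j)).mul (hy l)
  have hq {x y : Fin 3 → MvPolynomial (Fin 3) ℂ} (hx : ∀ i, (x i).IsHomogeneous 1)
      (hy : ∀ i, (y i).IsHomogeneous 1) :
      (∑ k, X k * bilin (fun j l ↦ MvPolynomial.C (C k j l)) x y).IsHomogeneous 3 :=
    IsHomogeneous.sum _ _ _ fun k _ ↦ (hX k).mul (hb hx hy k)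
  have h2 {p : MvPolynomial (Fin 3) ℂ} {m : ℕ} (h : p.IsHomogeneous m) :
      (2 * p).IsHomogeneous m := by
    have := h.C_mul 2
    rwa [map_ofNat] at this
  have h3 {p : MvPolynomial (Fin 3) ℂ} {m : ℕ} (h : p.IsHomogeneous m) :
      (3 * p).IsHomogeneous m := by
    have := h.C_mul 3
    rwa [map_ofNat] at this
  have key {q0 q1 q2 k0 k1 k2 k3 : MvPolynomial (Fin 3) ℂ} (hq0 : q0.IsHomogeneous 3)
      (hq1 : q1.IsHomogeneous 3) (hq2 : q2.IsHomogeneous 3) (hk0 : k0.IsHomogeneous 2)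
      (hk1 : k1.IsHomogeneous 2) (hk2 : k2.IsHomogeneous 2) (hk3 : k3.IsHomogeneous 2) :
      (binaryResultant q0 q1 q2 k0 k1 k2 k3).IsHomogeneous 13 :=
    (((((((((((hk0.pow 2).mul (hq2.pow 3)).sub ((hk0.mul hk1).mul ((hq2.pow 2).mul hq1))).add
      ((hk0.mul hk2).mul (hq2.mul ((hq1.pow 2).sub (h2 (hq0.mul hq2)))))).add
      ((hk0.mul hk3).mul ((h3 ((hq0.mul hq1).mul hq2)).sub (hq1.pow 3)))).add
      ((hk1.pow 2).mul (hq0.mul (hq2.pow 2)))).sub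
      ((hk1.mul hk2).mul ((hq0.mul hq1).mul hq2))).add
      ((hk1.mul hk3).mul (hq0.mul ((hq1.pow 2).sub (h2 (hq0.mul hq2)))))).add
      ((hk2.pow 2).mul ((hq0.pow 2).mul hq2))).sub
      ((hk2.mul hk3).mul ((hq0.pow 2).mul hq1))).add
      ((hk3.pow 2).mul (hq0.pow 3)))
  exact key (hq hp hp) (h2 (hq hp hs)) (hq hs hs) (hb hp hp 0)
    ((h2 (hb hp hs 0)).add (hb hp hp 1)) ((hb hs hs 0).add (h2 (hb hp hs 1))) (hb hs hs 1)

/-- The linear form with coefficients `x`. -/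
def linForm (x : Fin 3 → ℂ) : MvPolynomial (Fin 3) ℂ := ∑ k, MvPolynomial.C (x k) * X k

theorem aeval_linForm {S : Type} [CommRing S] [Algebra ℂ S] (x : Fin 3 → ℂ) (t : Fin 3 → S) :
    aeval t (linForm x) = ∑ k, algebraMap ℂ S (x k) * t k := by
  simp [linForm]

theorem eval_linForm (x t : Fin 3 → ℂ) : eval t (linForm x) = ∑ k, x k * t k := by
  simp [linForm]

theorem isHomogeneous_linForm (x : Fin 3 → ℂ) : (linForm x).IsHomogeneous 1 :=
  IsHomogeneous.sum _ _ _ fun _ _ ↦ isHomogeneous_C_mul_X _ _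

theorem coeff_linForm (x : Fin 3 → ℂ) (k : Fin 3) :
    coeff (Finsupp.single k 1) (linForm x) = x k := by
  simp [linForm, coeff_sum, coeff_C_mul, coeff_X, Finsupp.single_left_inj]

theorem linForm_ne_zero {x : Fin 3 → ℂ} (hx : x ≠ 0) : linForm x ≠ 0 := by
  obtain ⟨k, hk⟩ := Function.ne_iff.mp hx
  intro h
  rw [← coeff_linForm x k, h] at hk
  simp at hk

theorem prime_linForm {x : Fin 3 → ℂ} (hx : x ≠ 0) : Prime (linForm x) := by
  refine UniqueFactorizationMonoid.irreducible_iff_prime.mp ?_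
  refine irreducible_of_totalDegree_eq_one
    ((isHomogeneous_linForm x).totalDegree (linForm_ne_zero hx)) fun c hc ↦ ?_
  obtain ⟨k, hk⟩ := Function.ne_iff.mp hx
  have := hc (Finsupp.single k 1)
  rw [coeff_linForm] at this
  exact isUnit_iff_ne_zero.mpr fun h ↦ hk (by simpa [h] using this)

theorem eq_smul_of_linForm_dvd {x y : Fin 3 → ℂ} (h : linForm x ∣ linForm y) (hy : y ≠ 0) :
    ∃ c : ℂ, y = c • x := by
  obtain ⟨p, hp⟩ := h
  have hy' := linForm_ne_zero hy
  rw [hp] at hy'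
  have h1 := (isHomogeneous_linForm y).totalDegree (linForm_ne_zero hy)
  rw [hp, totalDegree_mul_of_isDomain (left_ne_zero_of_mul hy') (right_ne_zero_of_mul hy'),
    (isHomogeneous_linForm x).totalDegree (left_ne_zero_of_mul hy')] at h1
  have h2 := (totalDegree_eq_zero_iff_eq_C (p := p)).mp (by omega)
  refine ⟨coeff 0 p, funext fun k ↦ ?_⟩
  rw [Pi.smul_apply, smul_eq_mul, ← coeff_linForm y, hp, h2, mul_comm, coeff_C_mul, coeff_linForm]
  simp

/-- The Nullstellensatz for the prime ideal generated by `L`. -/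
theorem dvd_of_forall_eval_eq_zero {σ : Type} [Finite σ] {L p : MvPolynomial σ ℂ} (hL : Prime L)
    (h : ∀ t, eval t L = 0 → eval t p = 0) : L ∣ p := by
  have hP : (Ideal.span {L}).IsPrime := (Ideal.span_singleton_prime hL.ne_zero).mpr hL
  rw [← Ideal.mem_span_singleton, ← MvPolynomial.IsPrime.vanishingIdeal_zeroLocus (K := ℂ)
    (Ideal.span {L}), mem_vanishingIdeal_iff]
  exact fun t ht ↦ h t (ht L (Ideal.mem_span_singleton_self L))

theorem prod_dvd_of_prime {ι A : Type} [CommRing A] [IsDomain A] [UniqueFactorizationMonoid A]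
    (s : Finset ι) {L : ι → A} (hL : ∀ i ∈ s, Prime (L i))
    (hLL : ∀ i ∈ s, ∀ j ∈ s, i ≠ j → ¬ L i ∣ L j) {p : A} (h : ∀ i ∈ s, L i ∣ p) :
    ∏ i ∈ s, L i ∣ p := by
  let := UniqueFactorizationMonoid.toGCDMonoid A
  refine Finset.prod_dvd_of_isRelPrime (fun i hi j hj hij ↦ ?_) h
  exact (hL i hi).irreducible.isRelPrime_iff_not_dvd.mpr (hLL i hi j hj hij)

/-- The resultant on the line `t` of a quadratic self-map of the plane with the seven fixed
points `x i` is the product of the equations of the fixed points. -/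
theorem exists_lineResultant_eq {ι : Type} [Fintype ι] (hι : Fintype.card ι = 7)
    {C : Fin 3 → Fin 3 → Fin 3 → ℂ} (hC : ∀ k j l, C k j l = C k l j)
    (x : ι → Fin 3 → ℂ) (hx : ∀ i, x i ≠ 0) (hxx : ∀ i j, i ≠ j → ∀ c : ℂ, x j ≠ c • x i)
    (β : ι → ℂ) (hβ : ∀ i k, bilin (C k) (x i) (x i) = β i * x i k)
    (hall : ∀ y : Fin 3 → ℂ, y ≠ 0 → ∀ β : ℂ, (∀ k, bilin (C k) y y = β * y k) →
      ∃ i, ∃ c : ℂ, y = c • x i) :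
    ∃ c : ℂ, c ≠ 0 ∧ lineResultant X (fun k j l ↦ MvPolynomial.C (C k j l)) =
      X 2 ^ 6 * (∏ i, linForm (x i)) * MvPolynomial.C c := by
  set D : Fin 3 → Fin 3 → Fin 3 → MvPolynomial (Fin 3) ℂ :=
    fun k j l ↦ MvPolynomial.C (C k j l) with hD
  set P := lineResultant X D with hP
  have hDsymm (k j l) : D k j l = D k l j := by rw [hD]; simp only [hC k j l]
  have hev (t : Fin 3 → ℂ) : eval t P = lineResultant t C := by
    rw [hP, map_lineResultant]
    simp only [hD, eval_C]
    congr 1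
    funext k
    simp
  have hrot := lineResultant_rot X D hDsymm (X_ne_zero 2)
  set P' := lineResultant (rot X) (rot fun k ↦ rot fun j ↦ rot (D k j)) with hP'
  have hrotC (t : Fin 3 → ℂ) : eval t P' =
      lineResultant (rot t) (rot fun k ↦ rot fun j ↦ rot (C k j)) := by
    rw [hP', map_lineResultant]
    congr 1
    · funext k
      fin_cases k <;> simp [rot]
    · funext k j l
      fin_cases k <;> fin_cases j <;> fin_cases l <;> simp [rot, hD]
  have hprimeX (i : Fin 3) : Prime (X i : MvPolynomial (Fin 3) ℂ)   := by
    have : (X i : MvPolynomial (Fin 3) ℂ) = linForm (Pi.single i 1) := by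
      simp [linForm, Pi.single_apply]
    rw [this]
    exact prime_linForm (by simp)
  -- By the rotation identity `X 2 ^ 6` divides `X 0 ^ 6 * P`, and the two powers are coprime.
  obtain ⟨ρ, hρ⟩ : X 2 ^ 6 ∣ P := by
    let := UniqueFactorizationMonoid.toGCDMonoid (MvPolynomial (Fin 3) ℂ)
    have h1 : IsRelPrime (X 2 ^ 6 : MvPolynomial (Fin 3) ℂ) (X 0 ^ 6) := by
      refine IsRelPrime.pow ((hprimeX 2).irreducible.isRelPrime_iff_not_dvd.mpr ?_)
      rw [X_dvd_X]
      simp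
    exact h1.dvd_of_dvd_mul_left ⟨_, hrot.symm⟩
  have hρ' : P' = X 0 ^ 6 * ρ := by
    refine mul_left_cancel₀ (pow_ne_zero 6 (X_ne_zero (R := ℂ) (2 : Fin 3))) ?_
    rw [hrot, ← hP, hρ]
    ring
  -- The vanishing criterion is available where `t 2 ≠ 0`, and for the rotated resultant where `t 0
  -- ≠ 0`; so the linear form divides `X 2 * ρ` and `X 0 * ρ`. Being prime, it divides `ρ` unless it
  -- divides both coordinates, which would force `x i = 0`.
  have hdvd (i) : linForm (x i) ∣ ρ := by
    have h2 : linForm (x i) ∣ X 2 * ρ := by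
      refine dvd_of_forall_eval_eq_zero (prime_linForm (hx i)) fun t ht ↦ ?_
      rw [eval_linForm] at ht
      by_cases h2 : t 2 = 0
      · simp [h2]
      · have := lineResultant_eq_zero hC h2 (hx i) (by simpa only [mul_comm] using ht) (hβ i)
        rw [← hev, hρ] at this
        simpa [h2] using this
    have h0 : linForm (x i) ∣ X 0 * ρ := by
      refine dvd_of_forall_eval_eq_zero (prime_linForm (hx i)) fun t ht ↦ ?_
      rw [eval_linForm, Fin.sum_univ_three] at ht
      by_cases h0 : t 0 = 0
      · simp [h0]
      · have hrx : rot (x i) ≠ 0 := fun h ↦ hx i (by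
          funext k
          have h0 := congrFun h 2
          have h1 := congrFun h 0
          have h2 := congrFun h 1
          fin_cases k
          exacts [h0, h1, h2])
        have := lineResultant_eq_zero (t := rot t)
          (C := rot fun k ↦ rot fun j ↦ rot (C k j)) (fun k j l ↦ by
            fin_cases k <;> fin_cases j <;> fin_cases l <;> simp [rot, hC _ 1 0, hC _ 2 0, hC _ 2 1])
          h0 hrx (by simp [rot, Fin.sum_univ_three]; linear_combination ht) (β := β i) (fun k ↦ by
            have h := hβ i
            simp only [bilin, Fin.sum_univ_three] at h ⊢
            have h0 := h 0
            have h1 := h 1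
            have h2 := h 2
            fin_cases k
            · simp [rot]; linear_combination h1
            · simp [rot]; linear_combination h2
            · simp [rot]; linear_combination h0)
        rw [← hrotC, hρ'] at this
        simpa [h0] using this
    by_contra hne
    have h2' := ((prime_linForm (hx i)).dvd_or_dvd h2).resolve_right hne
    have h0' := ((prime_linForm (hx i)).dvd_or_dvd h0).resolve_right hne
    have hz (t : Fin 3 → ℂ) (ht : ∑ k, x i k * t k = 0) : t 2 = 0 ∧ t 0 = 0 := by
      rw [← eval_linForm] at ht
      constructor
      · obtain ⟨p, hp⟩ := h2'
        rw [← eval_X (f := t) 2, hp, map_mul, ht, zero_mul]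
      · obtain ⟨p, hp⟩ := h0'
        rw [← eval_X (f := t) 0, hp, map_mul, ht, zero_mul]
    have z1 := hz ![x i 1, -x i 0, 0] (by simp [Fin.sum_univ_three]; ring)
    have z2 := hz ![x i 2, 0, -x i 0] (by simp [Fin.sum_univ_three]; ring)
    refine hx i (funext fun k ↦ ?_)
    fin_cases k
    · simpa using z2.1
    · simpa using z1.2
    · simpa using z2.2
  obtain ⟨q, hq⟩ := prod_dvd_of_prime Finset.univ (L := fun i ↦ linForm (x i))
    (fun i _ ↦ prime_linForm (hx i))
    (fun i _ j _ hij h ↦ by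
      obtain ⟨c, hc⟩ := eq_smul_of_linForm_dvd h (hx j)
      exact hxx i j hij c hc) (fun i _ ↦ hdvd i)
  have hLne : (∏ i, linForm (x i)) ≠ 0 := Finset.prod_ne_zero_iff.mpr fun i _ ↦ linForm_ne_zero (hx i)
  -- On a line missing all the `x i` and with `t 2 ≠ 0`, a vanishing resultant would produce a
  -- further fixed point.
  have hPne : P ≠ 0 := by
    intro hP0
    obtain ⟨t, ht⟩ : ∃ t : Fin 3 → ℂ, eval t (X 2 * ∏ i, linForm (x i)) ≠ 0 := by
      by_contra! h
      have : X 2 * ∏ i, linForm (x i) = 0 := MvPolynomial.funext fun t ↦ by rw [h t, map_zero]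
      exact mul_ne_zero (X_ne_zero _) hLne this
    rw [map_mul, eval_X, map_prod] at ht
    obtain ⟨y, hy, hty, β', hβ'⟩ := exists_of_lineResultant_eq_zero hC (left_ne_zero_of_mul ht)
      (by rw [← hev, hP0, map_zero])
    obtain ⟨i, c, rfl⟩ := hall y hy β' hβ'
    have hL := Finset.prod_ne_zero_iff.mp (right_ne_zero_of_mul ht) i (Finset.mem_univ i)
    rw [eval_linForm] at hL
    have hc : c ≠ 0 := by
      rintro rfl
      simp at hy
    refine mul_ne_zero hc hL ?_
    rw [← hty, Finset.mul_sum]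
    exact Finset.sum_congr rfl fun k _ ↦ by simp; ring
  have hP13 := (isHomogeneous_lineResultant C).totalDegree hPne
  have hPq : P = X 2 ^ 6 * (∏ i, linForm (x i)) * q := by rw [hρ, hq]; ring
  have hq0 : q ≠ 0 := by
    rintro rfl
    exact hPne (by rw [hPq, mul_zero])
  have hprod : (X 2 ^ 6 * ∏ i, linForm (x i)).IsHomogeneous 13 := by
    have := ((isHomogeneous_X ℂ (2 : Fin 3)).pow 6).mul
      (IsHomogeneous.prod Finset.univ (fun i ↦ linForm (x i)) (fun _ ↦ 1)
        fun i _ ↦ isHomogeneous_linForm (x i))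
    simpa [hι] using this
  have hprod0 : X 2 ^ 6 * ∏ i, linForm (x i) ≠ 0 := mul_ne_zero (pow_ne_zero _ (X_ne_zero _)) hLne
  have hdeg : P.totalDegree = 13 + q.totalDegree := by
    rw [hPq, totalDegree_mul_of_isDomain hprod0 hq0, hprod.totalDegree hprod0]
  have hqC := (totalDegree_eq_zero_iff_eq_C (p := q)).mp (by
    have : P.totalDegree = 13 := hP13
    omega)
  exact ⟨coeff 0 q, fun h ↦ hq0 (by rw [hqC, h, map_zero]), by rw [← hqC]; exact hPq⟩

end Resultant

/-! ### Singular symmetric matrices, Gram determinants and the singular members of the net. -/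

section Matrices

open Matrix

variable {n : Type} [Fintype n]

/-- The adjugate of a singular symmetric matrix with kernel vector `v` is a multiple of
`v vᵀ`. -/
theorem exists_adjugate_eq [DecidableEq n] {F : Type} [Field F] {A : Matrix n n F} (hA : A.IsSymm) {v : n → F}
    (hv : v ≠ 0) (hAv : A *ᵥ v = 0) (hadj : A.adjugate ≠ 0) :
    ∃ c : F, c ≠ 0 ∧ ∀ s t, A.adjugate s t = c * v s * v t := by
  have hdet : A.det = 0 := exists_mulVec_eq_zero_iff.mp ⟨v, hv, hAv⟩
  obtain ⟨y, x, hyx⟩ : ∃ y x, A.adjugate y x ≠ 0 := by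
    by_contra! h
    exact hadj (Matrix.ext h)
  -- Adding a unit vector to row `x` gives a matrix whose determinant is the nonzero cofactor. On
  -- the kernel of `A` this matrix only sees the coordinate `y`, so the kernel is one-dimensional
  -- and `v y ≠ 0`.
  let B := A.updateRow x (A x + Pi.single y 1)
  have hB : B.det ≠ 0 := by
    rw [det_updateRow_add, updateRow_eq_self, hdet, zero_add, ← adjugate_apply]
    exact hyx
  have hBu (u : n → F) (hu : A *ᵥ u = 0) : B *ᵥ u = Pi.single x (u y) := by
    funext i
    have hi := congrFun hu i
    rw [mulVec] at hi ⊢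
    by_cases h : i = x
    · subst h
      simp only [B, updateRow_self, add_dotProduct, hi]
      simp
    · simp only [B, updateRow_ne h, hi]
      simp [h]
  have hcol (t) : A *ᵥ (fun s ↦ A.adjugate s t) = 0 := by
    have h := mul_adjugate A
    rw [hdet, zero_smul] at h
    funext i
    exact congrFun (congrFun h i) t
  have key (s t) : v y * A.adjugate s t = A.adjugate y t * v s := by
    have h : B *ᵥ (v y • (fun s ↦ A.adjugate s t) - A.adjugate y t • v) = 0 := by
      rw [mulVec_sub, mulVec_smul, mulVec_smul, hBu _ (hcol t), hBu _ hAv, ← Pi.single_smul,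
        ← Pi.single_smul]
      simp [mul_comm]
    have h' := eq_zero_of_mulVec_eq_zero hB h
    have := congrFun h' s
    simpa [sub_eq_zero] using this
  have hvy : v y ≠ 0 := by
    intro h
    refine hv (eq_zero_of_mulVec_eq_zero hB ?_)
    rw [hBu _ hAv, h, Pi.single_zero]
  have hsymm (s t) : A.adjugate s t = A.adjugate t s := by
    have h := adjugate_transpose A
    rw [hA.eq] at h
    exact congrFun (congrFun h t) s |>.symm ▸ rfl
  have hform (s t) : A.adjugate s t = A.adjugate y y / v y ^ 2 * v s * v t := by
    have h1 := key s t
    have h2 := key t y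
    rw [hsymm t y] at h2
    field_simp
    linear_combination v y * h1 + v s * h2
  refine ⟨A.adjugate y y / v y ^ 2, fun h ↦ hyx ?_, hform⟩
  rw [hform, h]
  ring

/-- The determinant of four vectors. -/
def det4 {R : Type} [CommRing R] (u v w k : Fin 4 → R) : R := (Matrix.of ![u, v, w, k]).det

theorem mul_mul_transpose_apply {m R : Type} [CommRing R] (S : Matrix m n R) (A : Matrix n n R)
    (i j : m) : (S * A * Sᵀ) i j = S i ⬝ᵥ A *ᵥ S j := by
  rw [Matrix.mul_assoc, Matrix.mul_apply]
  rfl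

theorem dotProduct_mulVec_comm {R : Type} [CommRing R] {A : Matrix n n R} (hA : A.IsSymm)
    (x y : n → R) : x ⬝ᵥ A *ᵥ y = y ⬝ᵥ A *ᵥ x := by
  rw [dotProduct_mulVec, ← mulVec_transpose, hA.eq, dotProduct_comm]

/-- The adjugate is multiplicative, so a change of basis keeps it of the form `k kᵀ / m`; all
diagonal cofactors have the class of `m` modulo squares, in every basis. -/
theorem mul_adjugate_mul_mul_transpose_apply [DecidableEq n] {R : Type} [CommRing R]
    {A : Matrix n n R} {m : R} {k : n → R} (hk : ∀ s t, m * A.adjugate s t = k s * k t)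
    (S : Matrix n n R) (j : n) :
    m * (S * A * Sᵀ).adjugate j j = (∑ s, k s * S.adjugate s j) ^ 2 := by
  rw [adjugate_mul_distrib, adjugate_mul_distrib, mul_apply, pow_two, Finset.sum_mul_sum,
    Finset.mul_sum]
  refine Finset.sum_congr rfl fun s _ ↦ ?_
  rw [mul_apply, Finset.mul_sum, Finset.mul_sum]
  refine Finset.sum_congr rfl fun t _ ↦ ?_
  rw [← adjugate_transpose, transpose_apply]
  linear_combination S.adjugate s j * S.adjugate t j * hk s t

/-- The last diagonal cofactor of the Gram matrix of `v, b, c, k` is the Gram determinant of `v, b,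
c`, short because `b` and `c` are isotropic. On the other hand it is a square up to `m`, by the form
of the adjugate of `A`. The bracket is `c · A σ(v)` for the projection `σ` from `b`. -/
theorem gram_det {R : Type} [CommRing R] {A : Matrix (Fin 4) (Fin 4) R} (hA : A.IsSymm)
    {m : R} {k : Fin 4 → R} (hk : ∀ s t, m * A.adjugate s t = k s * k t) (v b c : Fin 4 → R)
    (hb : b ⬝ᵥ A *ᵥ b = 0) (hc : c ⬝ᵥ A *ᵥ c = 0) :
    m * (b ⬝ᵥ A *ᵥ c * ((v ⬝ᵥ A *ᵥ v) * (b ⬝ᵥ A *ᵥ c) - 2 * (b ⬝ᵥ A *ᵥ v) * (c ⬝ᵥ A *ᵥ v))) =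
      -det4 v b c k ^ 2 := by
  set S : Matrix (Fin 4) (Fin 4) R := Matrix.of ![v, b, c, k] with hS
  have hsymm := dotProduct_mulVec_comm hA
  have hG := mul_mul_transpose_apply S A
  have h1 : (S * A * Sᵀ).adjugate 3 3 = -(b ⬝ᵥ A *ᵥ c *
      ((v ⬝ᵥ A *ᵥ v) * (b ⬝ᵥ A *ᵥ c) - 2 * (b ⬝ᵥ A *ᵥ v) * (c ⬝ᵥ A *ᵥ v))) := by
    rw [adjugate_fin_succ_eq_det_submatrix, det_fin_three]
    have e0 : (3 : Fin 4).succAbove 0 = 0 := rfl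
    have e1 : (3 : Fin 4).succAbove 1 = 1 := rfl
    have e2 : (3 : Fin 4).succAbove 2 = 2 := rfl
    have e3 : ((-1 : R)) ^ (((3 : Fin 4) : ℕ) + ((3 : Fin 4) : ℕ)) = 1 := by
      rw [← two_mul, pow_mul]
      simp
    simp only [submatrix_apply, hG, e0, e1, e2, e3]
    have s0 : S 0 = v := rfl
    have s1 : S 1 = b := rfl
    have s2 : S 2 = c := rfl
    rw [s0, s1, s2, hb, hc, hsymm v b, hsymm v c, hsymm c b]
    ring
  -- Taking `k` itself as the last row of `S` makes this sum the expansion of `det S` along that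
  -- row.
  have h2 : ∑ s, k s * S.adjugate s 3 = S.det := by
    have := congrFun (congrFun (mul_adjugate S) 3) 3
    simpa [mul_apply, hS] using this
  have h3 : m * (S * A * Sᵀ).adjugate 3 3 = S.det ^ 2 := by
    rw [mul_adjugate_mul_mul_transpose_apply hk, h2]
  have h4 : det4 v b c k = S.det := rfl
  rw [h4, ← h3, h1]
  ring

theorem derivation_prod {R S ι : Type} [CommRing R] [CommRing S] [Algebra R S] [DecidableEq ι]
    (D : Derivation R S S) (f : ι → S) (s : Finset ι) :
    D (∏ i ∈ s, f i) = ∑ i ∈ s, D (f i) * ∏ l ∈ s.erase i, f l := by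
  induction s using Finset.induction_on with
  | empty => simp
  | insert a s ha ih =>
    rw [Finset.prod_insert ha, D.leibniz, ih, Finset.sum_insert ha, Finset.erase_insert ha,
      smul_eq_mul, smul_eq_mul, Finset.mul_sum, add_comm, mul_comm]
    congr 1
    refine Finset.sum_congr rfl fun i hi ↦ ?_
    have hia : a ≠ i := fun h ↦ ha (h ▸ hi)
    rw [Finset.erase_insert_of_ne hia, Finset.prod_insert fun h ↦ ha (Finset.mem_of_mem_erase h)]
    ring

/-- Jacobi's formula. It gives the partial derivatives of the discriminant as pairings of the `Q k`
with the adjugate, through which the smoothness of the curve is used. -/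
theorem derivation_det {R S n : Type} [CommRing R] [CommRing S] [Algebra R S] [Fintype n]
    [DecidableEq n] (D : Derivation R S S) (N : Matrix n n S) :
    D N.det = ∑ i, ∑ j, D (N i j) * N.adjugate j i := by
  have h (i : n) : ∑ j, D (N i j) * N.adjugate j i = (N.updateRow i (D ∘ N i)).det := by
    have := congrFun (cramer_eq_adjugate_mulVec Nᵀ (D ∘ N i)) i
    rw [cramer_transpose_apply] at this
    rw [this, mulVec, dotProduct]
    refine Finset.sum_congr rfl fun j _ ↦ ?_
    rw [← adjugate_transpose, transpose_apply, mul_comm]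
    rfl
  simp only [h, det_apply, map_sum]
  rw [Finset.sum_comm]
  refine Finset.sum_congr rfl fun s _ ↦ ?_
  rw [← Finset.smul_sum, ← Equiv.sum_comp s, map_zsmul_unit]
  congr 1
  rw [derivation_prod]
  refine Finset.sum_congr rfl fun i _ ↦ ?_
  rw [← Finset.mul_prod_erase _ _ (Finset.mem_univ i), updateRow_self]
  congr 1
  refine Finset.prod_congr rfl fun l hl ↦ ?_
  rw [updateRow_ne fun h ↦ Finset.ne_of_mem_erase hl (s.injective h)]

variable {Q : Fin 3 → Matrix (Fin 4) (Fin 4) ℂ}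

theorem member_isSymm (hQ : IsRegularNet Q) (t : Fin 3 → ℂ) : (member Q t).IsSymm := by
  simp [Matrix.IsSymm, member, transpose_sum, (hQ.symm _).eq]

/-- The member of the net with parameter `t` over an extension ring. -/
def memberOver (Q : Fin 3 → Matrix (Fin 4) (Fin 4) ℂ) {R : Type} [CommRing R] [Algebra ℂ R]
    (t : Fin 3 → R) : Matrix (Fin 4) (Fin 4) R := ∑ k, t k • (Q k).map (algebraMap ℂ R)

theorem memberOver_isSymm (hQ : IsRegularNet Q) {R : Type} [CommRing R] [Algebra ℂ R]
    (t : Fin 3 → R) : (memberOver Q t).IsSymm := by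
  simp [Matrix.IsSymm, memberOver, transpose_sum, ← transpose_map, (hQ.symm _).eq]

theorem map_memberOver {R S : Type} [CommRing R] [Algebra ℂ R] [CommRing S] [Algebra ℂ S]
    (φ : R →ₐ[ℂ] S) (t : Fin 3 → R) :
    (memberOver Q t).map φ = memberOver Q (φ ∘ t) := by
  ext i j
  simp [memberOver, Matrix.sum_apply]

theorem memberOver_complex (t : Fin 3 → ℂ) : memberOver Q t = member Q t := by
  ext i j
  simp [memberOver, member, Matrix.sum_apply]

theorem dotProduct_memberOver {R : Type} [CommRing R] [Algebra ℂ R] (t : Fin 3 → R)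
    (x y : Fin 4 → ℂ) :
    (algebraMap ℂ R ∘ x) ⬝ᵥ memberOver Q t *ᵥ (algebraMap ℂ R ∘ y) =
      ∑ k, algebraMap ℂ R (x ⬝ᵥ Q k *ᵥ y) * t k := by
  simp only [memberOver, Matrix.sum_mulVec, dotProduct_sum, smul_mulVec, dotProduct_smul,
    smul_eq_mul]
  refine Finset.sum_congr rfl fun k _ ↦ ?_
  rw [mul_comm, RingHom.map_dotProduct]
  congr 2
  funext i
  exact (RingHom.map_mulVec (algebraMap ℂ R) (Q k) y i).symm

/-- The generic member of the net. -/
abbrev netMatrix (Q : Fin 3 → Matrix (Fin 4) (Fin 4) ℂ) :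
    Matrix (Fin 4) (Fin 4) (MvPolynomial (Fin 3) ℂ) := memberOver Q X

theorem discriminant_eq : discriminant Q = (netMatrix Q).det := rfl

theorem det_memberOver {R : Type} [CommRing R] [Algebra ℂ R] (t : Fin 3 → R) :
    (memberOver Q t).det = aeval t (discriminant Q) := by
  have h := (aeval t : MvPolynomial (Fin 3) ℂ →ₐ[ℂ] R).map_det (netMatrix Q)
  rw [discriminant_eq, h]
  congr 1
  rw [AlgHom.mapMatrix_apply, netMatrix, map_memberOver]
  congr 1
  funext k
  simp

theorem isHomogeneous_netMatrix (i j) : (netMatrix Q i j).IsHomogeneous 1 := by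
  simp only [netMatrix, memberOver, Matrix.sum_apply]
  refine IsHomogeneous.sum _ _ _ fun k _ ↦ ?_
  exact (isHomogeneous_X _ k).mul (isHomogeneous_C _ _)

theorem isHomogeneous_det {σ m : Type} [Fintype m] [DecidableEq m]
    {A : Matrix m m (MvPolynomial σ ℂ)} (hA : ∀ i j, (A i j).IsHomogeneous 1) :
    A.det.IsHomogeneous (Fintype.card m) := by
  rw [det_apply]
  refine IsHomogeneous.sum _ _ _ fun s _ ↦ ?_
  have h := IsHomogeneous.prod Finset.univ (fun i ↦ A (s i) i) (fun _ ↦ 1) fun i _ ↦ hA _ _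
  simp only [Finset.sum_const, Finset.card_univ, smul_eq_mul, mul_one] at h
  rcases Int.units_eq_one_or (Equiv.Perm.sign s) with hs | hs
  · simpa [hs] using h
  · simpa [hs] using h.neg

theorem isHomogeneous_discriminant : (discriminant Q).IsHomogeneous 4 :=
  isHomogeneous_det isHomogeneous_netMatrix

theorem isHomogeneous_adjugate_netMatrix (i j) :
    ((netMatrix Q).adjugate i j).IsHomogeneous 3 := by
  rw [adjugate_fin_succ_eq_det_submatrix]
  have h := isHomogeneous_det (A := (netMatrix Q).submatrix j.succAbove i.succAbove)
    fun _ _ ↦ isHomogeneous_netMatrix _ _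
  rw [Fintype.card_fin] at h
  rcases neg_one_pow_eq_or (MvPolynomial (Fin 3) ℂ) (j + i : ℕ) with hs | hs
  · simpa [hs] using h
  · simpa [hs] using h.neg

theorem prime_discriminant (hQ : IsRegularNet Q) : Prime (discriminant Q) :=
  prime_of_smooth four_ne_zero isHomogeneous_discriminant hQ.smooth

theorem adjugate_netMatrix_ne_zero (hQ : IsRegularNet Q) : (netMatrix Q).adjugate ≠ 0 := by
  intro h
  have := mul_adjugate (netMatrix Q)
  rw [h, mul_zero] at this
  have := congrFun (congrFun this 0) 0
  simp only [Matrix.smul_apply, one_apply_eq, smul_eq_mul, mul_one, Matrix.zero_apply] at this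
  exact (prime_discriminant hQ).ne_zero this.symm

theorem eval_pderiv_discriminant (c : Fin 3 → ℂ) (k : Fin 3) :
    eval c (pderiv k (discriminant Q)) = ∑ i, ∑ j, Q k i j * (member Q c).adjugate j i := by
  have hmap : (eval c).mapMatrix (netMatrix Q) = member Q c := by
    rw [← memberOver_complex]
    refine (map_memberOver (Q := Q) (aeval c) (X : Fin 3 → MvPolynomial (Fin 3) ℂ)).trans ?_
    congr 1
    funext k
    simp
  have hadj (i j) : eval c ((netMatrix Q).adjugate j i) = (member Q c).adjugate j i := by
    rw [← hmap, ← RingHom.map_adjugate]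
    rfl
  have hD (i j) : pderiv k (netMatrix Q i j) = C (Q k i j) := by
    simp [netMatrix, memberOver, Matrix.sum_apply, algebraMap_eq, Derivation.leibniz,
      Pi.single_apply]
  rw [discriminant_eq, derivation_det, map_sum]
  refine Finset.sum_congr rfl fun i _ ↦ ?_
  rw [map_sum]
  refine Finset.sum_congr rfl fun j _ ↦ ?_
  rw [map_mul, hadj, hD, eval_C]

/-- The singular members of a regular net are cones over smooth conics. -/
theorem adjugate_member_ne_zero (hQ : IsRegularNet Q) {c : Fin 3 → ℂ} (hc : c ≠ 0)
    (hdet : eval c (discriminant Q) = 0) : (member Q c).adjugate ≠ 0 := by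
  intro h
  obtain ⟨k, hk⟩ := hQ.smooth c hc hdet
  refine hk ?_
  rw [eval_pderiv_discriminant, h]
  simp

theorem det_member (c : Fin 3 → ℂ) : (member Q c).det = eval c (discriminant Q) := by
  rw [← aeval_eq_eval_apply, ← det_memberOver, memberOver_complex]

/-- A vertex of a singular member is not a base point. -/
theorem member_mulVec_ne_zero (hQ : IsRegularNet Q) {c : Fin 3 → ℂ} (hc : c ≠ 0)
    {b : Fin 4 → ℂ} (hb : b ≠ 0) (hbase : ∀ k, b ⬝ᵥ Q k *ᵥ b = 0) : member Q c *ᵥ b ≠ 0 := by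
  intro h
  have hdet : eval c (discriminant Q) = 0 := by
    rw [← det_member]
    exact exists_mulVec_eq_zero_iff.mp ⟨b, hb, h⟩
  obtain ⟨k, hk⟩ := hQ.smooth c hc hdet
  -- With vertex `b` the adjugate is `m b bᵀ`, so every partial derivative of the discriminant is `m
  -- * (b · Q k b)`, which vanishes at a base point and contradicts smoothness.
  obtain ⟨m, -, hm⟩ := exists_adjugate_eq (member_isSymm hQ c) hb h
    (adjugate_member_ne_zero hQ hc hdet)
  refine hk ?_
  rw [eval_pderiv_discriminant, ← mul_zero m, ← hbase k, dotProduct, Finset.mul_sum]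
  refine Finset.sum_congr rfl fun i _ ↦ ?_
  rw [mulVec, dotProduct, Finset.mul_sum, Finset.mul_sum]
  refine Finset.sum_congr rfl fun j _ ↦ ?_
  rw [hm]
  ring

end Matrices

/-! ### Projection from a base point and the square class of the product of its seven polar forms.
-/

section Octad

open Matrix

variable {Q : Fin 3 → Matrix (Fin 4) (Fin 4) ℂ}

/-- A base point of a regular net together with vectors `w j` dual to the polar planes of the
base point spans the space. -/
theorem exists_dual_vectors (hQ : IsRegularNet Q) {b : Fin 4 → ℂ} (hb : b ≠ 0)
    (hbase : ∀ k, b ⬝ᵥ Q k *ᵥ b = 0) :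
    ∃ w : Fin 3 → Fin 4 → ℂ, (∀ k j, b ⬝ᵥ Q k *ᵥ w j = if k = j then 1 else 0) ∧
      ∀ u, ∃ β : ℂ, u = β • b + ∑ j, (b ⬝ᵥ Q j *ᵥ u) • w j := by
  let M : Matrix (Fin 3) (Fin 4) ℂ := Matrix.of fun k ↦ b ᵥ* Q k
  have hM (u k) : (M *ᵥ u) k = b ⬝ᵥ Q k *ᵥ u := (dotProduct_mulVec b (Q k) u).symm
  -- A linear relation between the polar planes of `b` is a member of the net with vertex `b`.
  have hli : LinearIndependent ℂ M.row := by
    rw [Fintype.linearIndependent_iff]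
    intro c hc
    by_contra! h
    refine member_mulVec_ne_zero hQ (c := c) (fun h0 ↦ ?_) hb hbase ?_
    · obtain ⟨i, hi⟩ := h
      exact hi (congrFun h0 i)
    · rw [← hc, ← vecMul_transpose, (member_isSymm hQ c).eq, member, vecMul_sum]
      exact Finset.sum_congr rfl fun k _ ↦ vecMul_smul _ _ _
  have hrank : Module.finrank ℂ (LinearMap.range M.mulVecLin) = 3 := by
    simpa [Matrix.rank] using hli.rank_matrix
  have hsurj : Function.Surjective M.mulVecLin := by
    rw [← LinearMap.range_eq_top]
    exact Submodule.eq_top_of_finrank_eq (by rw [hrank]; simp)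
  have hker : Module.finrank ℂ (LinearMap.ker M.mulVecLin) = 1 := by
    have := LinearMap.finrank_range_add_finrank_ker M.mulVecLin
    rw [hrank] at this
    simp at this
    omega
  choose w hw using fun j : Fin 3 ↦ hsurj (Pi.single j 1)
  have hw' (k j) : b ⬝ᵥ Q k *ᵥ w j = if k = j then 1 else 0 := by
    rw [← hM, ← mulVecLin_apply, hw, Pi.single_apply]
  refine ⟨w, hw', fun u ↦ ?_⟩
  have hbk : b ∈ LinearMap.ker M.mulVecLin := by
    rw [LinearMap.mem_ker, mulVecLin_apply]
    funext k
    rw [hM, hbase]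
    rfl
  have huk : u - ∑ j, (b ⬝ᵥ Q j *ᵥ u) • w j ∈ LinearMap.ker M.mulVecLin := by
    rw [LinearMap.mem_ker, map_sub, map_sum, sub_eq_zero]
    simp only [map_smul, hw]
    funext k
    simp [hM, Pi.single_apply]
  obtain ⟨β, hβ⟩ := (finrank_eq_one_iff_of_nonzero' (⟨b, hbk⟩ : LinearMap.ker M.mulVecLin)
    (by simpa using hb)).mp hker ⟨_, huk⟩
  exact ⟨β, sub_eq_iff_eq_add.mp (congrArg Subtype.val hβ).symm⟩

/-- The value at a point of the discriminant curve of the resultant attached to a quadratic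
map is, up to squares, a diagonal cofactor of the corresponding singular symmetric matrix. -/
theorem exists_neg_adjugate_mul_lineResultant_eq_sq {F : Type} [Field F] [CharZero F]
    {t : Fin 3 → F} {C : Fin 3 → Fin 3 → Fin 3 → F}
    {P : Matrix (Fin 4) (Fin 4) F} (hP : P.IsSymm) (h00 : P 0 0 = 0)
    (h0 : ∀ j, P 0 (Fin.succ j) = t j)
    (hsucc : ∀ j l, P (Fin.succ j) (Fin.succ l) = ∑ k, t k * C k j l)
    (hdet : P.det = 0) (hadj : P.adjugate ≠ 0) (h2 : t 2 ≠ 0) :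
    ∃ j s, P.adjugate j j ≠ 0 ∧ -P.adjugate j j * lineResultant t C = s ^ 2 := by
  set d : Fin 3 → Fin 3 → F := fun j l ↦ P (Fin.succ j) (Fin.succ l) with hd
  have hds (j l) : d j l = d l j := hP.apply _ _
  have h0' (j) : P (Fin.succ j) 0 = t j := by rw [← h0]; exact hP.apply _ _
  have hbil (x y : Fin 3 → F) : ∑ k, t k * bilin (C k) x y = bilin d x y := by
    simp only [bilin, Finset.mul_sum]
    rw [Finset.sum_comm]
    refine Finset.sum_congr rfl fun j _ ↦ ?_
    rw [Finset.sum_comm]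
    refine Finset.sum_congr rfl fun l _ ↦ ?_
    simp only [hd, hsucc, Finset.sum_mul]
    exact Finset.sum_congr rfl fun _ _ ↦ by ring
  have key {q0 q1 q2 k0 k1 k2 k3 : F} (hq0 : q0 ≠ 0) (hq : q1 ^ 2 = 4 * q0 * q2) :
      ∃ s, q0 * binaryResultant q0 q1 q2 k0 k1 k2 k3 = s ^ 2 := by
    have h := binaryResultant_of_sq k0 k1 k2 k3 hq0 hq
    refine ⟨(8 * k3 * q0 ^ 3 - 4 * k2 * q0 ^ 2 * q1 + 2 * k1 * q0 * q1 ^ 2 - k0 * q1 ^ 3) /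
      (8 * q0), ?_⟩
    rw [div_pow, ← h]
    field_simp
    norm_num
  set p : Fin 3 → F := ![0, t 2, -t 1] with hp
  set s : Fin 3 → F := ![-t 2, 0, t 0] with hs
  -- `P` is the block `d` bordered by `t`. Restricting `d` to the line `t` in the basis `p, s` of
  -- its points gives, up to sign, the diagonal cofactors of indices 1 and 2 as extreme
  -- coefficients.
  have e1 : bilin d p p = -P.adjugate 1 1 := by
    rw [adjugate_fin_succ_eq_det_submatrix, det_fin_three]
    have i0 : (1 : Fin 4).succAbove 0 = 0 := rfl
    have i1 : (1 : Fin 4).succAbove 1 = Fin.succ 1 := rfl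
    have i2 : (1 : Fin 4).succAbove 2 = Fin.succ 2 := rfl
    have e : ((-1 : F)) ^ (((1 : Fin 4) : ℕ) + ((1 : Fin 4) : ℕ)) = 1 := by
      rw [← two_mul, pow_mul]
      simp
    simp only [submatrix_apply, i0, i1, i2, e, h00, h0, h0', bilin, Fin.sum_univ_three, hp]
    simp only [cons_val]
    change _ = -(1 * (0 * d 1 1 * d 2 2 - 0 * d 1 2 * d 2 1 - t 1 * t 1 * d 2 2 +
      t 1 * d 1 2 * t 2 + t 2 * t 1 * d 2 1 - t 2 * d 1 1 * t 2))
    ring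
  have e2 : bilin d s s = -P.adjugate 2 2 := by
    rw [adjugate_fin_succ_eq_det_submatrix, det_fin_three]
    have i0 : (2 : Fin 4).succAbove 0 = 0 := rfl
    have i1 : (2 : Fin 4).succAbove 1 = Fin.succ 0 := rfl
    have i2 : (2 : Fin 4).succAbove 2 = Fin.succ 2 := rfl
    have e : ((-1 : F)) ^ (((2 : Fin 4) : ℕ) + ((2 : Fin 4) : ℕ)) = 1 := by
      rw [← two_mul, pow_mul]
      simp
    simp only [submatrix_apply, i0, i1, i2, e, h00, h0, h0', bilin, Fin.sum_univ_three, hs]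
    simp only [cons_val]
    change _ = -(1 * (0 * d 0 0 * d 2 2 - 0 * d 0 2 * d 2 0 - t 0 * t 0 * d 2 2 +
      t 0 * d 0 2 * t 2 + t 2 * t 0 * d 2 0 - t 2 * d 0 0 * t 2))
    ring
  -- The discriminant of this restriction is `4 * t 2 ^ 2` times the bordered determinant `det P`,
  -- which is zero: the quadratic form has a double root.
  have e12 : (2 * bilin d p s) ^ 2 = 4 * bilin d p p * bilin d s s := by
    have hdet' : -t 0 ^ 2 * (d 1 1 * d 2 2 - d 1 2 ^ 2) - t 1 ^ 2 * (d 0 0 * d 2 2 - d 0 2 ^ 2)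
        - t 2 ^ 2 * (d 0 0 * d 1 1 - d 0 1 ^ 2) + 2 * t 0 * t 1 * (d 0 1 * d 2 2 - d 0 2 * d 1 2)
        - 2 * t 0 * t 2 * (d 0 1 * d 1 2 - d 1 1 * d 0 2)
        + 2 * t 1 * t 2 * (d 0 0 * d 1 2 - d 0 1 * d 0 2) = 0 := by
      rw [← hdet, det_succ_row_zero, Fin.sum_univ_succ, h00]
      simp only [h0, Fin.sum_univ_three, det_fin_three, submatrix_apply]
      have i (j : Fin 3) : (Fin.succ j).succAbove (0 : Fin 3) = 0 := rfl
      have a1 : (Fin.succ 0 : Fin 4).succAbove 1 = Fin.succ 1 := rfl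
      have a2 : (Fin.succ 0 : Fin 4).succAbove 2 = Fin.succ 2 := rfl
      have b1 : (Fin.succ 1 : Fin 4).succAbove 1 = Fin.succ 0 := rfl
      have b2 : (Fin.succ 1 : Fin 4).succAbove 2 = Fin.succ 2 := rfl
      have c1 : (Fin.succ 2 : Fin 4).succAbove 1 = Fin.succ 0 := rfl
      have c2 : (Fin.succ 2 : Fin 4).succAbove 2 = Fin.succ 1 := rfl
      simp only [i, a1, a2, b1, b2, c1, c2, h0']
      have s0 : (((Fin.succ 0 : Fin 4)) : ℕ) = 1 := rfl
      have s1 : (((Fin.succ 1 : Fin 4)) : ℕ) = 2 := rfl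
      have s2 : (((Fin.succ 2 : Fin 4)) : ℕ) = 3 := rfl
      simp only [s0, s1, s2]
      have hdd (j l) : P (Fin.succ j) (Fin.succ l) = d j l := rfl
      simp only [hdd, hds 1 0, hds 2 0, hds 2 1]
      ring
    simp only [bilin, Fin.sum_univ_three, hp, hs, cons_val, hds 1 0, hds 2 0, hds 2 1]
    linear_combination 4 * t 2 ^ 2 * hdet'
  have hR : lineResultant t C = binaryResultant (bilin d p p) (2 * bilin d p s) (bilin d s s)
      (bilin (C 0) p p) (2 * bilin (C 0) p s + bilin (C 1) p p)
      (bilin (C 0) s s + 2 * bilin (C 1) p s) (bilin (C 1) s s) := by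
    rw [lineResultant, hbil, hbil, hbil]
  by_cases hq0 : bilin d p p = 0
  -- If both extreme coefficients vanished, the kernel vector would have `v 1 = v 2 = 0`, and rows 0
  -- and 3 together with `t 2 ≠ 0` would annihilate it. The remaining case is thus handled by
  -- exchanging the two variables.
  · have hq2 : bilin d s s ≠ 0 := by
      intro hq2
      obtain ⟨v, hv, hPv⟩ := exists_mulVec_eq_zero_iff.mpr hdet
      obtain ⟨c, hc, hform⟩ := exists_adjugate_eq hP hv hPv hadj
      have hv1 : v 1 = 0 := by
        have := hform 1 1
        rw [← neg_eq_iff_eq_neg.mpr e1, hq0] at this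
        simpa [hc] using this.symm
      have hv2 : v 2 = 0 := by
        have := hform 2 2
        rw [← neg_eq_iff_eq_neg.mpr e2, hq2] at this
        simpa [hc] using this.symm
      have r0 := congrFun hPv 0
      have r3 := congrFun hPv (Fin.succ 2)
      rw [mulVec, dotProduct, Fin.sum_univ_succ] at r0 r3
      simp only [Fin.sum_univ_three, h00, h0, h0'] at r0 r3
      have a0 : v (Fin.succ 0) = 0 := hv1
      have a1 : v (Fin.succ 1) = 0 := hv2
      rw [a0, a1] at r0 r3
      have hv3 : v (Fin.succ 2) = 0 := by simpa [h2] using r0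
      rw [hv3] at r3
      have hv0 : v 0 = 0 := by simpa [h2] using r3
      refine hv (funext fun i ↦ ?_)
      fin_cases i
      exacts [hv0, hv1, hv2, hv3]
    obtain ⟨x, hx⟩ := key (k0 := bilin (C 1) s s) (k1 := bilin (C 0) s s + 2 * bilin (C 1) p s)
      (k2 := 2 * bilin (C 0) p s + bilin (C 1) p p) (k3 := bilin (C 0) p p) hq2
      (e12.trans (by ring))
    refine ⟨2, x, fun h ↦ hq2 (by rw [e2, h, neg_zero]), ?_⟩
    rw [← hx, binaryResultant_swap, ← hR, e2]
  · obtain ⟨x, hx⟩ := key (k0 := bilin (C 0) p p) (k1 := 2 * bilin (C 0) p s + bilin (C 1) p p)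
      (k2 := bilin (C 0) s s + 2 * bilin (C 1) p s) (k3 := bilin (C 1) s s) hq0 e12
    refine ⟨1, x, fun h ↦ hq0 (by rw [e1, h, neg_zero]), ?_⟩
    rw [← hx, ← hR, e1]

/-- The vector `k` is a nonzero column of the adjugate. With this scaling the proportionality factor
in `adj = k kᵀ / k a` is an entry of `k` itself. -/
theorem exists_kernel_vector_of_adjugate_ne_zero {F : Type} [Field F] {A : Matrix (Fin 4) (Fin 4) F}
    (hA : A.IsSymm) (hdet : A.det = 0) (hadj : A.adjugate ≠ 0) :
    ∃ (a : Fin 4) (k : Fin 4 → F), k a ≠ 0 ∧ A *ᵥ k = 0 ∧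
      ∀ s t, k a * A.adjugate s t = k s * k t := by
  obtain ⟨v, hv, hAv⟩ := exists_mulVec_eq_zero_iff.mpr hdet
  obtain ⟨c, hc, hform⟩ := exists_adjugate_eq hA hv hAv hadj
  obtain ⟨a, ha⟩ := Function.ne_iff.mp hv
  refine ⟨a, (c * v a) • v, mul_ne_zero (mul_ne_zero hc ha) ha, ?_, fun s t ↦ ?_⟩
  · rw [mulVec_smul, hAv, smul_zero]
  · rw [hform]
    simp only [Pi.smul_apply, smul_eq_mul]
    ring

theorem exists_kernel_vector (hQ : IsRegularNet Q) {K : Type} [Field K] [Algebra ℂ K]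
    (F : CurveFunctionField (discriminant Q) K) :
    ∃ (a : Fin 4) (k : Fin 4 → K), k a ≠ 0 ∧ memberOver Q F.coord *ᵥ k = 0 ∧
      ∀ s t, k a * (memberOver Q F.coord).adjugate s t = k s * k t := by
  have hdet : (memberOver Q F.coord).det = 0 := by
    rw [det_memberOver]
    exact F.aeval_self isHomogeneous_discriminant
  have hadj : (memberOver Q F.coord).adjugate ≠ 0 := by
    intro h
    refine adjugate_netMatrix_ne_zero hQ (Matrix.ext fun i j ↦ ?_)
    by_contra hij
    refine F.aeval_ne_zero isHomogeneous_discriminant (by norm_num)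
      (isHomogeneous_adjugate_netMatrix i j) hij ?_
    have h1 := (aeval F.coord : MvPolynomial (Fin 3) ℂ →ₐ[ℂ] K).map_adjugate (netMatrix Q)
    have h2 := congrFun (congrFun h1 i) j
    rw [AlgHom.mapMatrix_apply, AlgHom.mapMatrix_apply, netMatrix, map_memberOver] at h2
    have h3 : (aeval F.coord : MvPolynomial (Fin 3) ℂ →ₐ[ℂ] K) ∘ X = F.coord := by
      funext k
      simp
    rw [h3, h] at h2
    exact h2
  exact exists_kernel_vector_of_adjugate_ne_zero (memberOver_isSymm hQ F.coord) hdet hadj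

variable {b : Fin 8 → Fin 4 → ℂ}

theorem IsBaseLocus.base_eq_zero (hb : IsBaseLocus Q b) (i : Fin 8) (k : Fin 3) :
    b i ⬝ᵥ Q k *ᵥ b i = 0 :=
  (hb.mem_iff _ (hb.ne_zero i)).mpr ⟨i, 1, (one_smul _ _).symm⟩ k

/-- The three polar planes of `b i` meet only in the point `b i`, so no other base point lies on all
of them. -/
theorem IsBaseLocus.exists_ne_zero (hQ : IsRegularNet Q) (hb : IsBaseLocus Q b) {i j : Fin 8}
    (hij : i ≠ j) : ∃ k, b i ⬝ᵥ Q k *ᵥ b j ≠ 0 := by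
  by_contra! h
  obtain ⟨w, -, hw⟩ := exists_dual_vectors hQ (hb.ne_zero i) (hb.base_eq_zero i)
  obtain ⟨β, hβ⟩ := hw (b j)
  simp only [h, zero_smul, Finset.sum_const_zero, add_zero] at hβ
  exact hb.distinct i j hij β hβ

theorem dotProduct_memberOver_eq_aeval {R : Type} [CommRing R] [Algebra ℂ R] (t : Fin 3 → R)
    (x y : Fin 4 → ℂ) :
    (algebraMap ℂ R ∘ x) ⬝ᵥ memberOver Q t *ᵥ (algebraMap ℂ R ∘ y) =
      aeval t (linForm fun k ↦ x ⬝ᵥ Q k *ᵥ y) := by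
  rw [dotProduct_memberOver, aeval_linForm]

theorem polar_ne_zero (hQ : IsRegularNet Q) (hb : IsBaseLocus Q b) {K : Type} [Field K]
    [Algebra ℂ K] (F : CurveFunctionField (discriminant Q) K) {i j : Fin 8} (hij : i ≠ j) :
    (algebraMap ℂ K ∘ b i) ⬝ᵥ memberOver Q F.coord *ᵥ (algebraMap ℂ K ∘ b j) ≠ 0 := by
  rw [dotProduct_memberOver_eq_aeval]
  refine F.aeval_ne_zero isHomogeneous_discriminant (by norm_num)
    (isHomogeneous_linForm _) (linForm_ne_zero fun h ↦ ?_)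
  obtain ⟨k, hk⟩ := hb.exists_ne_zero hQ hij
  exact hk (congrFun h k)

/-- The product of the seven polar forms of a base point with the others is, on the discriminant
curve, a square up to a diagonal cofactor. -/
theorem exists_prod_polar_mul_eq_sq (hQ : IsRegularNet Q) (hb : IsBaseLocus Q b) {K : Type}
    [Field K] [Algebra ℂ K] (F : CurveFunctionField (discriminant Q) K) {a : Fin 4}
    {k : Fin 4 → K} (ha : k a ≠ 0)
    (hk : ∀ s t, k a * (memberOver Q F.coord).adjugate s t = k s * k t) :
    ∃ s, (∏ i : Fin 7, (algebraMap ℂ K ∘ b 0) ⬝ᵥ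
      memberOver Q F.coord *ᵥ (algebraMap ℂ K ∘ b i.succ)) * k a = s ^ 2 := by
  have : CharZero K := charZero_of_injective_algebraMap (algebraMap ℂ K).injective
  obtain ⟨w, hw, hspan⟩ := exists_dual_vectors hQ (hb.ne_zero 0) (hb.base_eq_zero 0)
  have hQs (l : Fin 3) := dotProduct_mulVec_comm (hQ.symm l)
  -- The point `γ b 0 + ∑ y j w j` lies on all quadrics exactly when `C l (y, y) = -2 γ y l` for all
  -- `l`: base points are fixed points of the quadratic map `C` of the plane of lines through `b 0`.
  let C : Fin 3 → Fin 3 → Fin 3 → ℂ := fun l i j ↦ w i ⬝ᵥ Q l *ᵥ w j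
  have hC (l i j) : C l i j = C l j i := hQs l _ _
  let x : Fin 7 → Fin 3 → ℂ := fun i l ↦ b 0 ⬝ᵥ Q l *ᵥ b i.succ
  have hx (i) : x i ≠ 0 := by
    obtain ⟨l, hl⟩ := hb.exists_ne_zero hQ (Fin.succ_ne_zero i).symm
    exact fun h ↦ hl (congrFun h l)
  have hquad (γ : ℂ) (y : Fin 3 → ℂ) (l : Fin 3) :
      (γ • b 0 + ∑ j, y j • w j) ⬝ᵥ Q l *ᵥ (γ • b 0 + ∑ j, y j • w j) =
        2 * γ * y l + bilin (C l) y y := by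
    have h1 : (∑ j, y j • w j) ⬝ᵥ Q l *ᵥ (∑ j, y j • w j) = bilin (C l) y y := by
      simp only [mulVec_sum, dotProduct_sum, sum_dotProduct, mulVec_smul, dotProduct_smul,
        smul_dotProduct, smul_eq_mul, bilin, C]
      simp only [Finset.mul_sum]
      exact Finset.sum_congr rfl fun i _ ↦ Finset.sum_congr rfl fun j _ ↦ by
        rw [hQs l (w j) (w i)]
        ring
    have h2 : b 0 ⬝ᵥ Q l *ᵥ (∑ j, y j • w j) = y l := by
      simp [mulVec_sum, dotProduct_sum, mulVec_smul, dotProduct_smul, hw]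
    rw [mulVec_add, dotProduct_add, add_dotProduct, add_dotProduct, h1,
      hQs l (∑ j, y j • w j) (γ • b 0), mulVec_smul, smul_dotProduct, smul_dotProduct,
      dotProduct_smul, hb.base_eq_zero, h2]
    simp only [smul_eq_mul]
    ring
  have hpair (γ : ℂ) (y : Fin 3 → ℂ) (l : Fin 3) :
      b 0 ⬝ᵥ Q l *ᵥ (γ • b 0 + ∑ j, y j • w j) = y l := by
    simp [mulVec_add, mulVec_sum, dotProduct_sum, mulVec_smul, dotProduct_smul, hw,
      hb.base_eq_zero]
  choose β hβ using fun i : Fin 7 ↦ hspan (b i.succ)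
  have hxβ (i l) : bilin (C l) (x i) (x i) = -2 * β i * x i l := by
    have h := hquad (β i) (x i) l
    rw [← hβ i, hb.base_eq_zero] at h
    linear_combination -h
  have hxx (i j) (hij : i ≠ j) (c : ℂ) : x j ≠ c • x i := by
    intro h
    have h1 : b j.succ = c • b i.succ + (β j - c * β i) • b 0 := by
      have hj := hβ j
      have hi := hβ i
      change _ = _ + ∑ l, x j l • w l at hj
      change _ = _ + ∑ l, x i l • w l at hi
      rw [hj, hi, h]
      simp only [Pi.smul_apply, smul_add, Finset.smul_sum, sub_smul, smul_smul, smul_eq_mul]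
      abel
    -- Equal directions place `b j.succ` on the line through `b 0` and `b i.succ`. On that line the
    -- quadric `Q l` restricts to the product of the two coordinates times a polar value, so `b
    -- j.succ` is one of those two points.
    have h2 (l) : 2 * c * (β j - c * β i) * x i l = 0 := by
      have h3 := hb.base_eq_zero j.succ l
      rw [h1, mulVec_add, dotProduct_add, add_dotProduct, add_dotProduct,
        mulVec_smul, mulVec_smul, smul_dotProduct, smul_dotProduct, smul_dotProduct,
        smul_dotProduct, dotProduct_smul, dotProduct_smul, dotProduct_smul, dotProduct_smul,
        hb.base_eq_zero, hb.base_eq_zero, hQs l (b i.succ) (b 0)] at h3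
      simp only [smul_eq_mul, x] at h3 ⊢
      linear_combination h3
    obtain ⟨l, hl⟩ := Function.ne_iff.mp (hx i)
    rcases mul_eq_zero.mp ((mul_eq_zero.mp (h2 l)).resolve_right hl) with h3 | h3
    · have hc : c = 0 := by simpa using h3
      refine hb.distinct 0 j.succ (Fin.succ_ne_zero j).symm (β j) ?_
      rw [h1, hc]
      simp
    · refine hb.distinct i.succ j.succ (fun h ↦ hij (Fin.succ_injective _ h)) c ?_
      rw [h1, h3]
      simp
  have hall (y : Fin 3 → ℂ) (hy : y ≠ 0) (γ : ℂ) (h : ∀ l, bilin (C l) y y = γ * y l) :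
      ∃ i, ∃ c : ℂ, y = c • x i := by
    -- The multiplier `γ` of a fixed point determines the lift to a base point on the corresponding
    -- line through `b 0`.
    set v := (-γ / 2) • b 0 + ∑ j, y j • w j with hv
    have hv0 : v ≠ 0 := by
      intro h0
      refine hy (funext fun l ↦ ?_)
      rw [← hpair (-γ / 2) y l, ← hv, h0, mulVec_zero, dotProduct_zero]
      rfl
    obtain ⟨i, c, hc⟩ := (hb.mem_iff v hv0).mp fun l ↦ by
      rw [hv, hquad, h]
      ring
    have hyl (l) : y l = c * (b 0 ⬝ᵥ Q l *ᵥ b i) := by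
      rw [← hpair (-γ / 2) y l, ← hv, hc, mulVec_smul, dotProduct_smul, smul_eq_mul]
    induction i using Fin.cases with
    | zero =>
      refine absurd (_root_.funext fun l ↦ ?_) hy
      rw [hyl, hb.base_eq_zero, mul_zero]
      rfl
    | succ i => exact ⟨i, c, _root_.funext hyl⟩
  obtain ⟨c, hc, hres⟩ := exists_lineResultant_eq (by simp) hC x hx hxx (fun i ↦ -2 * β i)
    hxβ hall
  have hres' := congrArg (aeval F.coord) hres
  rw [← RingHom.coe_coe, map_lineResultant] at hres'
  simp only [RingHom.coe_coe, map_mul, map_pow, map_prod, aeval_X, aeval_C] at hres'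
  have hX : (aeval F.coord : MvPolynomial (Fin 3) ℂ →ₐ[ℂ] K) ∘ X = F.coord := by
    funext l
    simp
  rw [hX] at hres'
  simp only [dotProduct_memberOver_eq_aeval]
  change ∃ s, (∏ i, aeval F.coord (linForm (x i))) * k a = s ^ 2
  set A := memberOver Q F.coord with hA
  -- In the basis `b 0, w` the generic singular member takes the bordered form: zero corner, border
  -- `t`, and block `∑ t l C l`.
  let S : Matrix (Fin 4) (Fin 4) ℂ := Matrix.of (Fin.cons (b 0) w)
  have hS : S.det ≠ 0 := by
    intro h
    obtain ⟨z, hz, hzS⟩ := exists_vecMul_eq_zero_iff.mpr h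
    have hz' : z 0 • b 0 + ∑ j : Fin 3, z j.succ • w j = 0 := by
      rw [← hzS]
      funext i
      simp [vecMul, dotProduct, Fin.sum_univ_succ, S]
    have hz1 (j : Fin 3) : z j.succ = 0 := by
      have := hpair (z 0) (fun j ↦ z j.succ) j
      rw [hz', mulVec_zero, dotProduct_zero] at this
      exact this.symm
    have hz0 : z 0 = 0 := by
      simp only [hz1, zero_smul, Finset.sum_const_zero, add_zero] at hz'
      exact (smul_eq_zero.mp hz').resolve_right (hb.ne_zero 0)
    exact hz (funext (Fin.cases hz0 hz1))
  let S' : Matrix (Fin 4) (Fin 4) K := S.map (algebraMap ℂ K)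
  have hS' : IsUnit S'.det := by
    have h : S'.det = algebraMap ℂ K S.det := ((algebraMap ℂ K).map_det S).symm
    rw [h]
    exact (IsUnit.mk0 _ hS).map _
  let P := S' * A * S'ᵀ
  have hAs : A.IsSymm := memberOver_isSymm hQ _
  have hPs : P.IsSymm := by
    rw [IsSymm, transpose_mul, transpose_mul, transpose_transpose, hAs.eq]
    exact (Matrix.mul_assoc _ _ _).symm
  have hP (i j) : P i j = ∑ l, algebraMap ℂ K (S i ⬝ᵥ Q l *ᵥ S j) * F.coord l :=
    (mul_mul_transpose_apply S' A i j).trans (dotProduct_memberOver F.coord (S i) (S j))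
  have hS0 : S 0 = b 0 := rfl
  have hS1 (j : Fin 3) : S j.succ = w j := rfl
  have hdetA : A.det = 0 := by
    rw [hA, det_memberOver]
    exact F.aeval_self isHomogeneous_discriminant
  have hadjP : P.adjugate ≠ 0 := by
    intro h
    have h1 : S'ᵀ.adjugate * (A.adjugate * S'.adjugate) = 0 := by
      rw [← adjugate_mul_distrib, ← adjugate_mul_distrib]
      exact h
    have hu {T : Matrix (Fin 4) (Fin 4) K} (hT : IsUnit T.det) : IsUnit T.adjugate := by
      rw [isUnit_iff_isUnit_det, det_adjugate]
      exact hT.pow _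
    rw [(hu (by rwa [det_transpose])).mul_right_eq_zero, (hu hS').mul_left_eq_zero] at h1
    have := hk a a
    rw [h1, Matrix.zero_apply, mul_zero] at this
    exact mul_self_ne_zero.mpr ha this.symm
  obtain ⟨j, s, hj, hs⟩ := exists_neg_adjugate_mul_lineResultant_eq_sq (t := F.coord)
    (C := fun l i j ↦ algebraMap ℂ K (C l i j)) (P := P) hPs
    (by simp [hP, hS0, hb.base_eq_zero]) (fun j ↦ by simp [hP, hS0, hS1, hw])
    (fun i j ↦ by rw [hP]; exact Finset.sum_congr rfl fun _ _ ↦ mul_comm _ _)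
    (by rw [det_mul, det_mul, hdetA]; ring) hadjP
    (F.coord_ne_zero isHomogeneous_discriminant (by norm_num) 2)
  have hq := mul_adjugate_mul_mul_transpose_apply hk S' j
  -- The factor `-c`, from the sign of the cofactor and the constant of the factorization, is a
  -- complex number and hence a square.
  obtain ⟨δ, hδ⟩ := IsAlgClosed.exists_pow_nat_eq (-c) two_pos
  have hδ0 : algebraMap ℂ K δ ≠ 0 := by
    rw [Ne, FaithfulSMul.algebraMap_eq_zero_iff]
    rintro rfl
    exact hc (by simpa using hδ.symm)
  have hδ' : algebraMap ℂ K δ ^ 2 = -algebraMap ℂ K c := by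
    rw [← map_pow, hδ, map_neg]
  have h2 := F.coord_ne_zero isHomogeneous_discriminant (by norm_num) 2
  refine ⟨s * (∑ i, k i * S'.adjugate i j) /
    (algebraMap ℂ K δ * F.coord 2 ^ 3 * P.adjugate j j), ?_⟩
  rw [hres'] at hs
  rw [div_pow, mul_pow s, ← hs, ← hq, eq_div_iff
    (pow_ne_zero _ (mul_ne_zero (mul_ne_zero hδ0 (pow_ne_zero _ h2)) hj))]
  change _ = _ * (k a * P.adjugate j j)
  linear_combination (∏ i, aeval F.coord (linForm (x i))) * k a * F.coord 2 ^ 6 *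
    P.adjugate j j ^ 2 * hδ'

end Octad

/-! ### Parametrization of the conic of tangent planes from a base point. -/

section Conic

open Matrix

/-- The second point of intersection of the line through `v` and the point `b` of the quadric
with symmetric matrix `A` with this quadric. -/
def secondPoint {R : Type} [CommRing R] (A : Matrix (Fin 4) (Fin 4) R) (b v : Fin 4 → R) :
    Fin 4 → R := (v ⬝ᵥ A *ᵥ v) • b - (2 * (b ⬝ᵥ A *ᵥ v)) • v

section

variable {R : Type} [CommRing R] {A : Matrix (Fin 4) (Fin 4) R} {b : Fin 4 → R}

theorem dotProduct_mulVec_secondPoint (c v : Fin 4 → R) :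
    c ⬝ᵥ A *ᵥ secondPoint A b v =
      (v ⬝ᵥ A *ᵥ v) * (c ⬝ᵥ A *ᵥ b) - 2 * (b ⬝ᵥ A *ᵥ v) * (c ⬝ᵥ A *ᵥ v) := by
  simp only [secondPoint, mulVec_sub, mulVec_smul, dotProduct_sub, dotProduct_smul, smul_eq_mul]

theorem dotProduct_mulVec_secondPoint_self (hb : b ⬝ᵥ A *ᵥ b = 0) (v : Fin 4 → R) :
    b ⬝ᵥ A *ᵥ secondPoint A b v = -2 * (b ⬝ᵥ A *ᵥ v) ^ 2 := by
  rw [dotProduct_mulVec_secondPoint, hb]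
  ring

theorem secondPoint_isotropic (hA : A.IsSymm) (hb : b ⬝ᵥ A *ᵥ b = 0) (v : Fin 4 → R) :
    secondPoint A b v ⬝ᵥ A *ᵥ secondPoint A b v = 0 := by
  rw [dotProduct_mulVec_secondPoint, dotProduct_mulVec_comm hA _ b,
    dotProduct_mulVec_comm hA (secondPoint A b v) v, dotProduct_mulVec_secondPoint_self hb,
    dotProduct_mulVec_secondPoint, dotProduct_mulVec_comm hA v b]
  ring

theorem of_updateRow_zero {R : Type} (x y c d e : Fin 4 → R) :
    (Matrix.of ![y, c, d, e]).updateRow 0 x = Matrix.of ![x, c, d, e] := by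
  ext i j
  fin_cases i <;> simp [updateRow_apply]

theorem det4_eq_sum (y c d e : Fin 4 → R) :
    det4 y c d e = ∑ j, y j * det4 (Pi.single j 1) c d e := by
  have h := congrFun (congrFun (mul_adjugate (Matrix.of ![y, c, d, e])) 0) 0
  rw [Matrix.smul_apply, one_apply_eq, smul_eq_mul, mul_one, mul_apply] at h
  rw [det4, ← h]
  refine Finset.sum_congr rfl fun j _ ↦ ?_
  rw [adjugate_apply, of_updateRow_zero]
  rfl

theorem map_det4 {S : Type} [CommRing S] (φ : R →+* S) (x y c d : Fin 4 → R) :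
    φ (det4 x y c d) = det4 (φ ∘ x) (φ ∘ y) (φ ∘ c) (φ ∘ d) := by
  rw [det4, RingHom.map_det, det4]
  congr 1
  ext i j
  fin_cases i <;> rfl

/-- Modulo `b` the second point is `-2 (b · A v) v`, and the row `b` is already present in the
determinant. -/
theorem det4_secondPoint (c k v : Fin 4 → R) :
    det4 (secondPoint A b v) b c k = -2 * (b ⬝ᵥ A *ᵥ v) * det4 v b c k := by
  have h := det_updateRow_add (Matrix.of ![v, b, c, k]) 0 ((v ⬝ᵥ A *ᵥ v) • b)
    ((-2 * (b ⬝ᵥ A *ᵥ v)) • v)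
  rw [det_updateRow_smul, det_updateRow_smul] at h
  rw [of_updateRow_zero, of_updateRow_zero, of_updateRow_zero, det_zero_of_row_eq (M := Matrix.of ![b, b, c, k]) (i := 0) (j := 1) (by simp)
    rfl, mul_zero, zero_add] at h
  rw [det4, det4, ← h, secondPoint]
  congr 4
  rw [neg_mul, neg_smul, sub_eq_add_neg]

end

/-- A symmetric matrix whose kernel is spanned by `k` maps onto the orthogonal complement of
`k`. -/
theorem exists_mulVec_eq {F : Type} [Field F] {A : Matrix (Fin 4) (Fin 4) F} {a : Fin 4}
    {k : Fin 4 → F} (hA : A.IsSymm) (hAk : A *ᵥ k = 0) (ha : k a ≠ 0)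
    (hk : ∀ s t, k a * A.adjugate s t = k s * k t) {n : Fin 4 → F} (hn : k ⬝ᵥ n = 0) :
    ∃ z, A *ᵥ z = n := by
  have hdet : A.det = 0 := exists_mulVec_eq_zero_iff.mp ⟨k, fun h ↦ ha (congrFun h a), hAk⟩
  -- The perturbed matrix is invertible because its determinant is the cofactor at `(a, a)`. Pairing
  -- the solution with `k` shows that the perturbation contributes nothing.
  let B := A.updateRow a (A a + Pi.single a 1)
  have hB : IsUnit B.det := by
    rw [isUnit_iff_ne_zero, det_updateRow_add, updateRow_eq_self, hdet, zero_add,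
      ← adjugate_apply]
    intro h
    have := hk a a
    rw [h, mul_zero] at this
    exact mul_self_ne_zero.mpr ha this.symm
  have hBz : B *ᵥ (B⁻¹ *ᵥ n) = n := by rw [mulVec_mulVec, mul_nonsing_inv _ hB, one_mulVec]
  set z := B⁻¹ *ᵥ n
  have hAz : A *ᵥ z = n - z a • Pi.single a 1 := by
    rw [← hBz]
    funext i
    by_cases h : i = a
    · subst h
      have hBi : B i = A i + Pi.single i 1 := updateRow_self
      change A i ⬝ᵥ z = B i ⬝ᵥ z - (z i • Pi.single i 1 : Fin 4 → F) i
      rw [hBi, add_dotProduct]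
      simp
    · simp [mulVec, B, h]
  have hza : z a = 0 := by
    have h : k ⬝ᵥ A *ᵥ z = 0 := by
      rw [dotProduct_mulVec_comm hA, hAk, dotProduct_zero]
    rw [hAz, dotProduct_sub, hn, dotProduct_smul, dotProduct_single] at h
    simpa [ha] using h
  exact ⟨z, by rw [hAz, hza, zero_smul, sub_zero]⟩

variable {Q : Fin 3 → Matrix (Fin 4) (Fin 4) ℂ} {R : Type} [CommRing R] [Algebra ℂ R]

/-- The tangent plane of the member of the net with parameter `t` at the second point of
intersection with the line through `v` and the base point `b`. -/
def tangentPlane (Q : Fin 3 → Matrix (Fin 4) (Fin 4) ℂ) (b : Fin 4 → ℂ) (t : Fin 3 → R)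
    (v : Fin 4 → R) : Fin 4 → R :=
  memberOver Q t *ᵥ secondPoint (memberOver Q t) (algebraMap ℂ R ∘ b) v

theorem map_tangentPlane {S : Type} [CommRing S] [Algebra ℂ S] (φ : R →ₐ[ℂ] S) (b : Fin 4 → ℂ)
    (t : Fin 3 → R) (v : Fin 4 → R) :
    φ ∘ tangentPlane Q b t v = tangentPlane Q b (φ ∘ t) (φ ∘ v) := by
  have hm (x : Fin 4 → R) : φ ∘ (memberOver Q t *ᵥ x) = memberOver Q (φ ∘ t) *ᵥ (φ ∘ x) := by
    rw [← map_memberOver]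
    funext i
    exact RingHom.map_mulVec φ.toRingHom _ _ _
  have hd (x y : Fin 4 → R) : φ (x ⬝ᵥ y) = (φ ∘ x) ⬝ᵥ (φ ∘ y) :=
    RingHom.map_dotProduct φ.toRingHom _ _
  have hb : φ ∘ algebraMap ℂ R ∘ b = algebraMap ℂ S ∘ b := by
    funext i
    simp
  rw [tangentPlane, tangentPlane, hm]
  congr 1
  rw [← hb, secondPoint, secondPoint, ← hm, ← hd, ← hd]
  funext i
  simp only [Function.comp_apply, Pi.sub_apply, Pi.smul_apply, smul_eq_mul, map_sub, map_mul,
    map_ofNat]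

theorem tangentPlane_smul (b : Fin 4 → ℂ) (c : R) (t : Fin 3 → R) (v : Fin 4 → R) :
    tangentPlane Q b (c • t) v = c ^ 2 • tangentPlane Q b t v := by
  have hm : memberOver Q (c • t) = c • memberOver Q t := by
    simp [memberOver, Finset.smul_sum, mul_smul]
  rw [tangentPlane, tangentPlane, hm, secondPoint, secondPoint]
  simp only [smul_mulVec, dotProduct_smul, mulVec_sub, mulVec_smul, smul_sub, smul_smul,
    smul_eq_mul]
  congr 2 <;> ring

variable {b : Fin 8 → Fin 4 → ℂ}

theorem IsBaseLocus.memberOver_eq_zero (hb : IsBaseLocus Q b) (i : Fin 8) (t : Fin 3 → R) :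
    (algebraMap ℂ R ∘ b i) ⬝ᵥ memberOver Q t *ᵥ (algebraMap ℂ R ∘ b i) = 0 := by
  rw [dotProduct_memberOver]
  simp [hb.base_eq_zero]

/-- The planes of the octad, restricted to the conic of tangent planes of the generic singular
member of the net, have a square product; a square root of it is, up to a cube, a product of
linear forms. -/
theorem exists_sq_eq_prod_tangentPlane (hQ : IsRegularNet Q) (hb : IsBaseLocus Q b) {K : Type}
    [Field K] [Algebra ℂ K] (F : CurveFunctionField (discriminant Q) K)
    (ξ : Fin 4 → MvPolynomial (Fin 4) K)
    (hξ : ξ = tangentPlane Q (b 0) (algebraMap K _ ∘ F.coord) X) :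
    (∀ i, (algebraMap ℂ _ ∘ b i) ⬝ᵥ ξ ≠ 0) ∧
    ∃ (r : MvPolynomial (Fin 4) K) (c : K) (z : Fin 7 → Fin 4 → K),
      r ^ 2 = ∏ i, (algebraMap ℂ _ ∘ b i) ⬝ᵥ ξ ∧ c ≠ 0 ∧
      ∏ i, (algebraMap K _ ∘ z i) ⬝ᵥ ξ = algebraMap K _ c * ((algebraMap ℂ _ ∘ b 0) ⬝ᵥ ξ) ^ 3 * r := by
  have : CharZero K := charZero_of_injective_algebraMap (algebraMap ℂ K).injective
  obtain ⟨a, k, ha, hAk, hk⟩ := exists_kernel_vector hQ F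
  obtain ⟨s, hs⟩ := exists_prod_polar_mul_eq_sq hQ hb F ha hk
  set A := memberOver Q F.coord with hA
  have hAs : A.IsSymm := memberOver_isSymm hQ _
  let B (i : Fin 8) : Fin 4 → K := algebraMap ℂ K ∘ b i
  have hBA (i) : B i ⬝ᵥ A *ᵥ B i = 0 := hb.memberOver_eq_zero i _
  have hBAne {i j} (hij : i ≠ j) : B i ⬝ᵥ A *ᵥ B j ≠ 0 := polar_ne_zero hQ hb F hij
  let A' : Matrix (Fin 4) (Fin 4) (MvPolynomial (Fin 4) K) := A.map (algebraMap K (MvPolynomial (Fin 4) K))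
  have hA's : A'.IsSymm := by
    rw [IsSymm, ← transpose_map, hAs.eq]
  let ι : (Fin 4 → K) → Fin 4 → MvPolynomial (Fin 4) K := fun x ↦ algebraMap K (MvPolynomial (Fin 4) K) ∘ x
  have hBι (i) : (algebraMap ℂ (MvPolynomial (Fin 4) K) ∘ b i : Fin 4 → MvPolynomial (Fin 4) K) = ι (B i) := by
    funext j
    exact IsScalarTower.algebraMap_apply ℂ K (MvPolynomial (Fin 4) K) _
  have hιd (x y : Fin 4 → K) : ι x ⬝ᵥ A' *ᵥ ι y = algebraMap K (MvPolynomial (Fin 4) K) (x ⬝ᵥ A *ᵥ y) := by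
    rw [RingHom.map_dotProduct]
    congr 1
    funext i
    exact (RingHom.map_mulVec (algebraMap K (MvPolynomial (Fin 4) K)) A y i).symm
  have hξ' : ξ = A' *ᵥ secondPoint A' (ι (B 0)) X := by
    rw [hξ, tangentPlane, hBι]
    have h : memberOver Q (algebraMap K (MvPolynomial (Fin 4) K) ∘ F.coord) = A' := by
      have := map_memberOver (Q := Q) (IsScalarTower.toAlgHom ℂ K (MvPolynomial (Fin 4) K)) F.coord
      exact this.symm
    rw [h]
  clear hξ
  rw [hξ']
  simp only [hBι]
  have hev (v x : Fin 4 → K) :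
      eval v (ι x ⬝ᵥ A' *ᵥ X) = x ⬝ᵥ A *ᵥ v := by
    simp [ι, A', mulVec, dotProduct, algebraMap_eq]
  have hev' (v : Fin 4 → K) : eval v (X ⬝ᵥ A' *ᵥ X) = v ⬝ᵥ A *ᵥ v := by
    simp [A', mulVec, dotProduct, algebraMap_eq]
  have hevξ (v : Fin 4 → K) (x : Fin 4 → K) :
      eval v (ι x ⬝ᵥ A' *ᵥ secondPoint A' (ι (B 0)) X) =
        (v ⬝ᵥ A *ᵥ v) * (x ⬝ᵥ A *ᵥ B 0) - 2 * (B 0 ⬝ᵥ A *ᵥ v) * (x ⬝ᵥ A *ᵥ v) := by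
    rw [dotProduct_mulVec_secondPoint, hιd]
    simp [hev, hev', algebraMap_eq]
  refine ⟨fun i h ↦ ?_, ?_⟩
  -- At `v = b l` the form takes the value `-2 (b 0 · A b l) (b i · A b l)`, a product of nonzero
  -- polars if `l` differs from `0` and `i`.
  · have h2 (l : Fin 8) (hl : l ≠ 0) (hl' : l ≠ i) : False := by
      have h1 := hevξ (B l) (B i)
      rw [h, map_zero, hBA l, zero_mul, zero_sub, eq_comm, neg_eq_zero] at h1
      exact mul_ne_zero (mul_ne_zero two_ne_zero (hBAne hl.symm)) (hBAne hl'.symm) h1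
    by_cases hi : i = 1
    · exact h2 2 (by decide) (by rw [hi]; decide)
    · exact h2 1 (by decide) (Ne.symm hi)
  let p (i : Fin 7) : K := B 0 ⬝ᵥ A *ᵥ B i.succ
  have hp (i) : p i ≠ 0 := hBAne (Fin.succ_ne_zero i).symm
  have hs0 : s ≠ 0 := by
    rintro rfl
    refine mul_ne_zero (Finset.prod_ne_zero_iff.mpr fun i _ ↦ hp i) ha (hs.trans (by ring))
  set L : MvPolynomial (Fin 4) K := ι (B 0) ⬝ᵥ A' *ᵥ X with hL
  let D (i : Fin 7) : MvPolynomial (Fin 4) K := det4 X (ι (B 0)) (ι (B i.succ)) (ι k)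
  have hk' (s t) : algebraMap K (MvPolynomial (Fin 4) K) (k a) * A'.adjugate s t = ι k s * ι k t := by
    have h1 : A'.adjugate s t = algebraMap K (MvPolynomial (Fin 4) K) (A.adjugate s t) :=
      congrFun (congrFun ((algebraMap K (MvPolynomial (Fin 4) K)).map_adjugate A).symm s) t
    rw [h1, ← map_mul, hk, map_mul]
    rfl
  have hgram (i : Fin 7) : algebraMap K (MvPolynomial (Fin 4) K) (k a) * (algebraMap K (MvPolynomial (Fin 4) K) (p i) *
      (ι (B i.succ) ⬝ᵥ A' *ᵥ secondPoint A' (ι (B 0)) X)) = -D i ^ 2 := by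
    rw [← gram_det hA's (m := algebraMap K (MvPolynomial (Fin 4) K) (k a)) hk' X (ι (B 0)) (ι (B i.succ))
      (by rw [hιd, hBA, map_zero]) (by rw [hιd, hBA, map_zero]),
      dotProduct_mulVec_secondPoint, dotProduct_mulVec_comm hA's (ι (B i.succ)) (ι (B 0)), hιd]
  have h00 : ι (B 0) ⬝ᵥ A' *ᵥ secondPoint A' (ι (B 0)) X = -2 * L ^ 2 :=
    dotProduct_mulVec_secondPoint_self (by rw [hιd, hBA, map_zero]) X
  obtain ⟨δ, hδ⟩ := IsAlgClosed.exists_pow_nat_eq (2 : ℂ) two_pos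
  have hδ0 : algebraMap ℂ K δ ≠ 0 := by
    rw [Ne, FaithfulSMul.algebraMap_eq_zero_iff]
    rintro rfl
    norm_num at hδ
  have hδK : algebraMap ℂ K δ ^ 2 = 2 := by rw [← map_pow, hδ, map_ofNat]
  -- The Gram identities and `b 0 · ξ = -2 L²` require `γ² k a⁷ ∏ p i = 2`, and `k a⁷ ∏ p i = (k a³
  -- s)²`.
  set γ : K := algebraMap ℂ K δ / (k a ^ 3 * s) with hγ
  have hγ0 : γ ≠ 0 := div_ne_zero hδ0 (mul_ne_zero (pow_ne_zero _ ha) hs0)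
  have hγ2 : γ ^ 2 * (k a ^ 7 * ∏ i, p i) = 2 := by
    have : k a ^ 7 * ∏ i, p i = k a ^ 6 * s ^ 2 := by
      rw [← hs]
      ring
    rw [this, hγ, div_pow, hδK]
    field_simp
  have hprod : algebraMap K (MvPolynomial (Fin 4) K) (k a ^ 7 * ∏ i, p i) *
      ∏ i : Fin 7, ι (B i.succ) ⬝ᵥ A' *ᵥ secondPoint A' (ι (B 0)) X = -(∏ i, D i) ^ 2 := by
    have h : ∏ i : Fin 7, (algebraMap K (MvPolynomial (Fin 4) K) (k a) * (algebraMap K (MvPolynomial (Fin 4) K) (p i) *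
        (ι (B i.succ) ⬝ᵥ A' *ᵥ secondPoint A' (ι (B 0)) X))) = ∏ i, -D i ^ 2 :=
      Finset.prod_congr rfl fun i _ ↦ hgram i
    rw [Finset.prod_mul_distrib, Finset.prod_mul_distrib, Finset.prod_const, Finset.prod_neg,
      Finset.prod_pow, Finset.card_univ, Fintype.card_fin] at h
    rw [map_mul, map_pow, map_prod, mul_assoc, h]
    ring
  -- The linear form `det(y, b 0, b i, k)` vanishes on the kernel vector `k`, hence is `z · A y` for
  -- some `z`. At `y = σ(v)` it is then a linear form in `ξ`, equal to `-2 L D i`.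
  have hn (i : Fin 7) : ∃ z, ∀ y : Fin 4 → MvPolynomial (Fin 4) K, ι z ⬝ᵥ A' *ᵥ y =
      det4 y (ι (B 0)) (ι (B i.succ)) (ι k) := by
    let n : Fin 4 → K := fun j ↦ det4 (Pi.single j 1) (B 0) (B i.succ) k
    have hkn : k ⬝ᵥ n = 0 := by
      have := det4_eq_sum k (B 0) (B i.succ) k
      rw [det4, det_zero_of_row_eq (i := 0) (j := 3) (by simp) rfl] at this
      exact this.symm
    obtain ⟨z, hz⟩ := exists_mulVec_eq hAs hAk ha hk hkn
    refine ⟨z, fun y ↦ ?_⟩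
    have hn' : A' *ᵥ ι z = ι n := by
      rw [← hz]
      funext l
      exact (RingHom.map_mulVec (algebraMap K (MvPolynomial (Fin 4) K)) A z l).symm
    rw [dotProduct_mulVec_comm hA's, hn', det4_eq_sum]
    refine Finset.sum_congr rfl fun j _ ↦ ?_
    congr 1
    have hsingle : ι (Pi.single j 1) = Pi.single j 1 := by
      funext l
      rcases eq_or_ne l j with rfl | hl
      · simp [ι]
      · simp [ι, hl]
    rw [← hsingle]
    exact (map_det4 (algebraMap K _) _ _ _ _)
  choose z hz using hn
  -- The constant `16 / γ` balances `(-2)⁷ L⁷ ∏ D i` against `(-2 L²)³` times `γ L ∏ D i`.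
  refine ⟨algebraMap K (MvPolynomial (Fin 4) K) γ * L * ∏ i, D i, 16 / γ, z, ?_, div_ne_zero (by norm_num) hγ0, ?_⟩
  · rw [Fin.prod_univ_succ (fun x : Fin 8 ↦ ι (B x) ⬝ᵥ A' *ᵥ secondPoint A' (ι (B 0)) X), h00]
    have h2 : algebraMap K (MvPolynomial (Fin 4) K) γ ^ 2 *
        algebraMap K (MvPolynomial (Fin 4) K) (k a ^ 7 * ∏ i, p i) = 2 := by
      rw [← map_pow, ← map_mul, hγ2, map_ofNat]
    linear_combination algebraMap K (MvPolynomial (Fin 4) K) γ ^ 2 * L ^ 2 * hprod - L ^ 2 *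
      (∏ i : Fin 7, ι (B i.succ) ⬝ᵥ A' *ᵥ secondPoint A' (ι (B 0)) X) * h2
  · have h1 : ∏ i, ι (z i) ⬝ᵥ A' *ᵥ secondPoint A' (ι (B 0)) X = ∏ i, (-2 * L * D i) :=
      Finset.prod_congr rfl fun i _ ↦ by rw [hz, det4_secondPoint]
    have h3 : algebraMap K (MvPolynomial (Fin 4) K) (16 / γ) * algebraMap K (MvPolynomial (Fin 4) K) γ = 16 := by
      rw [← map_mul, div_mul_cancel₀ _ hγ0, map_ofNat]
    refine h1.trans ?_
    rw [Finset.prod_mul_distrib, Finset.prod_const, Finset.card_univ, Fintype.card_fin, h00]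
    linear_combination 8 * L ^ 7 * (∏ i, D i) * h3

theorem tangentPlane_complex (b : Fin 4 → ℂ) (t : Fin 3 → ℂ) (v : Fin 4 → ℂ) :
    tangentPlane Q b t v = member Q t *ᵥ secondPoint (member Q t) b v := by
  rw [tangentPlane, memberOver_complex]
  rfl

theorem exists_det4_ne_zero {b c d : Fin 4 → ℂ}
    (h : ∀ x y z : ℂ, x • b + y • c + z • d = 0 → x = 0 ∧ y = 0 ∧ z = 0) :
    ∃ v, det4 v b c d ≠ 0 := by
  have hli : LinearIndependent ℂ ![b, c, d] := by
    rw [Fintype.linearIndependent_iff]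
    intro g hg
    rw [Fin.sum_univ_three] at hg
    obtain ⟨h0, h1, h2⟩ := h _ _ _ hg
    intro i
    fin_cases i
    exacts [h0, h1, h2]
  obtain ⟨v, hv⟩ := exists_linearIndependent_cons_of_lt_finrank hli (by simp)
  refine ⟨v, ?_⟩
  have := linearIndependent_rows_iff_isUnit.mp
    (show LinearIndependent ℂ (Matrix.of ![v, b, c, d]).row from hv)
  rw [isUnit_iff_isUnit_det] at this
  exact this.ne_zero

/-- Every tangent plane of a singular member of the net at a smooth point arises by projection
from a given base point. -/
theorem exists_eq_smul_tangentPlane (hQ : IsRegularNet Q) {b : Fin 4 → ℂ} (hb : b ≠ 0)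
    (hbase : ∀ k, b ⬝ᵥ Q k *ᵥ b = 0) {t : Fin 3 → ℂ} (ht : t ≠ 0)
    (hdet : eval t (discriminant Q) = 0) {ξ : Fin 4 → ℂ} (hξ : ξ ∈ gamma Q t) :
    ∃ (v : Fin 4 → ℂ) (c : ℂ), c ≠ 0 ∧ ξ = c • tangentPlane Q b t v := by
  obtain ⟨y, hy, hMy, c, hc, rfl⟩ := hξ
  simp only [tangentPlane_complex]
  have hMb := member_mulVec_ne_zero hQ ht hb hbase
  have hMs := member_isSymm hQ t
  obtain ⟨a, k, ha, hMk, hk⟩ := exists_kernel_vector_of_adjugate_ne_zero hMs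
    ((det_member t).trans hdet) (adjugate_member_ne_zero hQ ht hdet)
  have hbb : b ⬝ᵥ member Q t *ᵥ b = 0 := by
    simp [member, sum_mulVec, dotProduct_sum, smul_mulVec, hbase]
  set M := member Q t
  have hk0 : k ≠ 0 := fun h ↦ ha (congrFun h a)
  by_cases hby : b ⬝ᵥ M *ᵥ y = 0
  -- If `y` is polar to `b`, it lies on the ruling through `b`: otherwise `b, y, k` would be
  -- independent, while the Gram identity makes every determinant `det(v, b, y, k)` vanish. The
  -- plane is then the tangent plane at `b`.
  · obtain ⟨x, hx, hxy⟩ : ∃ x : ℂ, x ≠ 0 ∧ M *ᵥ y = x • M *ᵥ b := by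
      by_contra! h
      obtain ⟨v, hv⟩ := exists_det4_ne_zero (b := b) (c := y) (d := k) fun x1 x2 x3 h0 ↦ by
        have h1 := congrArg (M *ᵥ ·) h0
        simp only [mulVec_add, mulVec_smul, hMk, smul_zero, add_zero, mulVec_zero] at h1
        have hx2 : x2 = 0 := by
          by_contra hx2
          have h2 : M *ᵥ y = (-x1 / x2) • M *ᵥ b := by
            have h3 : x2 • M *ᵥ y = -x1 • M *ᵥ b := by
              rw [neg_smul]
              exact eq_neg_of_add_eq_zero_right h1
            rw [div_eq_inv_mul, mul_smul, ← h3, smul_smul, inv_mul_cancel₀ hx2, one_smul]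
          by_cases hx1 : -x1 / x2 = 0
          · rw [hx1, zero_smul] at h2
            exact hMy h2
          · exact h _ hx1 h2
        have hx1 : x1 = 0 := by
          rw [hx2, zero_smul, add_zero] at h1
          exact (smul_eq_zero.mp h1).resolve_right hMb
        rw [hx1, hx2, zero_smul, zero_smul, zero_add, zero_add] at h0
        exact ⟨hx1, hx2, (smul_eq_zero.mp h0).resolve_right hk0⟩
      have := gram_det hMs hk v b y hbb hy
      rw [hby] at this
      exact hv (by simpa using this.symm)
    obtain ⟨u, hu⟩ : ∃ u, b ⬝ᵥ M *ᵥ u ≠ 0 := by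
      by_contra! h
      refine hMb (funext fun i ↦ ?_)
      have := h (Pi.single i 1)
      rw [dotProduct_mulVec_comm hMs, single_dotProduct, one_mul] at this
      exact this
    -- A second isotropic vector `d`, not polar to `b`. A vector `w` polar to `b` with `w · M w ≠ 0`
    -- is then obtained by subtracting a multiple of `d` from `v`; its second point is a nonzero
    -- multiple of `b`.
    set d := u - (u ⬝ᵥ M *ᵥ u / (2 * (b ⬝ᵥ M *ᵥ u))) • b with hd
    have hbd : b ⬝ᵥ M *ᵥ d = b ⬝ᵥ M *ᵥ u := by
      rw [hd, mulVec_sub, dotProduct_sub, mulVec_smul, dotProduct_smul, hbb, smul_zero, sub_zero]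
    have hdd : d ⬝ᵥ M *ᵥ d = 0 := by
      nth_rw 1 [hd]
      rw [sub_dotProduct, smul_dotProduct, hbd, dotProduct_mulVec_comm hMs, hd, sub_dotProduct,
        smul_dotProduct]
      simp only [smul_eq_mul]
      field_simp
      ring
    obtain ⟨v, hv⟩ := exists_det4_ne_zero (b := b) (c := d) (d := k) fun x1 x2 x3 h0 ↦ by
      have h1 := congrArg (M *ᵥ ·) h0
      simp only [mulVec_add, mulVec_smul, hMk, smul_zero, add_zero, mulVec_zero] at h1
      have h2 := congrArg (b ⬝ᵥ ·) h1
      simp only [dotProduct_add, dotProduct_smul, hbb, mul_zero, zero_add, dotProduct_zero,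
        hbd, smul_eq_mul] at h2
      have hx2 := (mul_eq_zero.mp h2).resolve_right hu
      have hx1 : x1 = 0 := by
        rw [hx2, zero_smul, add_zero] at h1
        exact (smul_eq_zero.mp h1).resolve_right hMb
      rw [hx1, hx2, zero_smul, zero_smul, zero_add, zero_add] at h0
      exact ⟨hx1, hx2, (smul_eq_zero.mp h0).resolve_right hk0⟩
    have hg := gram_det hMs hk v b d hbb hdd
    set e := b ⬝ᵥ M *ᵥ d with he
    have he0 : e ≠ 0 := by rwa [hbd]
    set w := v - (b ⬝ᵥ M *ᵥ v / e) • d with hw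
    have hbw : b ⬝ᵥ M *ᵥ w = 0 := by
      rw [hw, mulVec_sub, dotProduct_sub, mulVec_smul, dotProduct_smul, ← he, smul_eq_mul,
        div_mul_cancel₀ _ he0, sub_self]
    have hww : e * (w ⬝ᵥ M *ᵥ w) =
        (v ⬝ᵥ M *ᵥ v) * e - 2 * (b ⬝ᵥ M *ᵥ v) * (d ⬝ᵥ M *ᵥ v) := by
      simp only [hw, mulVec_sub, dotProduct_sub, mulVec_smul, dotProduct_smul, sub_dotProduct,
        smul_dotProduct, hdd, dotProduct_mulVec_comm hMs v d, smul_eq_mul]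
      field_simp
      ring
    have hww0 : w ⬝ᵥ M *ᵥ w ≠ 0 := by
      intro h
      rw [← hww, h] at hg
      exact hv (by simpa using hg.symm)
    refine ⟨w, c * x / (w ⬝ᵥ M *ᵥ w), div_ne_zero (mul_ne_zero hc hx) hww0, ?_⟩
    rw [secondPoint, hbw, mul_zero, zero_smul, sub_zero, mulVec_smul, smul_smul,
      div_mul_cancel₀ _ hww0, mul_smul, hxy]
  -- Off the tangent plane at `b`, the point `y` is already the second intersection of its own line
  -- through `b`, up to this scalar.
  · refine ⟨y, c / (-2 * (b ⬝ᵥ M *ᵥ y)), div_ne_zero hc (mul_ne_zero (by norm_num) hby), ?_⟩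
    rw [secondPoint, hy, zero_smul, zero_sub, mulVec_neg, mulVec_smul, ← neg_smul, smul_smul,
      ← neg_mul, div_mul_cancel₀ _ (mul_ne_zero (by norm_num) hby)]

end Conic

namespace CurveFunctionField

/-! ### Integral closedness of the charts of the curve inside `K(v)`. -/

section IntegralClosure

variable {f : MvPolynomial (Fin 3) ℂ} {n : ℕ} {K : Type} [Field K] [Algebra ℂ K]
  (F : CurveFunctionField f K)

theorem exists_mul_chartRing (h : f.IsHomogeneous n) (hn : 1 < n) (i : Fin 3) (x : K) :
    ∃ a c : F.chartRing i, c ≠ 0 ∧ x * c = a := by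
  obtain ⟨a, c, hc, hac⟩ := F.exists_mul_chartMap i x
  exact ⟨⟨_, (F.range_chartMap h hn i _).mp ⟨a, rfl⟩⟩, ⟨_, (F.range_chartMap h hn i _).mp ⟨c, rfl⟩⟩,
    fun h0 ↦ hc (congrArg Subtype.val h0), hac⟩

theorem isFractionRing_chartRing (h : f.IsHomogeneous n) (hn : 1 < n) (i : Fin 3) :
    IsFractionRing (F.chartRing i) K := by
  refine IsFractionRing.of_field _ _ fun x ↦ ?_
  obtain ⟨a, c, hc, hac⟩ := F.exists_mul_chartRing h hn i x
  have hc' : (c : K) ≠ 0 := fun h0 ↦ hc (Subtype.ext h0)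
  exact ⟨a, c, (eq_div_iff hc').mpr hac⟩

theorem mem_chartRing_of_isIntegral (h : f.IsHomogeneous n) (hn : 1 < n)
    (hf : ∀ t : Fin 3 → ℂ, t ≠ 0 → eval t f = 0 → ∃ k, eval t (pderiv k f) ≠ 0) (i : Fin 3) {x : K}
    (hx : IsIntegral (F.chartRing i) x) : x ∈ F.chartRing i := by
  have := F.isIntegrallyClosed_chartRing h hn hf i
  have := F.isFractionRing_chartRing h hn i
  obtain ⟨y, rfl⟩ := IsIntegrallyClosed.isIntegral_iff.mp hx
  exact y.2

/-- An element of `K(v)` integral over the chart is integral over `K`, hence lies in the normal ring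
`K[v]`. There it is zero or a unit, so a constant, and normality of the chart concludes. -/
theorem exists_chartMap_eq_of_isIntegralElem (h : f.IsHomogeneous n) (hn : 1 < n)
    (hf : ∀ t : Fin 3 → ℂ, t ≠ 0 → eval t f = 0 → ∃ k, eval t (pderiv k f) ≠ 0) (i : Fin 3)
    {x : FractionRing (MvPolynomial (Fin 4) K)}
    (hx : ((algebraMap K (FractionRing (MvPolynomial (Fin 4) K))).comp
      (F.chartMap i).hom).IsIntegralElem x) :
    x ∈ ((algebraMap K (FractionRing (MvPolynomial (Fin 4) K))).comp (F.chartMap i).hom).range := by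
  obtain ⟨p, hp, hpx⟩ := hx
  have hxK : IsIntegral K x := ⟨p.map (F.chartMap i).hom, hp.map _, by
    rw [Polynomial.eval₂_map]
    exact hpx⟩
  obtain ⟨q, rfl⟩ := IsIntegrallyClosed.isIntegral_iff.mp
    (hxK.tower_top (A := MvPolynomial (Fin 4) K))
  have hqK : IsIntegral K q :=
    (isIntegral_algebraMap_iff (IsFractionRing.injective (MvPolynomial (Fin 4) K) _)).mp hxK
  obtain ⟨c, rfl⟩ : ∃ c, q = C c := by
    by_cases hq : q = 0
    · exact ⟨0, by rw [hq, C_0]⟩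
    · obtain ⟨c, -, hc⟩ := isUnit_iff_eq_C_of_isReduced.mp (hqK.isUnit hq)
      exact ⟨c, hc⟩
  have hCc : algebraMap (MvPolynomial (Fin 4) K) (FractionRing (MvPolynomial (Fin 4) K)) (C c) =
      algebraMap K _ c :=
    (IsScalarTower.algebraMap_apply K (MvPolynomial (Fin 4) K) _ c).symm
  rw [hCc] at hpx ⊢
  rw [← Polynomial.hom_eval₂, map_eq_zero] at hpx
  have hc : c ∈ F.chartRing i := by
    refine F.mem_chartRing_of_isIntegral h hn hf i ?_
    let g : Γ(WProj.hypersurface planeWeight f, curveChart f i) →+* F.chartRing i :=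
      (F.chartMap i).hom.codRestrict (F.chartRing i).toSubring
        fun y ↦ (F.range_chartMap h hn i _).mp ⟨y, rfl⟩
    refine ⟨p.map g, hp.map _, ?_⟩
    rw [Polynomial.eval₂_map]
    exact hpx
  obtain ⟨y, hy⟩ := (F.range_chartMap h hn i c).mpr hc
  exact ⟨y, by rw [RingHom.comp_apply, hy]⟩

/-- The inclusion of polynomial rings given by the inclusion of an affine coordinate ring of the
curve in its function field. -/
def polyMap (i : Fin 3) : MvPolynomial (Fin 4) (F.chartRing i) →ₐ[ℂ] MvPolynomial (Fin 4) K :=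
  mapAlgHom (F.chartRing i).val

theorem polyMap_injective (i : Fin 3) : Function.Injective (F.polyMap i) :=
  map_injective _ Subtype.val_injective

-- A polynomial integral over a polynomial ring has coefficients integral over the coefficient ring.
-- The square root therefore extends over the whole affine chart of `C`, not only over its generic
-- point.
attribute [local instance] MvPolynomial.algebraMvPolynomial in
theorem exists_polyMap_eq (h : f.IsHomogeneous n) (hn : 1 < n)
    (hf : ∀ t : Fin 3 → ℂ, t ≠ 0 → eval t f = 0 → ∃ k, eval t (pderiv k f) ≠ 0) (i : Fin 3)
    {r : MvPolynomial (Fin 4) K} {s : MvPolynomial (Fin 4) (F.chartRing i)}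
    (hr : r ^ 2 = F.polyMap i s) : ∃ ρ, F.polyMap i ρ = r ∧ ρ ^ 2 = s := by
  have hint : IsIntegral (MvPolynomial (Fin 4) (F.chartRing i)) r :=
    IsIntegral.of_pow two_pos (hr ▸ isIntegral_algebraMap)
  have hcoeff := MvPolynomial.isIntegral_iff_isIntegral_coeff.mp hint
  obtain ⟨ρ, hρ⟩ : r ∈ RingHom.range (MvPolynomial.map (F.chartRing i).val.toRingHom) := by
    refine MvPolynomial.mem_range_map_iff_coeffs_subset.mpr fun x hx ↦ ?_
    obtain ⟨m, hm, rfl⟩ := MvPolynomial.mem_coeffs_iff.mp hx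
    exact ⟨⟨_, F.mem_chartRing_of_isIntegral h hn hf i (hcoeff m)⟩, rfl⟩
  have hρ' : F.polyMap i ρ = r := hρ
  refine ⟨ρ, hρ', F.polyMap_injective i ?_⟩
  rw [map_pow, hρ', hr]

theorem polyMap_algebraMap (i : Fin 3) (x : F.chartRing i) :
    F.polyMap i (algebraMap _ _ x) = algebraMap K _ (x : K) :=
  map_C _ _

end IntegralClosure

section Octad

open Matrix

variable {Q : Fin 3 → Matrix (Fin 4) (Fin 4) ℂ} {b : Fin 8 → Fin 4 → ℂ} {K : Type} [Field K]
  [Algebra ℂ K] (F : CurveFunctionField (discriminant Q) K)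

theorem polyMap_tangentPlane (i : Fin 3) (b : Fin 4 → ℂ) :
    F.polyMap i ∘ tangentPlane Q b (algebraMap _ _ ∘ F.chartCoord i) X =
      algebraMap K (MvPolynomial (Fin 4) K) (F.coord i)⁻¹ ^ 2 •
        tangentPlane Q b (algebraMap K _ ∘ F.coord) X := by
  rw [map_tangentPlane, ← tangentPlane_smul]
  congr 1
  · funext j
    simp only [Function.comp_apply, polyMap_algebraMap, Pi.smul_apply, smul_eq_mul]
    rw [← map_mul, mul_comm, ← div_eq_mul_inv]
    rfl
  · funext j
    exact map_X _ _

/-- The generic tangent plane is quadratic in the parameters of the net, so each of the eight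
factors scales by `(F.coord i)⁻¹ ^ 2` on passing to the chart, and the root of the product by the
eighth power. -/
theorem exists_chart_root (hQ : IsRegularNet Q) (i : Fin 3) {r : MvPolynomial (Fin 4) K}
    (hr : r ^ 2 = ∏ l, (algebraMap ℂ _ ∘ b l) ⬝ᵥ
      tangentPlane Q (b 0) (algebraMap K (MvPolynomial (Fin 4) K) ∘ F.coord) X) :
    ∃ ρ : MvPolynomial (Fin 4) (F.chartRing i),
      F.polyMap i ρ = algebraMap K (MvPolynomial (Fin 4) K) (F.coord i)⁻¹ ^ 8 * r ∧
      ρ ^ 2 = ∏ l, (algebraMap ℂ _ ∘ b l) ⬝ᵥ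
        tangentPlane Q (b 0) (algebraMap _ _ ∘ F.chartCoord i) X := by
  refine F.exists_polyMap_eq isHomogeneous_discriminant (by norm_num) hQ.smooth i ?_
  have h (l : Fin 8) : F.polyMap i ((algebraMap ℂ _ ∘ b l) ⬝ᵥ
      tangentPlane Q (b 0) (algebraMap _ _ ∘ F.chartCoord i) X) =
      algebraMap K (MvPolynomial (Fin 4) K) (F.coord i)⁻¹ ^ 2 * ((algebraMap ℂ _ ∘ b l) ⬝ᵥ
        tangentPlane Q (b 0) (algebraMap K (MvPolynomial (Fin 4) K) ∘ F.coord) X) := by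
    rw [← smul_eq_mul, ← dotProduct_smul, ← polyMap_tangentPlane]
    refine (RingHom.map_dotProduct (F.polyMap i).toRingHom _ _).trans ?_
    congr 1
    funext j
    exact (F.polyMap i).commutes _
  rw [map_prod]
  simp only [h]
  rw [Finset.prod_mul_distrib, Finset.prod_const, mul_pow, hr]
  simp only [Finset.card_univ, Fintype.card_fin]
  ring

end Octad

end CurveFunctionField

/-! ### Points of `C × X` with values in a ring, given by pairs of homogeneous coordinates. -/

section Ambient

variable {Q : Fin 3 → Matrix (Fin 4) (Fin 4) ℂ} {b : Fin 8 → Fin 4 → ℂ}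
  {R S : Type} [CommRing R] [Algebra ℂ R] [CommRing S] [Algebra ℂ S]

/-- The `R`-valued point `g` of `C × X` has the homogeneous coordinates `t` and `u`. -/
def IsCoordMor (g : Spec (.of R) ⟶ ambient Q b) (t : Fin 3 → R) (u : Option (Fin 4) → R) : Prop :=
  ∃ (i : Fin 3) (j : Fin 4) (ht : IsUnit (t i)) (hu : IsUnit (u (some j))),
    (g ≫ pullback.fst (curveToSpec Q) (threefoldToSpec b)) ≫
      WProj.hypersurfaceι planeWeight (discriminant Q) =
      coordMor (X i) (X_mem (w := planeWeight) rfl) one_pos t (isUnit_aeval_X ht) ∧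
    (g ≫ pullback.snd (curveToSpec Q) (threefoldToSpec b)) ≫
      WProj.hypersurfaceι coverWeight (coverEquation b) =
      coordMor (X (some j)) (X_mem (w := coverWeight) rfl) one_pos u (isUnit_aeval_X hu)

theorem coverEquation_mem (b : Fin 8 → Fin 4 → ℂ) :
    coverEquation b ∈ weightedHomogeneousSubmodule ℂ coverWeight 8 := by
  rw [mem_weightedHomogeneousSubmodule]
  have h1 : IsWeightedHomogeneous coverWeight
      (∏ i, ∑ j, C (b i j) * X (some j) : MvPolynomial (Option (Fin 4)) ℂ) (∑ i : Fin 8, 1) := by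
    refine IsWeightedHomogeneous.prod _ _ _ fun i _ ↦ ?_
    refine IsWeightedHomogeneous.sum _ _ _ fun j _ ↦ ?_
    have := (isWeightedHomogeneous_C coverWeight (b i j)).mul
      (isWeightedHomogeneous_X ℂ coverWeight (some j))
    simpa using this
  have h2 : IsWeightedHomogeneous coverWeight
      (X none ^ 2 : MvPolynomial (Option (Fin 4)) ℂ) (2 • 4) :=
    (isWeightedHomogeneous_X ℂ coverWeight none).pow 2
  exact (weightedHomogeneousSubmodule ℂ coverWeight 8).sub_mem h2 h1

theorem aeval_coverEquation (u : Option (Fin 4) → R) :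
    aeval u (coverEquation b) =
      u none ^ 2 - ∏ i, (algebraMap ℂ R ∘ b i) ⬝ᵥ (fun j ↦ u (some j)) := by
  simp [coverEquation, dotProduct]

theorem exists_lift_hypersurface {σ : Type} {w : σ → ℕ} [IsReduced R] {p : MvPolynomial σ ℂ} {n : ℕ}
    (hp : p ∈ weightedHomogeneousSubmodule ℂ w n) {i : σ} (hi : w i = 1) {v : σ → R}
    (hv : IsUnit (v i)) (hpv : aeval v p = 0) :
    ∃ g : Spec (.of R) ⟶ WProj.hypersurface w p, g ≫ WProj.hypersurfaceι w p =
      coordMor (X i) (X_mem hi) one_pos v (isUnit_aeval_X hv) := by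
  refine exists_lift_reducedSubscheme _ _ fun x ↦ ?_
  exact Set.singleton_subset_iff.mpr
    ((mem_coordMor_iff (X_mem hi) one_pos v (isUnit_aeval_X hv) x hp).mpr (hpv ▸ zero_mem _))

theorem exists_isCoordMor [IsReduced R] {t : Fin 3 → R} {u : Option (Fin 4) → R} {i : Fin 3}
    {j : Fin 4} (ht : IsUnit (t i)) (hu : IsUnit (u (some j)))
    (htQ : aeval t (discriminant Q) = 0) (hub : aeval u (coverEquation b) = 0) :
    ∃ g : Spec (.of R) ⟶ ambient Q b, IsCoordMor g t u := by
  obtain ⟨g₁, hg₁⟩ := exists_lift_hypersurface (w := planeWeight)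
    (mem_planeWeight.mpr isHomogeneous_discriminant) rfl ht htQ
  obtain ⟨g₂, hg₂⟩ := exists_lift_hypersurface (coverEquation_mem b) (i := some j) rfl hu hub
  have h : g₁ ≫ curveToSpec Q = g₂ ≫ threefoldToSpec b := by
    rw [← Category.assoc, ← Category.assoc, hg₁, hg₂, coordMor_toSpec, coordMor_toSpec]
  refine ⟨pullback.lift g₁ g₂ h, i, j, ht, hu, ?_, ?_⟩
  · rw [← hg₁]
    congr 1
    exact pullback.lift_fst _ _ _
  · rw [← hg₂]
    congr 1
    exact pullback.lift_snd _ _ _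

namespace IsCoordMor

variable {g g' : Spec (.of R) ⟶ ambient Q b} {t t' : Fin 3 → R} {u u' : Option (Fin 4) → R}

theorem fst_eq (hg : IsCoordMor g t u) {i : Fin 3} (hi : IsUnit (t i)) :
    (g ≫ pullback.fst (curveToSpec Q) (threefoldToSpec b)) ≫
      WProj.hypersurfaceι planeWeight (discriminant Q) =
      coordMor (X i) (X_mem (w := planeWeight) rfl) one_pos t (isUnit_aeval_X hi) := by
  obtain ⟨k, j, hk, hj, h, -⟩ := hg
  rw [h]
  exact coordMor_eq _ _ _ _ _ _ _

theorem snd_eq (hg : IsCoordMor g t u) {j : Fin 4} (hj : IsUnit (u (some j))) :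
    (g ≫ pullback.snd (curveToSpec Q) (threefoldToSpec b)) ≫
      WProj.hypersurfaceι coverWeight (coverEquation b) =
      coordMor (X (some j)) (X_mem (w := coverWeight) rfl) one_pos u (isUnit_aeval_X hj) := by
  obtain ⟨k, l, hk, hl, -, h⟩ := hg
  rw [h]
  exact coordMor_eq _ _ _ _ _ _ _

theorem unique (hg : IsCoordMor g t u) (hg' : IsCoordMor g' t u) : g = g' := by
  obtain ⟨i, j, hi, hj, h1, h2⟩ := hg
  refine pullback.hom_ext ?_ ?_
  · rw [← cancel_mono (WProj.hypersurfaceι planeWeight (discriminant Q)), h1, hg'.fst_eq hi]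
  · rw [← cancel_mono (WProj.hypersurfaceι coverWeight (coverEquation b)), h2, hg'.snd_eq hj]

theorem comp (hg : IsCoordMor g t u) (φ : R →ₐ[ℂ] S) :
    IsCoordMor (Spec.map (CommRingCat.ofHom φ.toRingHom) ≫ g) (φ ∘ t) (φ ∘ u) := by
  obtain ⟨i, j, hi, hj, h1, h2⟩ := hg
  refine ⟨i, j, hi.map φ, hj.map φ, ?_, ?_⟩
  · rw [Category.assoc, Category.assoc, ← Category.assoc g, h1, specMap_coordMor]
  · rw [Category.assoc, Category.assoc, ← Category.assoc g, h2, specMap_coordMor]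

theorem smul (hg : IsCoordMor g t u) {x y : R} (hx : IsUnit x) (hy : IsUnit y)
    (ht : ∀ k, t' k = x * t k) (hu : ∀ o, u' o = y ^ coverWeight o * u o) :
    IsCoordMor g t' u' := by
  obtain ⟨i, j, hi, hj, h1, h2⟩ := hg
  refine ⟨i, j, ht i ▸ hx.mul hi, hu (some j) ▸ (hy.pow _).mul hj, ?_, ?_⟩
  · rw [h1]
    exact coordMor_smul _ _ _ _ _ _ x fun k ↦ by rw [ht, pow_one]
  · rw [h2]
    exact coordMor_smul _ _ _ _ _ _ y hu

theorem fst_injective (hg : IsCoordMor g t u) (hg' : IsCoordMor g t' u') {i : Fin 3} (hi : t i = 1)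
    (hi' : t' i = 1) : t = t' := by
  refine coordMor_injective i (w := planeWeight) rfl hi hi' ?_
  rw [← hg.fst_eq (hi ▸ isUnit_one), ← hg'.fst_eq (hi' ▸ isUnit_one)]

theorem snd_injective (hg : IsCoordMor g t u) (hg' : IsCoordMor g t' u') {j : Fin 4}
    (hj : u (some j) = 1) (hj' : u' (some j) = 1) : u = u' := by
  refine coordMor_injective (some j) (w := coverWeight) rfl hj hj' ?_
  rw [← hg.snd_eq (hj ▸ isUnit_one), ← hg'.snd_eq (hj' ▸ isUnit_one)]

theorem mem_fst_iff (hg : IsCoordMor g t u) (x : Spec (.of R)) {n : ℕ} {p : MvPolynomial (Fin 3) ℂ}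
    (hp : p.IsHomogeneous n) :
    p ∈ ProjectiveSpectrum.asHomogeneousIdeal (𝒜 := weightedHomogeneousSubmodule ℂ planeWeight)
      (WProj.hypersurfaceι planeWeight (discriminant Q)
        (pullback.fst (curveToSpec Q) (threefoldToSpec b) (g x))) ↔
      aeval t p ∈ PrimeSpectrum.asIdeal x := by
  obtain ⟨i, j, hi, hj, h1, h2⟩ := hg
  rw [← mem_coordMor_iff (X_mem (w := planeWeight) rfl) one_pos t (isUnit_aeval_X hi) x
    (mem_planeWeight.mpr hp), ← h1]
  rfl

theorem mem_snd_iff (hg : IsCoordMor g t u) (x : Spec (.of R)) {n : ℕ}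
    {p : MvPolynomial (Option (Fin 4)) ℂ}
    (hp : p ∈ weightedHomogeneousSubmodule ℂ coverWeight n) :
    p ∈ ProjectiveSpectrum.asHomogeneousIdeal (𝒜 := weightedHomogeneousSubmodule ℂ coverWeight)
      (WProj.hypersurfaceι coverWeight (coverEquation b)
        (pullback.snd (curveToSpec Q) (threefoldToSpec b) (g x))) ↔
      aeval u p ∈ PrimeSpectrum.asIdeal x := by
  obtain ⟨i, j, hi, hj, h1, h2⟩ := hg
  rw [← mem_coordMor_iff (X_mem (w := coverWeight) rfl) one_pos u (isUnit_aeval_X hj) x hp, ← h2]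
  rfl

theorem comp_toSpec (hg : IsCoordMor g t u) :
    g ≫ pullback.fst (curveToSpec Q) (threefoldToSpec b) ≫ curveToSpec Q =
      Spec.map (CommRingCat.ofHom (algebraMap ℂ R)) := by
  obtain ⟨i, j, hi, hj, h1, h2⟩ := hg
  rw [← coordMor_toSpec (X_mem (w := planeWeight) rfl) one_pos t (isUnit_aeval_X hi), ← h1]
  simp only [Category.assoc]

end IsCoordMor

/-- A point with values in a local ring is given by normalized coordinates. -/
theorem exists_isCoordMor_of_mem {g : Spec (.of R) ⟶ ambient Q b}
    (hg : g ≫ pullback.fst (curveToSpec Q) (threefoldToSpec b) ≫ curveToSpec Q =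
      Spec.map (CommRingCat.ofHom (algebraMap ℂ R))) (i : Fin 3) (j : Fin 4)
    (hi : ∀ x, (X i : MvPolynomial (Fin 3) ℂ) ∉
      ProjectiveSpectrum.asHomogeneousIdeal (𝒜 := weightedHomogeneousSubmodule ℂ planeWeight)
      (WProj.hypersurfaceι planeWeight (discriminant Q)
        (pullback.fst (curveToSpec Q) (threefoldToSpec b) (g x))))
    (hj : ∀ x, (X (some j) : MvPolynomial (Option (Fin 4)) ℂ) ∉
      ProjectiveSpectrum.asHomogeneousIdeal (𝒜 := weightedHomogeneousSubmodule ℂ coverWeight)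
      (WProj.hypersurfaceι coverWeight (coverEquation b)
        (pullback.snd (curveToSpec Q) (threefoldToSpec b) (g x)))) :
    ∃ t u, t i = 1 ∧ u (some j) = 1 ∧ IsCoordMor g t u := by
  obtain ⟨t, ht, h1⟩ := exists_eq_coordMor (w := planeWeight) i rfl
    ((g ≫ pullback.fst (curveToSpec Q) (threefoldToSpec b)) ≫
      WProj.hypersurfaceι planeWeight (discriminant Q))
    (by rw [← hg]; simp only [Category.assoc]) hi
  obtain ⟨u, hu, h2⟩ := exists_eq_coordMor (w := coverWeight) (some j) rfl
    ((g ≫ pullback.snd (curveToSpec Q) (threefoldToSpec b)) ≫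
      WProj.hypersurfaceι coverWeight (coverEquation b))
    (by rw [← hg, pullback.condition]; simp only [Category.assoc]) hj
  exact ⟨t, u, ht, hu, i, j, ht ▸ isUnit_one, hu ▸ isUnit_one, h1, h2⟩

end Ambient

/-! ### Complex points of `C × X`. -/

section ComplexPoints

variable {Q : Fin 3 → Matrix (Fin 4) (Fin 4) ℂ} {b : Fin 8 → Fin 4 → ℂ}

theorem mem_asIdeal_of_field {K : Type} [Field K] (x : PrimeSpectrum K) (y : K) :
    y ∈ x.asIdeal ↔ y = 0 := by
  rw [Ideal.eq_bot_of_prime x.asIdeal, Ideal.mem_bot]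

theorem IsCoordMor.hasCoords {g : Spec (.of ℂ) ⟶ ambient Q b} {t : Fin 3 → ℂ}
    {u : Option (Fin 4) → ℂ} (hg : IsCoordMor g t u) (x : Spec (.of ℂ)) :
    WProj.HasCoords planeWeight (WProj.hypersurfaceι planeWeight (discriminant Q)
      (pullback.fst (curveToSpec Q) (threefoldToSpec b) (g x))) t ∧
    WProj.HasCoords coverWeight (WProj.hypersurfaceι coverWeight (coverEquation b)
      (pullback.snd (curveToSpec Q) (threefoldToSpec b) (g x))) u := by
  refine ⟨⟨?_, fun n p hp ↦ ?_⟩, ?_, fun n p hp ↦ ?_⟩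
  · obtain ⟨i, -, hi, -⟩ := hg
    rintro rfl
    exact hi.ne_zero rfl
  · exact (hg.mem_fst_iff x (mem_planeWeight.mp hp)).trans (mem_asIdeal_of_field x _)
  · obtain ⟨-, j, -, hj, -⟩ := hg
    rintro rfl
    exact hj.ne_zero rfl
  · exact (hg.mem_snd_iff x hp).trans (mem_asIdeal_of_field x _)

theorem eval_eq_zero_of_hasCoords {σ : Type} {w : σ → ℕ} {p : MvPolynomial σ ℂ} {n : ℕ}
    (hp : p ∈ weightedHomogeneousSubmodule ℂ w n) {x : WProj.hypersurface w p} {v : σ → ℂ}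
    (hx : WProj.HasCoords w (WProj.hypersurfaceι w p x) v) : eval v p = 0 := by
  rw [← hx.2 n p hp]
  have h : WProj.hypersurfaceι w p x ∈ (WProj.zeros w p : Set (WProj w)) := by
    rw [← range_reducedSubschemeι]
    exact ⟨x, rfl⟩
  exact Set.singleton_subset_iff.mp h

/-- A point with complex coordinates is a complex point. -/
theorem exists_isCoordMor_of_hasCoords {z : ambient Q b} {t : Fin 3 → ℂ} {u : Option (Fin 4) → ℂ}
    (ht : WProj.HasCoords planeWeight (WProj.hypersurfaceι planeWeight (discriminant Q)
      (pullback.fst (curveToSpec Q) (threefoldToSpec b) z)) t)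
    (hu : WProj.HasCoords coverWeight (WProj.hypersurfaceι coverWeight (coverEquation b)
      (pullback.snd (curveToSpec Q) (threefoldToSpec b) z)) u)
    {i : Fin 3} {j : Fin 4} (hi : t i ≠ 0) (hj : u (some j) ≠ 0) :
    ∃ g : Spec (.of ℂ) ⟶ ambient Q b, IsCoordMor g t u ∧ ∀ x, g x = z := by
  obtain ⟨g, hg⟩ := exists_isCoordMor (Q := Q) (b := b) hi.isUnit hj.isUnit
    (eval_eq_zero_of_hasCoords (mem_planeWeight.mpr isHomogeneous_discriminant) ht)
    (eval_eq_zero_of_hasCoords (coverEquation_mem b) hu)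
  refine ⟨g, hg, fun x ↦ ?_⟩
  let κ : Type := (ambient Q b).residueField z
  let G : Spec (.of κ) ⟶ ambient Q b := (ambient Q b).fromSpecResidueField z
  let a : .of ℂ ⟶ CommRingCat.of κ := Spec.preimage
    (G ≫ pullback.fst (curveToSpec Q) (threefoldToSpec b) ≫ curveToSpec Q)
  let : Algebra ℂ κ := a.hom.toAlgebra
  have hG (y) : G y = z := Scheme.fromSpecResidueField_apply z y
  obtain ⟨t', u', hti, huj, hG'⟩ := exists_isCoordMor_of_mem (R := κ) (g := G)
    (Spec.map_preimage _).symm i j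
    (fun y ↦ by
      rw [hG, ht.2 1 _ (X_mem (w := planeWeight) rfl), eval_X]
      exact hi)
    (fun y ↦ by
      rw [hG, hu.2 1 _ (X_mem (w := coverWeight) rfl), eval_X]
      exact hj)
  let y : Spec (.of κ) := IsLocalRing.closedPoint κ
  -- The forms `X k - (t k / t i) X i` vanish at `z`, so the normalized coordinates over the residue
  -- field of `z` are complex constants. The point `z` thus factors through the complex point `g`.
  have htk (k) : t' k = algebraMap ℂ κ (t k / t i) := by
    have hp : (X k - C (t k / t i) * X i : MvPolynomial (Fin 3) ℂ).IsHomogeneous 1 := by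
      refine (isHomogeneous_X _ _).sub ?_
      simpa using (isHomogeneous_C (Fin 3) (t k / t i)).mul (isHomogeneous_X ℂ i)
    have h := (hG'.mem_fst_iff y hp).trans (mem_asIdeal_of_field y _)
    rw [hG, ht.2 1 _ (mem_planeWeight.mpr hp)] at h
    have h1 := h.mp (by simp [hi])
    simpa [hti, sub_eq_zero] using h1
  have huo (o) : u' o = algebraMap ℂ κ (u o / u (some j) ^ coverWeight o) := by
    have hp : (X o - C (u o / u (some j) ^ coverWeight o) * X (some j) ^ coverWeight o :
        MvPolynomial (Option (Fin 4)) ℂ) ∈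
        weightedHomogeneousSubmodule ℂ coverWeight (coverWeight o) := by
      refine (weightedHomogeneousSubmodule ℂ coverWeight _).sub_mem
        (isWeightedHomogeneous_X _ _ _) ?_
      have := (isWeightedHomogeneous_C coverWeight (u o / u (some j) ^ coverWeight o)).mul
        ((isWeightedHomogeneous_X ℂ coverWeight (some j)).pow (coverWeight o))
      simpa using this
    have h := (hG'.mem_snd_iff y hp).trans (mem_asIdeal_of_field y _)
    rw [hG, hu.2 _ _ hp] at h
    have h1 := h.mp (by simp [hj])
    simpa [huj, sub_eq_zero] using h1
  have h1 := hg.comp (Algebra.ofId ℂ κ)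
  have h2 := h1.smul (x := algebraMap ℂ κ (t i)⁻¹) (y := algebraMap ℂ κ (u (some j))⁻¹)
    (t' := t') (u' := u')
    ((isUnit_iff_ne_zero.mpr (inv_ne_zero hi)).map _)
    ((isUnit_iff_ne_zero.mpr (inv_ne_zero hj)).map _)
    (fun k ↦ by
      rw [htk, div_eq_inv_mul, map_mul]
      rfl)
    (fun o ↦ by
      rw [huo, div_eq_inv_mul, map_mul, ← map_pow, inv_pow]
      rfl)
  rw [← hG y, hG'.unique h2, Scheme.Hom.comp_apply]
  congr 1
  exact Subsingleton.elim (α := PrimeSpectrum ℂ) _ _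

/-- The complex points of `{(t, x) ∈ C × X ∣ π(x) ∈ γ_t}`. -/
def incidencePoints (Q : Fin 3 → Matrix (Fin 4) (Fin 4) ℂ) (b : Fin 8 → Fin 4 → ℂ) :
    Set (ambient Q b) :=
  {z | ∃ (t : Fin 3 → ℂ) (ξ : Fin 4 → ℂ) (η : ℂ),
    WProj.HasCoords planeWeight (WProj.hypersurfaceι planeWeight (discriminant Q)
      (pullback.fst (curveToSpec Q) (threefoldToSpec b) z)) t ∧
    WProj.HasCoords coverWeight (WProj.hypersurfaceι coverWeight (coverEquation b)
      (pullback.snd (curveToSpec Q) (threefoldToSpec b) z)) (fun o => o.elim η ξ) ∧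
    ξ ∈ gamma Q t}

theorem coe_incidenceSet : (incidenceSet Q b : Set (ambient Q b)) = closure (incidencePoints Q b) :=
  rfl

end ComplexPoints

/-! ### The parametrized double conic over the function field and over the charts of `C`. -/

section CoverPoint

variable {R S : Type} [CommRing R] [Algebra ℂ R] [CommRing S] [Algebra ℂ S]

/-- The coordinates of a point of the double covering. -/
def coverPoint (η : R) (ξ : Fin 4 → R) : Option (Fin 4) → R := fun o ↦ o.elim η ξ

theorem map_coverPoint (φ : R →ₐ[ℂ] S) (η : R) (ξ : Fin 4 → R) :
    φ ∘ coverPoint η ξ = coverPoint (φ η) (φ ∘ ξ) := by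
  funext o
  cases o <;> rfl

theorem aeval_comp_algHom {σ : Type} (φ : R →ₐ[ℂ] S) (v : σ → R) (p : MvPolynomial σ ℂ) :
    aeval (φ ∘ v) p = φ (aeval v p) := (comp_aeval_apply v φ p).symm

theorem aeval_coverPoint (b : Fin 8 → Fin 4 → ℂ) (η : R) (ξ : Fin 4 → R) :
    aeval (coverPoint η ξ) (coverEquation b) = η ^ 2 - ∏ i, (algebraMap ℂ R ∘ b i) ⬝ᵥ ξ :=
  aeval_coverEquation _

end CoverPoint

section GenericConic

open Matrix

variable {Q : Fin 3 → Matrix (Fin 4) (Fin 4) ℂ} {b : Fin 8 → Fin 4 → ℂ} {K : Type} [Field K]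
  [Algebra ℂ K] (F : CurveFunctionField (discriminant Q) K)

/-- The generic tangent plane of the generic singular member of the net. -/
def genericPlane (b : Fin 4 → ℂ) : Fin 4 → MvPolynomial (Fin 4) K :=
  tangentPlane Q b (algebraMap K _ ∘ F.coord) X

/-- The generic tangent plane over an affine chart of the curve. -/
def chartPlane (i : Fin 3) (b : Fin 4 → ℂ) : Fin 4 → MvPolynomial (Fin 4) (F.chartRing i) :=
  tangentPlane Q b (algebraMap _ _ ∘ F.chartCoord i) X

theorem aeval_chartCoord_discriminant (i : Fin 3) :
    aeval (F.chartCoord i) (discriminant Q) = 0 := by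
  refine Subtype.ext ?_
  rw [F.aeval_chartCoord, F.aeval_affineCoord isHomogeneous_discriminant]
  rfl

theorem chartCoord_self (i : Fin 3) : F.chartCoord i i = 1 :=
  Subtype.ext (F.affineCoord_self isHomogeneous_discriminant (by norm_num) i)

/-- The generic point of a component of the family of double coverings of conics is
`Spec` of a function field; it factors through the charts of the curve. -/
theorem exists_chart_isCoordMor {r : MvPolynomial (Fin 4) K}
    {π : Spec (.of (FractionRing (MvPolynomial (Fin 4) K))) ⟶ ambient Q b}
    (hπ : IsCoordMor π (algebraMap K _ ∘ F.coord)
      (algebraMap (MvPolynomial (Fin 4) K) _ ∘ coverPoint r (genericPlane F (b 0))))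
    {i : Fin 3} {j : Fin 4} (hj : chartPlane F i (b 0) j ≠ 0)
    {ρ : MvPolynomial (Fin 4) (F.chartRing i)}
    (hρ : F.polyMap i ρ = algebraMap K (MvPolynomial (Fin 4) K) (F.coord i)⁻¹ ^ 8 * r)
    (hρ2 : ρ ^ 2 = ∏ l, (algebraMap ℂ _ ∘ b l) ⬝ᵥ chartPlane F i (b 0)) :
    ∃ (g : Spec (.of (Localization.Away (chartPlane F i (b 0) j))) ⟶ ambient Q b)
      (φ : Localization.Away (chartPlane F i (b 0) j) →ₐ[ℂ]
        FractionRing (MvPolynomial (Fin 4) K)),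
      IsCoordMor g (algebraMap (MvPolynomial (Fin 4) (F.chartRing i)) _ ∘ algebraMap _ _ ∘
          F.chartCoord i)
        (algebraMap (MvPolynomial (Fin 4) (F.chartRing i)) _ ∘
          coverPoint ρ (chartPlane F i (b 0))) ∧
      Function.Injective φ ∧ Spec.map (CommRingCat.ofHom φ.toRingHom) ≫ g = π := by
  let P := MvPolynomial (Fin 4) (F.chartRing i)
  let R := Localization.Away (chartPlane F i (b 0) j)
  have hle : Submonoid.powers (chartPlane F i (b 0) j) ≤ nonZeroDivisors P :=
    powers_le_nonZeroDivisors_of_noZeroDivisors hj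
  have : IsDomain R := IsLocalization.isDomain_localization hle
  let ψ : P →ₐ[ℂ] R := IsScalarTower.toAlgHom ℂ P R
  obtain ⟨g, hg⟩ := exists_isCoordMor (Q := Q) (b := b) (R := R)
    (t := ψ ∘ algebraMap _ _ ∘ F.chartCoord i) (u := ψ ∘ coverPoint ρ (chartPlane F i (b 0)))
    (i := i) (j := j)
    (by simp [chartCoord_self])
    (IsLocalization.Away.algebraMap_isUnit (S := R) (chartPlane F i (b 0) j))
    (by
      have h : ψ ∘ algebraMap (F.chartRing i) P ∘ F.chartCoord i =
        (ψ.comp (IsScalarTower.toAlgHom ℂ (F.chartRing i) P)) ∘ F.chartCoord i := rfl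
      rw [h, aeval_comp_algHom, aeval_chartCoord_discriminant, map_zero])
    (by rw [aeval_comp_algHom, aeval_coverPoint, hρ2, sub_self, map_zero])
  let Φ : P →ₐ[ℂ] FractionRing (MvPolynomial (Fin 4) K) :=
    (IsScalarTower.toAlgHom ℂ (MvPolynomial (Fin 4) K) _).comp (F.polyMap i)
  have hΦ : Function.Injective Φ :=
    (IsFractionRing.injective (MvPolynomial (Fin 4) K) _).comp (F.polyMap_injective i)
  let φ : R →ₐ[ℂ] FractionRing (MvPolynomial (Fin 4) K) :=
    IsLocalization.liftAlgHom (M := Submonoid.powers (chartPlane F i (b 0) j)) (f := Φ)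
      fun y ↦ isUnit_iff_ne_zero.mpr fun h ↦
        nonZeroDivisors.ne_zero (hle y.2) (hΦ (h.trans (map_zero Φ).symm))
  have hφψ (x : P) : φ (ψ x) = Φ x := IsLocalization.lift_eq _ x
  have hφ : Function.Injective φ := by
    refine (injective_iff_map_eq_zero φ).mpr fun x hx ↦ ?_
    obtain ⟨y, s, rfl⟩ := IsLocalization.exists_mk'_eq (Submonoid.powers (chartPlane F i (b 0) j)) x
    have h1 : φ (ψ y) = 0 := by
      have h2 : ψ y = IsLocalization.mk' R y s * algebraMap P R s := (IsLocalization.mk'_spec _ _ _).symm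
      rw [h2, map_mul, hx, zero_mul]
    rw [hφψ] at h1
    rw [hΦ (h1.trans (map_zero Φ).symm), IsLocalization.mk'_zero]
  refine ⟨g, φ, hg, hφ, ?_⟩
  have hi := F.coord_ne_zero isHomogeneous_discriminant (by norm_num) i
  have hu : IsUnit (algebraMap K (FractionRing (MvPolynomial (Fin 4) K)) (F.coord i)⁻¹) :=
    (isUnit_iff_ne_zero.mpr (inv_ne_zero hi)).map _
  -- Chart and generic coordinates differ by `(F.coord i)⁻¹` on `C` and by its square on `X`; the
  -- coordinate of weight four scales by the eighth power, matching `hρ`.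
  refine (hg.comp φ).unique (hπ.smul hu (hu.pow 2) (fun k ↦ ?_) fun o ↦ ?_)
  · have h1 : φ (ψ (algebraMap _ _ (F.chartCoord i k))) = algebraMap K _ (F.chartCoord i k : K) := by
      rw [hφψ]
      change algebraMap (MvPolynomial (Fin 4) K) _ (F.polyMap i _) = _
      rw [F.polyMap_algebraMap]
      exact (IsScalarTower.algebraMap_apply K (MvPolynomial (Fin 4) K) _ _).symm
    refine h1.trans ?_
    rw [Function.comp_apply, ← map_mul, mul_comm, ← div_eq_mul_inv]
    rfl
  · have h1 : φ (ψ (coverPoint ρ (chartPlane F i (b 0)) o)) =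
        algebraMap (MvPolynomial (Fin 4) K) _
          (F.polyMap i (coverPoint ρ (chartPlane F i (b 0)) o)) := hφψ _
    refine h1.trans ?_
    rw [IsScalarTower.algebraMap_apply K (MvPolynomial (Fin 4) K), ← pow_mul, ← map_pow,
      Function.comp_apply, ← map_mul]
    congr 1
    cases o with
    | none => exact hρ
    | some l => exact congrFun (F.polyMap_tangentPlane i (b 0)) l

end GenericConic

/-! ### The incidence variety is the closure of the images of two generic points. -/

section Closure

open Matrix

variable {Q : Fin 3 → Matrix (Fin 4) (Fin 4) ℂ} {b : Fin 8 → Fin 4 → ℂ} {K : Type} [Field K]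
  [Algebra ℂ K] (F : CurveFunctionField (discriminant Q) K)

theorem polyMap_chartPlane (i : Fin 3) (b : Fin 4 → ℂ) (j : Fin 4) :
    F.polyMap i (chartPlane F i b j) =
      algebraMap K (MvPolynomial (Fin 4) K) (F.coord i)⁻¹ ^ 2 * genericPlane F b j :=
  congrFun (F.polyMap_tangentPlane i b) j

theorem chartPlane_ne_zero {b : Fin 4 → ℂ} {j : Fin 4} (hj : genericPlane F b j ≠ 0) (i : Fin 3) :
    chartPlane F i b j ≠ 0 := by
  intro h
  have h1 := polyMap_chartPlane F i b j
  rw [h, map_zero, eq_comm, mul_eq_zero] at h1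
  have hi := F.coord_ne_zero isHomogeneous_discriminant (by norm_num) i
  refine h1.elim (fun h2 ↦ ?_) hj
  rw [pow_eq_zero_iff two_ne_zero, FaithfulSMul.algebraMap_eq_zero_iff] at h2
  exact inv_ne_zero hi h2

theorem exists_genericPlane_ne_zero (hQ : IsRegularNet Q) (hb : IsBaseLocus Q b) :
    ∃ j, genericPlane F (b 0) j ≠ 0 := by
  by_contra! h
  refine (exists_sq_eq_prod_tangentPlane hQ hb F _ rfl).1 0 ?_
  change _ ⬝ᵥ genericPlane F (b 0) = 0
  rw [show genericPlane F (b 0) = 0 from funext h, dotProduct_zero]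

theorem exists_generic_isCoordMor (hQ : IsRegularNet Q) (hb : IsBaseLocus Q b)
    {r : MvPolynomial (Fin 4) K}
    (hr : r ^ 2 = ∏ l, (algebraMap ℂ _ ∘ b l) ⬝ᵥ genericPlane F (b 0)) :
    ∃ π : Spec (.of (FractionRing (MvPolynomial (Fin 4) K))) ⟶ ambient Q b,
      IsCoordMor π (algebraMap K _ ∘ F.coord)
        (algebraMap (MvPolynomial (Fin 4) K) _ ∘ coverPoint r (genericPlane F (b 0))) := by
  obtain ⟨j, hj⟩ := exists_genericPlane_ne_zero F hQ hb
  refine exists_isCoordMor (i := 0) (j := j) ?_ ?_ ?_ ?_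
  · rw [Function.comp_apply, F.coord_zero, map_one]
    exact isUnit_one
  · rw [isUnit_iff_ne_zero]
    exact fun h ↦ hj (IsFractionRing.injective (MvPolynomial (Fin 4) K) _ (h.trans (map_zero _).symm))
  · refine (aeval_comp_algHom (IsScalarTower.toAlgHom ℂ K _) F.coord _).trans ?_
    rw [F.aeval_self isHomogeneous_discriminant, map_zero]
  · refine (aeval_comp_algHom (IsScalarTower.toAlgHom ℂ (MvPolynomial (Fin 4) K) _) _ _).trans ?_
    rw [aeval_coverPoint, hr, sub_self, map_zero]

instance (i : Fin 3) : Algebra.FiniteType ℂ (F.chartRing i) :=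
  (F.chartRing i).fg_iff_finiteType.mp
    (Subalgebra.fg_def.mpr ⟨_, Set.finite_range _, rfl⟩)

theorem exists_algHom_away_ne_zero {P : Type} [CommRing P] [IsDomain P] [Algebra ℂ P]
    [Algebra.FiniteType ℂ P] {s : P} (hs : s ≠ 0) {h : Localization.Away s} (hh : h ≠ 0) :
    ∃ ψ : Localization.Away s →ₐ[ℂ] ℂ, ψ h ≠ 0 := by
  have : IsDomain (Localization.Away s) := IsLocalization.isDomain_localization
    (powers_le_nonZeroDivisors_of_noZeroDivisors hs)
  have : Algebra.FiniteType P (Localization.Away s) :=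
    IsLocalization.finiteType_of_monoid_fg (Submonoid.powers s) _
  have : Algebra.FiniteType ℂ (Localization.Away s) :=
    Algebra.FiniteType.trans (S := P) inferInstance inferInstance
  exact exists_algHom_ne_zero hh

theorem IsCoordMor.mem_incidencePoints (hQ : IsRegularNet Q) (hb : IsBaseLocus Q b)
    {g : Spec (.of ℂ) ⟶ ambient Q b} {t : Fin 3 → ℂ} {v : Fin 4 → ℂ} {η : ℂ}
    (hg : IsCoordMor g t (coverPoint η (tangentPlane Q (b 0) t v)))
    (hne : tangentPlane Q (b 0) t v ≠ 0) (x : Spec (.of ℂ)) : g x ∈ incidencePoints Q b := by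
  refine ⟨_, _, _, (hg.hasCoords x).1, (hg.hasCoords x).2, ?_⟩
  rw [tangentPlane_complex] at hne ⊢
  refine ⟨_, secondPoint_isotropic (member_isSymm hQ _) ?_ _, hne, 1, one_ne_zero,
    (one_smul _ _).symm⟩
  simp [member, sum_mulVec, dotProduct_sum, smul_mulVec, hb.base_eq_zero]

/-- The generic points of the family of double coverings of conics lie in the closure of the
set of complex points. -/
theorem mem_closure_incidencePoints (hQ : IsRegularNet Q) (hb : IsBaseLocus Q b)
    {r : MvPolynomial (Fin 4) K}
    (hr : r ^ 2 = ∏ l, (algebraMap ℂ _ ∘ b l) ⬝ᵥ genericPlane F (b 0))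
    {π : Spec (.of (FractionRing (MvPolynomial (Fin 4) K))) ⟶ ambient Q b}
    (hπ : IsCoordMor π (algebraMap K _ ∘ F.coord)
      (algebraMap (MvPolynomial (Fin 4) K) _ ∘ coverPoint r (genericPlane F (b 0))))
    (y : Spec (.of (FractionRing (MvPolynomial (Fin 4) K)))) :
    π y ∈ closure (incidencePoints Q b) := by
  obtain ⟨j, hj⟩ := exists_genericPlane_ne_zero F hQ hb
  have hj' := chartPlane_ne_zero F hj 0
  obtain ⟨ρ, hρ, hρ2⟩ := F.exists_chart_root hQ 0 hr
  obtain ⟨g, φ, hg, hφ, rfl⟩ := exists_chart_isCoordMor F hπ hj' hρ hρ2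
  have : Algebra.FiniteType ℂ (MvPolynomial (Fin 4) (F.chartRing 0)) :=
    Algebra.FiniteType.trans (S := F.chartRing 0) inferInstance inferInstance
  rw [mem_closure_iff]
  intro U hU hyU
  -- A neighbourhood of the generic point pulls back to a nonempty open set of an integral affine
  -- scheme of finite type, which contains a complex point. There the chart coordinates are those of
  -- an incidence point.
  obtain ⟨V, ⟨h, rfl⟩, hyV, hVU⟩ :=
    PrimeSpectrum.isTopologicalBasis_basic_opens.exists_subset_of_mem_open
      (show Spec.map (CommRingCat.ofHom φ.toRingHom) y ∈ g ⁻¹' U from hyU)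
      (hU.preimage g.continuous)
  have hh : h ≠ 0 := by
    rintro rfl
    exact hyV (zero_mem _)
  obtain ⟨ψ, hψ⟩ := exists_algHom_away_ne_zero hj' hh
  let x : Spec (.of ℂ) := (⊥ : PrimeSpectrum ℂ)
  refine ⟨g (Spec.map (CommRingCat.ofHom ψ.toRingHom) x), hVU ?_, ?_⟩
  · exact fun h0 ↦ hψ ((mem_asIdeal_of_field (⊥ : PrimeSpectrum ℂ) _).mp h0)
  let ψ' : MvPolynomial (Fin 4) (F.chartRing 0) →ₐ[ℂ] ℂ :=
    ψ.comp (IsScalarTower.toAlgHom ℂ (MvPolynomial (Fin 4) (F.chartRing 0)) _)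
  have hcoord : IsCoordMor (Spec.map (CommRingCat.ofHom ψ.toRingHom) ≫ g)
      (ψ' ∘ algebraMap _ _ ∘ F.chartCoord 0) (ψ' ∘ coverPoint ρ (chartPlane F 0 (b 0))) :=
    hg.comp ψ
  have hne : ψ' (chartPlane F 0 (b 0) j) ≠ 0 :=
    ((IsLocalization.Away.algebraMap_isUnit (chartPlane F 0 (b 0) j)).map ψ).ne_zero
  rw [map_coverPoint, show ψ' ∘ chartPlane F 0 (b 0) = _ from map_tangentPlane ψ' _ _ _] at hcoord
  refine hcoord.mem_incidencePoints hQ hb (fun h0 ↦ hne ?_) x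
  exact (congrFun (map_tangentPlane ψ' _ _ _) j).trans (congrFun h0 j)

/-- Every complex point lies over one of the two generic points. -/
theorem specializes_of_mem_incidencePoints (hQ : IsRegularNet Q) (hb : IsBaseLocus Q b)
    {r : MvPolynomial (Fin 4) K}
    (hr : r ^ 2 = ∏ l, (algebraMap ℂ _ ∘ b l) ⬝ᵥ genericPlane F (b 0))
    {π π' : Spec (.of (FractionRing (MvPolynomial (Fin 4) K))) ⟶ ambient Q b}
    (hπ : IsCoordMor π (algebraMap K _ ∘ F.coord)
      (algebraMap (MvPolynomial (Fin 4) K) _ ∘ coverPoint r (genericPlane F (b 0))))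
    (hπ' : IsCoordMor π' (algebraMap K _ ∘ F.coord)
      (algebraMap (MvPolynomial (Fin 4) K) _ ∘ coverPoint (-r) (genericPlane F (b 0))))
    {z : ambient Q b} (hz : z ∈ incidencePoints Q b)
    (y : Spec (.of (FractionRing (MvPolynomial (Fin 4) K)))) : π y ⤳ z ∨ π' y ⤳ z := by
  obtain ⟨t, ξ, η, ht, hξ, hγ⟩ := hz
  have htQ : eval t (discriminant Q) = 0 :=
    eval_eq_zero_of_hasCoords (mem_planeWeight.mpr isHomogeneous_discriminant) ht
  have hη : η ^ 2 - ∏ l, b l ⬝ᵥ ξ = 0 := by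
    have h := eval_eq_zero_of_hasCoords (coverEquation_mem b) hξ
    have h1 := aeval_coverPoint (R := ℂ) b η ξ
    rw [← h]
    exact h1.symm
  obtain ⟨i, hi⟩ := Function.ne_iff.mp ht.1
  have hi : t i ≠ 0 := hi
  obtain ⟨v, c, hc, hξc⟩ := exists_eq_smul_tangentPlane hQ (hb.ne_zero 0) (hb.base_eq_zero 0) ht.1
    htQ hγ
  obtain ⟨j, hj⟩ : ∃ j, ξ j ≠ 0 := by
    obtain ⟨y, -, hy, c, hc, rfl⟩ := hγ
    exact Function.ne_iff.mp (smul_ne_zero hc hy)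
  set t' : Fin 3 → ℂ := (t i)⁻¹ • t with ht'
  have htt' : t = t i • t' := by rw [ht', smul_smul, mul_inv_cancel₀ hi, one_smul]
  have ht'i : t' i = 1 := inv_mul_cancel₀ hi
  have hξ' : ξ = (c * t i ^ 2) • tangentPlane Q (b 0) t' v := by
    rw [hξc]
    nth_rw 1 [htt']
    rw [tangentPlane_smul, smul_smul]
  have ht'Q : eval t' (discriminant Q) = 0 := by
    have h := aeval_smul_of_mem planeWeight (R := ℂ)
      (mem_planeWeight.mpr (isHomogeneous_discriminant (Q := Q))) (t i) t'
    simp only [pow_one] at h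
    have h1 : eval t (discriminant Q) = t i ^ 4 * eval t' (discriminant Q) := by
      nth_rw 1 [htt']
      exact h
    rw [htQ, eq_comm, mul_eq_zero] at h1
    exact h1.resolve_left (pow_ne_zero _ hi)
  obtain ⟨χ, hχ⟩ := F.exists_algHom_chartRing isHomogeneous_discriminant (by norm_num) ht'i ht'Q
  let P := MvPolynomial (Fin 4) (F.chartRing i)
  -- Specialization of the parametrized family over the chart at the point `t'` of the curve and at
  -- the parameter `v` of the given tangent plane.
  let Ψ : P →ₐ[ℂ] ℂ := (aeval v : MvPolynomial (Fin 4) ℂ →ₐ[ℂ] ℂ).comp (mapAlgHom χ)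
  have hΨ : Ψ ∘ chartPlane F i (b 0) = tangentPlane Q (b 0) t' v := by
    rw [chartPlane, map_tangentPlane]
    congr 1
    · funext k
      simp [Ψ, P, algebraMap_eq, hχ]
    · funext k
      simp [Ψ, P]
  have hd : c * t i ^ 2 ≠ 0 := mul_ne_zero hc (pow_ne_zero _ hi)
  have hΨj : Ψ (chartPlane F i (b 0) j) ≠ 0 := by
    intro h
    have h1 : tangentPlane Q (b 0) t' v j = 0 := by rw [← hΨ]; exact h
    rw [hξ', Pi.smul_apply, h1, smul_zero] at hj
    exact hj rfl
  have hj' : chartPlane F i (b 0) j ≠ 0 := fun h ↦ hΨj (by rw [h, map_zero])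
  let R := Localization.Away (chartPlane F i (b 0) j)
  let ΨR : R →ₐ[ℂ] ℂ :=
    IsLocalization.liftAlgHom (M := Submonoid.powers (chartPlane F i (b 0) j)) (f := Ψ) (by
      rintro ⟨_, m, rfl⟩
      rw [map_pow]
      exact (isUnit_iff_ne_zero.mpr hΨj).pow m)
  have hΨR (x : P) : ΨR (algebraMap P R x) = Ψ x := IsLocalization.lift_eq _ x
  obtain ⟨h, hh, hhz⟩ := exists_isCoordMor_of_hasCoords ht hξ hi (j := j) hj
  -- Under the same morphism `g` from an integral affine scheme, `π y` is the image of the generic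
  -- point and `z` that of the complex point defined by `ΨR`.
  have key {r' : MvPolynomial (Fin 4) K}
      {π : Spec (.of (FractionRing (MvPolynomial (Fin 4) K))) ⟶ ambient Q b}
      (hπ : IsCoordMor π (algebraMap K _ ∘ F.coord)
        (algebraMap (MvPolynomial (Fin 4) K) _ ∘ coverPoint r' (genericPlane F (b 0))))
      {ρ : MvPolynomial (Fin 4) (F.chartRing i)}
      (hρ : F.polyMap i ρ = algebraMap K (MvPolynomial (Fin 4) K) (F.coord i)⁻¹ ^ 8 * r')
      (hρ2 : ρ ^ 2 = ∏ l, (algebraMap ℂ _ ∘ b l) ⬝ᵥ chartPlane F i (b 0))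
      (hρη : η = (c * t i ^ 2) ^ 4 * Ψ ρ) : π y ⤳ z := by
    obtain ⟨g, φ, hg, hφ, rfl⟩ := exists_chart_isCoordMor F hπ hj' hρ hρ2
    have h1 := (hg.comp ΨR).smul (x := t i) (y := c * t i ^ 2) (t' := t)
      (u' := fun o ↦ o.elim η ξ) hi.isUnit hd.isUnit
      (fun k ↦ by
        have : ΨR (algebraMap P R (algebraMap _ _ (F.chartCoord i k))) = t' k := by
          rw [hΨR]
          simp [Ψ, P, algebraMap_eq, hχ]
        refine (congrFun htt' k).trans ?_
        exact congrArg (t i * ·) this.symm)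
      (fun o ↦ by
        have : ΨR (algebraMap P R (coverPoint ρ (chartPlane F i (b 0)) o)) =
            Ψ (coverPoint ρ (chartPlane F i (b 0)) o) := hΨR _
        cases o with
        | none => exact hρη.trans (congrArg _ this.symm)
        | some l =>
          refine (congrFun hξ' l).trans ?_
          rw [← hΨ]
          exact (congrArg₂ (· * ·) (pow_one _).symm this.symm))
    let x : Spec (.of ℂ) := (⊥ : PrimeSpectrum ℂ)
    rw [← hhz x, hh.unique h1, Scheme.Hom.comp_apply, Scheme.Hom.comp_apply]
    refine Specializes.map ?_ g.continuous
    refine (PrimeSpectrum.le_iff_specializes _ _).mp ?_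
    intro a ha
    have ha' : φ a ∈ PrimeSpectrum.asIdeal y := ha
    have : a = 0 := hφ (((mem_asIdeal_of_field y _).mp ha').trans (map_zero φ).symm)
    rw [this]
    exact zero_mem _
  obtain ⟨ρ, hρ, hρ2⟩ := F.exists_chart_root hQ i hr
  have hε : Ψ ρ ^ 2 = ∏ l, b l ⬝ᵥ tangentPlane Q (b 0) t' v := by
    rw [← map_pow, hρ2, map_prod]
    refine Finset.prod_congr rfl fun l _ ↦ ?_
    rw [← hΨ]
    refine (RingHom.map_dotProduct Ψ.toRingHom _ _).trans ?_
    congr 1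
    funext k
    exact Ψ.commutes _
  -- Both `η` and the rescaled value of `ρ` are square roots of the same product of eight linear
  -- forms; the sign between them decides which generic point specializes to `z`.
  have hηε : η ^ 2 = ((c * t i ^ 2) ^ 4 * Ψ ρ) ^ 2 := by
    rw [sub_eq_zero.mp hη, mul_pow, hε, hξ']
    simp only [dotProduct_smul, smul_eq_mul]
    rw [Finset.prod_mul_distrib, Finset.prod_const, Finset.card_univ, Fintype.card_fin]
    ring
  rcases sq_eq_sq_iff_eq_or_eq_neg.mp hηε with h1 | h1
  · exact .inl (key hπ hρ hρ2 h1)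
  · exact .inr (key hπ' (ρ := -ρ) (by rw [map_neg, hρ, mul_neg]) ((neg_sq ρ).trans hρ2)
      (by rw [map_neg, mul_neg, h1]))

end Closure

/-! ### The two generic points do not specialize to each other. -/

section Separation

open Matrix

/-- `R` plays the local ring at the special point, `ρ'` its map at that point and `ρ` that of the
generization. The element `c (β · ζ)³ ω - ∏ (z i · ζ)`, with constants lifted to `R`, is killed by
`ρ`. The opposite sign of `ω` makes it nonzero under `ρ'`, hence a unit, a contradiction. -/
theorem false_of_local_sign {K L R : Type} [Field K] [Field L] [CharZero L] [Algebra K L]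
    [CommRing R] (ρ ρ' : R →+* L) (hρ' : ∀ x, ρ' x ≠ 0 → IsUnit x)
    (hlift : ∀ x : K, ∃ y, ρ y = algebraMap K L x ∧ ρ' y = algebraMap K L x)
    {ζ : Fin 4 → R} {ω : R} (hζ : ρ ∘ ζ = ρ' ∘ ζ) (hω : ρ' ω = -ρ ω) {c : K} {β : Fin 4 → K}
    {z : Fin 7 → Fin 4 → K} (hc : c ≠ 0) (hβ : (algebraMap K L ∘ β) ⬝ᵥ (ρ ∘ ζ) ≠ 0)
    (hω0 : ρ ω ≠ 0) (h : ∏ i, (algebraMap K L ∘ z i) ⬝ᵥ (ρ ∘ ζ) =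
      algebraMap K L c * ((algebraMap K L ∘ β) ⬝ᵥ (ρ ∘ ζ)) ^ 3 * ρ ω) : False := by
  choose l hl hl' using hlift
  have hdot (y : Fin 4 → K) : ρ ((l ∘ y) ⬝ᵥ ζ) = (algebraMap K L ∘ y) ⬝ᵥ (ρ ∘ ζ) := by
    rw [RingHom.map_dotProduct]
    congr 1
    exact _root_.funext fun i ↦ hl _
  have hdot' (y : Fin 4 → K) : ρ' ((l ∘ y) ⬝ᵥ ζ) = (algebraMap K L ∘ y) ⬝ᵥ (ρ ∘ ζ) := by
    rw [RingHom.map_dotProduct, hζ]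
    congr 1
    exact _root_.funext fun i ↦ hl' _
  let e : R := l c * ((l ∘ β) ⬝ᵥ ζ) ^ 3 * ω - ∏ i, (l ∘ z i) ⬝ᵥ ζ
  have he : ρ e = 0 := by
    simp only [e, map_sub, map_mul, map_pow, map_prod, hdot, hl, h, sub_self]
  have he' : ρ' e ≠ 0 := by
    have : ρ' e = -(2 * (algebraMap K L c * ((algebraMap K L ∘ β) ⬝ᵥ (ρ ∘ ζ)) ^ 3 * ρ ω)) := by
      simp only [e, map_sub, map_mul, map_pow, map_prod, hdot', hl', h, hω]
      ring
    rw [this]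
    refine neg_ne_zero.mpr (mul_ne_zero two_ne_zero (mul_ne_zero (mul_ne_zero ?_ ?_) hω0))
    · exact (map_ne_zero _).mpr hc
    · exact pow_ne_zero _ hβ
  exact ((hρ' e he').map ρ).ne_zero he

variable {Q : Fin 3 → Matrix (Fin 4) (Fin 4) ℂ} {b : Fin 8 → Fin 4 → ℂ} {K : Type} [Field K]
  [Algebra ℂ K] (F : CurveFunctionField (discriminant Q) K)

theorem CurveFunctionField.exists_eq_div_aeval_coord (x : K) : ∃ p q : MvPolynomial (Fin 3) ℂ,
    aeval F.coord q ≠ 0 ∧ x * aeval F.coord q = aeval F.coord p := by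
  have hmem (a : F.chartRing 0) : ∃ p : MvPolynomial (Fin 3) ℂ, aeval F.coord p = (a : K) := by
    have h : (a : K) ∈ Algebra.adjoin ℂ (Set.range (F.affineCoord 0)) := a.2
    rw [Algebra.adjoin_range_eq_range_aeval] at h
    obtain ⟨p, hp⟩ := h
    have : F.affineCoord 0 = F.coord := _root_.funext fun j ↦ by
      rw [CurveFunctionField.affineCoord, F.coord_zero, div_one]
    rw [this] at hp
    exact ⟨p, hp⟩
  obtain ⟨a, c, hc, hac⟩ := F.exists_mul_chartRing isHomogeneous_discriminant (by norm_num) 0 x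
  obtain ⟨p, hp⟩ := hmem a
  obtain ⟨q, hq⟩ := hmem c
  refine ⟨p, q, ?_, by rw [hp, hq, hac]⟩
  rw [hq]
  exact fun h ↦ hc (Subtype.ext h)

/-- Both generic points lie over the generic point of `C`. An element of `K` is a fraction of
polynomials in the coordinates, and its denominator, nonzero under `ρ'`, is invertible in the local
ring. -/
theorem CurveFunctionField.exists_common_lift {L R : Type} [Field L] [Algebra ℂ L] [Algebra K L]
    [IsScalarTower ℂ K L] [CommRing R] [Algebra ℂ R] (ρ ρ' : R →ₐ[ℂ] L)
    (hρ' : ∀ x, ρ' x ≠ 0 → IsUnit x) {t : Fin 3 → R} (ht : ρ ∘ t = algebraMap K L ∘ F.coord)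
    (ht' : ρ' ∘ t = algebraMap K L ∘ F.coord) (x : K) :
    ∃ y, ρ y = algebraMap K L x ∧ ρ' y = algebraMap K L x := by
  have hev (σ : R →ₐ[ℂ] L) (hσ : σ ∘ t = algebraMap K L ∘ F.coord) (p : MvPolynomial (Fin 3) ℂ) :
      σ (aeval t p) = algebraMap K L (aeval F.coord p) := by
    rw [← aeval_comp_algHom, hσ]
    exact aeval_comp_algHom (IsScalarTower.toAlgHom ℂ K L) F.coord p
  obtain ⟨p, q, hq, hx⟩ := F.exists_eq_div_aeval_coord x
  have hq' : algebraMap K L (aeval F.coord q) ≠ 0 := (map_ne_zero _).mpr hq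
  obtain ⟨w, hw⟩ := hρ' (aeval t q) (by rwa [hev ρ' ht'])
  have key (σ : R →ₐ[ℂ] L) (hσ : σ ∘ t = algebraMap K L ∘ F.coord) :
      σ (aeval t p * ↑w⁻¹) = algebraMap K L x := by
    refine mul_right_cancel₀ hq' ?_
    rw [← map_mul, hx, ← hev σ hσ, ← hev σ hσ, ← map_mul, mul_assoc, ← hw, Units.inv_mul, mul_one]
  exact ⟨_, key ρ ht, key ρ' ht'⟩

theorem exists_isCoordMor_of_specializes {R : Type} [CommRing R] [Algebra ℂ R]
    {g : Spec (.of R) ⟶ ambient Q b} {p : ambient Q b} (hx : ∀ x, g x ⤳ p) {i : Fin 3} {j : Fin 4}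
    (h : g ≫ pullback.fst (curveToSpec Q) (threefoldToSpec b) ≫
      curveToSpec Q = Spec.map (CommRingCat.ofHom (algebraMap ℂ R)))
    (hi : (X i : MvPolynomial (Fin 3) ℂ) ∉
      ProjectiveSpectrum.asHomogeneousIdeal (𝒜 := weightedHomogeneousSubmodule ℂ planeWeight)
      (WProj.hypersurfaceι planeWeight (discriminant Q)
        (pullback.fst (curveToSpec Q) (threefoldToSpec b) p)))
    (hj : (X (some j) : MvPolynomial (Option (Fin 4)) ℂ) ∉
      ProjectiveSpectrum.asHomogeneousIdeal (𝒜 := weightedHomogeneousSubmodule ℂ coverWeight)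
      (WProj.hypersurfaceι coverWeight (coverEquation b)
        (pullback.snd (curveToSpec Q) (threefoldToSpec b) p))) :
    ∃ t u, t i = 1 ∧ u (some j) = 1 ∧ IsCoordMor g t u := by
  refine exists_isCoordMor_of_mem h i j (fun x ↦ ?_) fun x ↦ ?_
  · exact (((hx x).map (pullback.fst (curveToSpec Q) (threefoldToSpec b)).continuous).map
      (WProj.hypersurfaceι planeWeight (discriminant Q)).continuous).mem_open
      (ProjectiveSpectrum.basicOpen (weightedHomogeneousSubmodule ℂ planeWeight) (X i)).isOpen hi
  · exact (((hx x).map (pullback.snd (curveToSpec Q) (threefoldToSpec b)).continuous).map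
      (WProj.hypersurfaceι coverWeight (coverEquation b)).continuous).mem_open
      (ProjectiveSpectrum.basicOpen (weightedHomogeneousSubmodule ℂ coverWeight)
        (X (some j))).isOpen hj

/-- The generic points of the two double coverings do not specialize to each other. -/
theorem not_specializes_of_neg {r : MvPolynomial (Fin 4) K} {c : K} {z : Fin 7 → Fin 4 → K}
    (hc : c ≠ 0) (hr : r ≠ 0) (hb0 : (algebraMap ℂ _ ∘ b 0) ⬝ᵥ genericPlane F (b 0) ≠ 0)
    (hz : ∏ i, (algebraMap K _ ∘ z i) ⬝ᵥ genericPlane F (b 0) =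
      algebraMap K _ c * ((algebraMap ℂ _ ∘ b 0) ⬝ᵥ genericPlane F (b 0)) ^ 3 * r)
    {π π' : Spec (.of (FractionRing (MvPolynomial (Fin 4) K))) ⟶ ambient Q b}
    (hπ : IsCoordMor π (algebraMap K _ ∘ F.coord)
      (algebraMap (MvPolynomial (Fin 4) K) _ ∘ coverPoint r (genericPlane F (b 0))))
    (hπ' : IsCoordMor π' (algebraMap K _ ∘ F.coord)
      (algebraMap (MvPolynomial (Fin 4) K) _ ∘ coverPoint (-r) (genericPlane F (b 0))))
    (y y' : Spec (.of (FractionRing (MvPolynomial (Fin 4) K)))) : ¬ π y ⤳ π' y' := by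
  let P := MvPolynomial (Fin 4) K
  let L := FractionRing P
  intro h
  let q : PrimeSpectrum L := IsLocalRing.closedPoint L
  have hy : y = q := Subsingleton.elim (α := PrimeSpectrum L) _ _
  have hy' : y' = q := Subsingleton.elim (α := PrimeSpectrum L) _ _
  rw [hy, hy'] at h
  let p : ambient Q b := π' (IsLocalRing.closedPoint L)
  let R : Type := (ambient Q b).presheaf.stalk p
  let G : Spec (.of R) ⟶ ambient Q b := (ambient Q b).fromSpecStalk p
  let a : .of ℂ ⟶ CommRingCat.of R := Spec.preimage
    (G ≫ pullback.fst (curveToSpec Q) (threefoldToSpec b) ≫ curveToSpec Q)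
  let : Algebra ℂ R := a.hom.toAlgebra
  obtain ⟨j, hj⟩ : ∃ j, genericPlane F (b 0) j ≠ 0 := by
    by_contra! h0
    exact hb0 (by rw [show genericPlane F (b 0) = 0 from _root_.funext h0, dotProduct_zero])
  have hPL : Function.Injective (algebraMap P L) := IsFractionRing.injective P L
  have hjL : algebraMap P L (genericPlane F (b 0) j) ≠ 0 :=
    fun h ↦ hj (hPL (h.trans (map_zero _).symm))
  have hx (x : Spec (.of R)) : G x ⤳ p := by
    have : G x ∈ Set.range ((ambient Q b).fromSpecStalk p) := ⟨x, rfl⟩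
    rwa [Scheme.range_fromSpecStalk] at this
  obtain ⟨t, u, ht, hu, hG⟩ := exists_isCoordMor_of_specializes hx (i := 0) (j := j)
    (Spec.map_preimage _).symm
    (fun h0 ↦ by
      have h1 := (mem_asIdeal_of_field _ _).mp
        ((hπ'.mem_fst_iff (IsLocalRing.closedPoint L) (isHomogeneous_X ℂ 0)).mp h0)
      rw [aeval_X, Function.comp_apply, F.coord_zero, map_one] at h1
      exact one_ne_zero h1)
    (fun h0 ↦ by
      have h1 := (mem_asIdeal_of_field _ _).mp
        ((hπ'.mem_snd_iff (IsLocalRing.closedPoint L) (X_mem (w := coverWeight) rfl)).mp h0)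
      rw [aeval_X] at h1
      exact hjL h1)
  -- The specialization gives a map from the local ring at `p` to that at the image of `π`;
  -- composing with evaluation along `π` yields a second `L`-point of the same local ring.
  let ρ₁ : CommRingCat.of R ⟶ .of L :=
    (ambient Q b).presheaf.stalkSpecializes h ≫ Scheme.stalkClosedPointTo π
  let ρ₁' : CommRingCat.of R ⟶ .of L := Scheme.stalkClosedPointTo π'
  have hρ₁ : Spec.map ρ₁ ≫ G = π := by
    refine (congrArg (· ≫ G) (Spec.map_comp _ _)).trans ((Category.assoc _ _ _).trans ?_)
    refine (congrArg (Spec.map (Scheme.stalkClosedPointTo π) ≫ ·)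
      (Scheme.SpecMap_stalkSpecializes_fromSpecStalk h)).trans ?_
    exact Scheme.Spec_stalkClosedPointTo_fromSpecStalk π
  have hρ₁' : Spec.map ρ₁' ≫ G = π' := Scheme.Spec_stalkClosedPointTo_fromSpecStalk π'
  have halg (τ : CommRingCat.of R ⟶ .of L) (π : Spec (.of L) ⟶ ambient Q b) {t u}
      (hπ : IsCoordMor π t u) (hτ : Spec.map τ ≫ G = π) (x : ℂ) :
      τ.hom (algebraMap ℂ R x) = algebraMap ℂ L x := by
    have h1 := hπ.comp_toSpec
    rw [← hτ, Category.assoc,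
      show G ≫ _ ≫ _ = Spec.map a from (Spec.map_preimage _).symm, ← Spec.map_comp] at h1
    have h2 := Spec.map_injective h1
    exact congrArg (fun f : CommRingCat.of ℂ ⟶ .of L ↦ f.hom x) h2
  let ρ : R →ₐ[ℂ] L := { ρ₁.hom with commutes' := halg ρ₁ π hπ hρ₁ }
  let ρ' : R →ₐ[ℂ] L := { ρ₁'.hom with commutes' := halg ρ₁' π' hπ' hρ₁' }
  have hloc (x : R) (hx : ρ' x ≠ 0) : IsUnit x :=
    (inferInstance : IsLocalHom (Scheme.stalkClosedPointTo π').hom).map_nonunit x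
      (isUnit_iff_ne_zero.mpr hx)
  -- Coordinates normalized by `t 0 = 1` and `u (some j) = 1` are unique, so the values in `L` are
  -- read off from the coordinates of `π` and `π'`. They agree except for the sign at weight four.
  have key (σ : R →ₐ[ℂ] L) (π : Spec (.of L) ⟶ ambient Q b) (η : P)
      (hσ : Spec.map (CommRingCat.ofHom σ.toRingHom) ≫ G = π)
      (hπ : IsCoordMor π (algebraMap K _ ∘ F.coord)
        (algebraMap P L ∘ coverPoint η (genericPlane F (b 0)))) :
      σ ∘ t = algebraMap K L ∘ F.coord ∧
        σ (u none) = (algebraMap P L (genericPlane F (b 0) j))⁻¹ ^ 4 * algebraMap P L η ∧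
        ∀ l, σ (u (some l)) = (algebraMap P L (genericPlane F (b 0) j))⁻¹ *
          algebraMap P L (genericPlane F (b 0) l) := by
    have h1 : IsCoordMor π (σ ∘ t) (σ ∘ u) := hσ ▸ hG.comp σ
    have h2 := hπ.smul isUnit_one (isUnit_iff_ne_zero.mpr (inv_ne_zero hjL))
      (fun k ↦ (one_mul _).symm) (fun o ↦ rfl)
    have h3 := h1.snd_injective h2 (j := j) (by rw [Function.comp_apply, hu, map_one])
      (by
        refine (congrArg (· * _) (pow_one _)).trans ?_
        exact inv_mul_cancel₀ hjL)
    refine ⟨?_, congrFun h3 none, fun l ↦ ?_⟩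
    · refine h1.fst_injective hπ (i := 0) (by rw [Function.comp_apply, ht, map_one]) ?_
      rw [Function.comp_apply, F.coord_zero, map_one]
    · exact (congrFun h3 (some l)).trans (congrArg (· * _) (pow_one _))
  obtain ⟨ht1, hn1, hs1⟩ := key ρ π r hρ₁ hπ
  obtain ⟨ht2, hn2, hs2⟩ := key ρ' π' (-r) hρ₁' hπ'
  let s : L := (algebraMap P L (genericPlane F (b 0) j))⁻¹
  have hs : s ≠ 0 := inv_ne_zero hjL
  have hζ : (ρ : R →+* L) ∘ (fun l ↦ u (some l)) = s • (algebraMap P L ∘ genericPlane F (b 0)) :=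
    _root_.funext hs1
  have hdot (v : Fin 4 → K) : (algebraMap K L ∘ v) ⬝ᵥ ((ρ : R →+* L) ∘ fun l ↦ u (some l)) =
      s * algebraMap P L ((algebraMap K P ∘ v) ⬝ᵥ genericPlane F (b 0)) := by
    rw [hζ, dotProduct_smul, RingHom.map_dotProduct, smul_eq_mul]
    congr 2
  have hβ : (algebraMap K P ∘ algebraMap ℂ K ∘ b 0) = algebraMap ℂ P ∘ b 0 :=
    _root_.funext fun l ↦ (IsScalarTower.algebraMap_apply ℂ K P _).symm
  have : CharZero L := charZero_of_injective_algebraMap (algebraMap ℂ L).injective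
  refine false_of_local_sign (K := K) (ρ : R →+* L) (ρ' : R →+* L) hloc
    (F.exists_common_lift ρ ρ' hloc ht1 ht2) (ζ := fun l ↦ u (some l)) (ω := u none)
    (c := c) (β := algebraMap ℂ K ∘ b 0) (z := z) ?_ ?_ hc ?_ ?_ ?_
  · exact _root_.funext fun l ↦ (hs1 l).trans (hs2 l).symm
  · refine hn2.trans ?_
    rw [map_neg, mul_neg]
    exact congrArg _ hn1.symm
  · rw [hdot, hβ]
    exact mul_ne_zero hs fun h ↦ hb0 (hPL (h.trans (map_zero _).symm))
  · refine fun h ↦ mul_ne_zero (pow_ne_zero 4 hs) ?_ (hn1.symm.trans h)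
    exact fun h ↦ hr (hPL (h.trans (map_zero _).symm))
  · simp only [hdot, hβ]
    rw [Finset.prod_mul_distrib, ← map_prod, hz, Finset.prod_const, Finset.card_univ,
      Fintype.card_fin]
    refine Eq.trans ?_ (congrArg (_ * ·) hn1.symm)
    rw [map_mul, map_mul, map_pow, ← IsScalarTower.algebraMap_apply K P L]
    ring

end Separation

/-! ### Determination of the generic points and conclusion. -/

section GenericPoints

open Topology

/-- A space which is the union of the closures of two points, neither of which specializes to
the other, has exactly these generic points. -/
theorem genericPoints_eq_pair {T : Type} [TopologicalSpace T] [T0Space T] {p q : T}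
    (h : ∀ x, p ⤳ x ∨ q ⤳ x) (hpq : ¬ p ⤳ q) (hqp : ¬ q ⤳ p) : genericPoints T = {p, q} := by
  have hcl (x y : T) : closure {x} ⊆ closure {y} ↔ y ⤳ x := by
    rw [specializes_iff_closure_subset]
  -- A point is generic exactly when it has no proper generization. For the converse, an irreducible
  -- set containing `x` lies in the closure of `p` or of `q`, which then generizes `x`.
  have hgen (x : T) : x ∈ genericPoints T ↔ ∀ y, y ⤳ x → x ⤳ y := by
    constructor
    · intro hx y hy
      have hx' : Maximal IsIrreducible (closure {x}) := by
        have : closure {x} ∈ irreducibleComponents T := hx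
        exact this
      rw [← hcl]
      exact hx'.2 isIrreducible_singleton.closure ((hcl _ _).mpr hy)
    · intro hx
      change closure {x} ∈ irreducibleComponents T
      refine ⟨isIrreducible_singleton.closure, fun s hs hxs ↦ ?_⟩
      have hcov : s ⊆ closure {p} ∪ closure {q} := fun y _ ↦ (h y).imp
        specializes_iff_mem_closure.mp specializes_iff_mem_closure.mp
      have hxs' : x ∈ s := hxs (subset_closure rfl)
      rcases (isPreirreducible_iff_isClosed_union_isClosed.mp hs.isPreirreducible) _ _
        isClosed_closure isClosed_closure hcov with h1 | h1
      · exact h1.trans ((hcl _ _).mpr (hx p (specializes_iff_mem_closure.mpr (h1 hxs'))))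
      · exact h1.trans ((hcl _ _).mpr (hx q (specializes_iff_mem_closure.mpr (h1 hxs'))))
  ext x
  rw [hgen, Set.mem_insert_iff, Set.mem_singleton_iff]
  constructor
  · intro hx
    exact (h x).imp (fun h1 ↦ ((hx p h1).antisymm h1).eq) fun h1 ↦ ((hx q h1).antisymm h1).eq
  · rintro (rfl | rfl) y hy
    · exact (h y).resolve_right fun h1 ↦ hqp (h1.trans hy)
    · exact (h y).resolve_left fun h1 ↦ hpq (h1.trans hy)

theorem isInducing_reducedSubschemeι {X : Scheme.{0}} (Z : TopologicalSpace.Closeds X) :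
    IsInducing (reducedSubschemeι Z) :=
  (reducedSubschemeι Z).isClosedEmbedding.isInducing

variable {Q : Fin 3 → Matrix (Fin 4) (Fin 4) ℂ} {b : Fin 8 → Fin 4 → ℂ} {K : Type} [Field K]
  [Algebra ℂ K] (F : CurveFunctionField (discriminant Q) K)

theorem specializes_of_mem_closure_incidencePoints {p q : ambient Q b}
    (h : ∀ z ∈ incidencePoints Q b, p ⤳ z ∨ q ⤳ z) {z : ambient Q b}
    (hz : z ∈ closure (incidencePoints Q b)) : p ⤳ z ∨ q ⤳ z := by
  simp only [specializes_iff_mem_closure] at h ⊢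
  exact closure_minimal (fun z hz ↦ h z hz) (isClosed_closure.union isClosed_closure) hz

/-- The curve is integrally closed in the residue field of a generic point of the family of
double coverings. -/
theorem isIso_fromNormalization_residueField (hQ : IsRegularNet Q)
    {π : Spec (.of (FractionRing (MvPolynomial (Fin 4) K))) ⟶ ambient Q b} {u}
    (hπ : IsCoordMor π (algebraMap K _ ∘ F.coord) u)
    {g : Spec (.of (FractionRing (MvPolynomial (Fin 4) K))) ⟶ incidence Q b}
    (hg : g ≫ reducedSubschemeι (incidenceSet Q b) = π) :
    IsIso ((incidence Q b).fromSpecResidueField (g (IsLocalRing.closedPoint _)) ≫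
      incidenceToCurve Q b).fromNormalization := by
  let L := FractionRing (MvPolynomial (Fin 4) K)
  have hmor : g ≫ incidenceToCurve Q b =
      Spec.map (CommRingCat.ofHom (algebraMap K L)) ≫ F.mor := by
    rw [← Category.assoc, hg, ← cancel_mono (WProj.hypersurfaceι planeWeight (discriminant Q))]
    have h0 : IsUnit ((algebraMap K L ∘ F.coord) 0) := by
      rw [Function.comp_apply, F.coord_zero, map_one]
      exact isUnit_one
    rw [hπ.fst_eq h0, Category.assoc, F.mor_comp]
    exact (specMap_coordMor (IsScalarTower.toAlgHom ℂ K L) _ _ _ _ _).symm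
  -- The residue field at the generic point embeds in `L = K(v)`, compatibly with the maps to `C`.
  let ψ := Scheme.descResidueField (Scheme.stalkClosedPointTo g)
  have hψ : Spec.map ψ ≫ (incidence Q b).fromSpecResidueField (g (IsLocalRing.closedPoint L)) = g :=
    Scheme.descResidueField_stalkClosedPointTo_fromSpecResidueField L _ g
  have : Subsingleton (Spec ((incidence Q b).residueField (g (IsLocalRing.closedPoint L)))) :=
    inferInstanceAs (Subsingleton (PrimeSpectrum
      ((incidence Q b).residueField (g (IsLocalRing.closedPoint L)))))
  have : Nonempty (Spec (.of L)) := ⟨IsLocalRing.closedPoint L⟩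
  refine isIso_fromNormalization_of_specMap _ ψ ψ.hom.injective (curveChart (discriminant Q))
    (isAffineOpen_curveChart _) (iSup_curveChart _)
    (fun i ↦ F.chartMap i ≫ CommRingCat.ofHom (algebraMap K L)) (fun i ↦ ?_) (fun i ↦ ?_)
    fun i x hx ↦ ?_
  · rw [← Category.assoc, hψ, hmor, F.mor_eq i, Spec.map_comp, Category.assoc]
  · exact (algebraMap K L).injective.comp (F.chartMap_injective i)
  · exact F.exists_chartMap_eq_of_isIntegralElem isHomogeneous_discriminant (by norm_num)
      hQ.smooth i hx

end GenericPoints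

theorem exists_doubleCover_iso {Q : Fin 3 → Matrix (Fin 4) (Fin 4) ℂ} {b : Fin 8 → Fin 4 → ℂ}
    (hQ : IsRegularNet Q) (hb : IsBaseLocus Q b) :
    ∃ e : doubleCover Q b ≅ curve Q ⨿ curve Q,
      e.hom ≫ coprod.desc (𝟙 (curve Q)) (𝟙 (curve Q)) = doubleCoverMap Q b := by
  obtain ⟨K, _, _, ⟨F⟩⟩ := exists_curveFunctionField isHomogeneous_discriminant (by norm_num)
    (prime_discriminant hQ)
  obtain ⟨hξ, r, c, z, hr, hc, hz⟩ := exists_sq_eq_prod_tangentPlane hQ hb F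
    (genericPlane F (b 0)) rfl
  have hr0 : r ≠ 0 := by
    rintro rfl
    rw [zero_pow two_ne_zero, eq_comm, Finset.prod_eq_zero_iff] at hr
    obtain ⟨i, -, hi⟩ := hr
    exact hξ i hi
  have hr' : (-r) ^ 2 = _ := (neg_sq r).trans hr
  obtain ⟨π₀, hπ₀⟩ := exists_generic_isCoordMor F hQ hb hr
  obtain ⟨π₁, hπ₁⟩ := exists_generic_isCoordMor F hQ hb hr'
  obtain ⟨g₀, hg₀⟩ := exists_lift_reducedSubscheme π₀ (incidenceSet Q b)
    (mem_closure_incidencePoints F hQ hb hr hπ₀)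
  obtain ⟨g₁, hg₁⟩ := exists_lift_reducedSubscheme π₁ (incidenceSet Q b)
    (mem_closure_incidencePoints F hQ hb hr' hπ₁)
  let y : Spec (.of (FractionRing (MvPolynomial (Fin 4) K))) := IsLocalRing.closedPoint _
  have h₀ : reducedSubschemeι (incidenceSet Q b) (g₀ y) = π₀ y := congr($hg₀ y)
  have h₁ : reducedSubschemeι (incidenceSet Q b) (g₁ y) = π₁ y := congr($hg₁ y)
  have hind := isInducing_reducedSubschemeι (incidenceSet Q b)
  have h01 : ¬ g₀ y ⤳ g₁ y := by
    rw [← hind.specializes_iff, h₀, h₁]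
    exact not_specializes_of_neg F hc hr0 (hξ 0) hz hπ₀ hπ₁ y y
  have h10 : ¬ g₁ y ⤳ g₀ y := by
    rw [← hind.specializes_iff, h₀, h₁]
    -- Exchanging the two points replaces `(c, r)` by `(-c, -r)`, which leaves the relation with the
    -- `z i` unchanged.
    refine not_specializes_of_neg F (neg_ne_zero.mpr hc) (neg_ne_zero.mpr hr0) (hξ 0) (z := z) ?_
      hπ₁ ((neg_neg r).symm ▸ hπ₀) y y
    rw [hz, map_neg]
    ring
  have hcov (x : incidence Q b) : g₀ y ⤳ x ∨ g₁ y ⤳ x := by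
    rw [← hind.specializes_iff, ← hind.specializes_iff, h₀, h₁]
    refine specializes_of_mem_closure_incidencePoints (fun z hz ↦
      specializes_of_mem_incidencePoints F hQ hb hr hπ₀ hπ₁ hz y) ?_
    rw [← coe_incidenceSet, ← range_reducedSubschemeι]
    exact ⟨x, rfl⟩
  refine exists_steinFactor_absNormalization_iso (incidenceToCurve Q b) ![g₀ y, g₁ y] ?_ ?_ ?_
  · refine List.nodup_ofFn.mp ?_
    simpa using fun h : g₀ y = g₁ y ↦ h01 (specializes_of_eq h)
  · rw [genericPoints_eq_pair hcov h01 h10, Matrix.range_cons_cons_empty]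
  · intro i
    fin_cases i
    · exact isIso_fromNormalization_residueField F hQ hπ₀ hg₀
    · exact isIso_fromNormalization_residueField F hQ hπ₁ hg₁

end CayleyOctad

end

theorem proposition3 (Q : Fin 3 → Matrix (Fin 4) (Fin 4) ℂ) (b : Fin 8 → Fin 4 → ℂ)
    (hQ : CayleyOctad.IsRegularNet Q) (hb : CayleyOctad.IsBaseLocus Q b) :
    ∃ e : CayleyOctad.doubleCover Q b ≅ CayleyOctad.curve Q ⨿ CayleyOctad.curve Q,
      e.hom ≫ coprod.desc (𝟙 (CayleyOctad.curve Q)) (𝟙 (CayleyOctad.curve Q)) =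
        CayleyOctad.doubleCoverMap Q b := by
  exact CayleyOctad.exists_doubleCover_iso hQ hb
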